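/- Let $d\ge 5$, write $r(x)=|x|$ and $\|\cdot\|$ for the $L^2(\mathbb R^d)$ norm, and put $$C_{\mathrm H}=\tfrac{(d-2)^2}{4},\qquad C_{\mathrm R}=\tfrac{d^2(d-4)^2}{16},\qquad C_{\mathrm{HR}}=\tfrac{d^2}{4}.$$ Let $V\colon\mathbb R^d\to\mathbb C$ satisfy $V\in L^1_{\mathrm{loc}}(\mathbb R^d)$ and $r^2V\in L^2_{\mathrm{loc}}(\mathbb R^d)$, and let $a\ge 0$ be such that $$\int_{\mathbb R^d} r^4|V|^2|\psi|^2\le a^2\int_{\mathbb R^d}\frac{|\nabla\psi|^2}{r^2}\qquad\text{for all }\psi\in H^2(\mathbb R^d)$$ and $$\frac{4d^2(d-3)}{(d-2)(d-4)}\,\frac{a}{\sqrt{C_{\mathrm H}}}+\frac{4d\sqrt d}{(d-4)\sqrt{(d-2)(d-4)}}\,\frac{a^{3/2}}{\sqrt{C_{\mathrm H}}^{\,3/2}}<1 .$$ Then the number $$c_{a,d}:=\frac{\sqrt{C_{\mathrm{HR}}}}{\sqrt{C_{\mathrm R}}\sqrt{C_{\mathrm{HR}}}-a}$$ is well defined and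 positive, and there is a constant $c>0$ such that for every $z\in\mathbb C$, every $f\colon\mathbb R^d\to\mathbb C$ with $r^2f\in L^2(\mathbb R^d)$ and every weak solution $u\in H^2(\mathbb R^d)$ of $(\Delta^2+V-z)u=f$, that is, every $u\in H^2(\mathbb R^d)$ with $$\int_{\mathbb R^d}\Delta u\,\Delta\varphi+\int_{\mathbb R^d}Vu\,\varphi=z\int_{\mathbb R^d}u\,\varphi+\int_{\mathbb R^d}f\varphi\qquad\text{for all }\varphi\in C_c^\infty(\mathbb R^d;\mathbb C),$$ the following hold. * If $\operatorname{Re}z\ge 0$, then $(\partial_ju)^-\in H^1(\mathbb R^d)$ for $j=1,\dots,d$ and $$\sum_{j=1}^d\|\nabla(\partial_ju)^-\|\le c\,\|r^2f\|,$$ where, for a function $v$, $v^-(x):=e^{-i(\operatorname{Re}\sqrt z)^{1/2}\operatorname{sgn}(\operatorname{Im}\sqrt z)|x|}\,v(x)$, with $\sqrt z$ the principal square root and $\operatorname{sgn}0=0$. * If $\operatorname{Re}z<0$, then $\|\Delta u\|\le c_{a,d}\,\|r^2f\|$. -/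

import Mathlib

open MeasureTheory

noncomputable section

namespace Bilaplacian

/-- The Euclidean space `ℝ^d`. -/
abbrev Space (d : ℕ) : Type := EuclideanSpace ℝ (Fin d)

/-- Complex test functions, `C_c^∞(ℝ^d)`. -/
def IsTest {d : ℕ} (φ : Space d → ℂ) : Prop :=
  ContDiff ℝ (⊤ : ℕ∞) φ ∧ HasCompactSupport φ

/-- `w` is a weak (distributional) partial derivative `∂_j v`. -/
def HasWeakPartial {d : ℕ} (j : Fin d) (v w : Space d → ℂ) : Prop :=
  LocallyIntegrable v volume ∧ LocallyIntegrable w volume ∧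
    ∀ φ : Space d → ℂ, IsTest φ →
      ∫ x, v x * fderiv ℝ φ x (EuclideanSpace.single j 1) = -∫ x, w x * φ x

open Classical in
/-- The weak partial derivative `∂_j v` (unique almost everywhere when it exists; `0` is a
placeholder when there is none). -/
def weakPartial {d : ℕ} (j : Fin d) (v : Space d → ℂ) : Space d → ℂ :=
  if h : ∃ w, HasWeakPartial j v w then h.choose else 0

/-- The weak gradient `∇v`, with values in `ℂ^d` with the Hermitian norm. -/
def weakGrad {d : ℕ} (v : Space d → ℂ) (x : Space d) : EuclideanSpace ℂ (Fin d) :=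
  WithLp.toLp 2 fun k => weakPartial k v x

/-- The weak Laplacian `Δv = ∑_j ∂_j ∂_j v`. -/
def weakLaplacian {d : ℕ} (v : Space d → ℂ) (x : Space d) : ℂ :=
  ∑ j, weakPartial j (weakPartial j v) x

/-- `v ∈ H¹(ℝ^d)`. -/
def MemH1 {d : ℕ} (v : Space d → ℂ) : Prop :=
  MemLp v 2 volume ∧ ∀ j, ∃ w, HasWeakPartial j v w ∧ MemLp w 2 volume

/-- `v ∈ H²(ℝ^d)`: `v` and all its first partial derivatives belong to `H¹(ℝ^d)`. -/
def MemH2 {d : ℕ} (v : Space d → ℂ) : Prop :=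
  MemH1 v ∧ ∀ j, MemH1 (weakPartial j v)

/-- `v ∈ L²_loc(ℝ^d)`. -/
def MemL2Loc {d : ℕ} (v : Space d → ℂ) : Prop :=
  ∀ K : Set (Space d), IsCompact K → MemLp v 2 (volume.restrict K)

/-- The `L²(ℝ^d)` norm, with value `∞` outside of `L²`. -/
def normL2 {d : ℕ} {F : Type*} [NormedAddCommGroup F] (g : Space d → F) : ENNReal :=
  eLpNorm g 2 volume

/-- The function `r² g`, where `r(x) = |x|`. -/
def rsq {d : ℕ} (g : Space d → ℂ) (x : Space d) : ℂ :=
  ((‖x‖ ^ 2 : ℝ) : ℂ) * g x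

/-- The Hardy constant. -/
def CH (d : ℕ) : ℝ := ((d : ℝ) - 2) ^ 2 / 4

/-- The Rellich constant. -/
def CR (d : ℕ) : ℝ := (d : ℝ) ^ 2 * ((d : ℝ) - 4) ^ 2 / 16

/-- The Hardy-Rellich constant. -/
def CHR (d : ℕ) : ℝ := (d : ℝ) ^ 2 / 4

/-- Smallness of the constant `a`. -/
def SmallConstant (d : ℕ) (a : ℝ) : Prop :=
  4 * (d : ℝ) ^ 2 * ((d : ℝ) - 3) / (((d : ℝ) - 2) * ((d : ℝ) - 4)) * (a / √(CH d))
    + 4 * (d : ℝ) * √(d : ℝ) / (((d : ℝ) - 4) * √(((d : ℝ) - 2) * ((d : ℝ) - 4)))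
      * (a ^ (3 / 2 : ℝ) / √(CH d) ^ (3 / 2 : ℝ)) < 1

/-- `∫ r⁴ |V|² |ψ|² ≤ a² ∫ |∇ψ|² / r²` for all `ψ ∈ H²(ℝ^d)`, both sides being integrals of
non-negative functions with values in `[0, ∞]`. -/
def SmallPotential {d : ℕ} (V : Space d → ℂ) (a : ℝ) : Prop :=
  ∀ ψ : Space d → ℂ, MemH2 ψ →
    ∫⁻ x, ENNReal.ofReal (‖x‖ ^ 4 * ‖V x‖ ^ 2 * ‖ψ x‖ ^ 2)
      ≤ ENNReal.ofReal (a ^ 2) * ∫⁻ x, ENNReal.ofReal (‖weakGrad ψ x‖ ^ 2 / ‖x‖ ^ 2)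

/-- `u` solves `(Δ² + V - z) u = f` in the weak sense:
`∫ Δu Δφ + ∫ V u φ = z ∫ u φ + ∫ f φ` for all test functions `φ`. -/
def IsWeakSolution {d : ℕ} (V : Space d → ℂ) (z : ℂ) (f u : Space d → ℂ) : Prop :=
  ∀ φ : Space d → ℂ, IsTest φ →
    (∫ x, weakLaplacian u x * Laplacian.laplacian φ x) + ∫ x, V x * u x * φ x
      = z * (∫ x, u x * φ x) + ∫ x, f x * φ x

/-- The gauge transform `v⁻(x) = exp(-i (Re √z)^{1/2} sgn(Im √z) |x|) v(x)`, with the principal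
square root `√z` and `sgn 0 = 0`. -/
def gauge {d : ℕ} (z : ℂ) (v : Space d → ℂ) (x : Space d) : ℂ :=
  Complex.exp (-Complex.I *
    ((√(Complex.sqrt z).re * Real.sign (Complex.sqrt z).im * ‖x‖ : ℝ) : ℂ)) * v x

/-- The constant `c_{a,d} = √C_HR / (√C_R √C_HR - a)`. -/
def cConst (d : ℕ) (a : ℝ) : ℝ := √(CHR d) / (√(CR d) * √(CHR d) - a)

end Bilaplacian

end

/-!
Why the estimates hold. Everything is first proved for smooth square integrable functions
satisfying `Δ²u = z u + g`, with constants that do not depend on `z`, by multiplier identities. Each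
identity is the divergence of an explicit vector field, integrated by `integral_le_of_div`, which
disposes of the boundary terms at the origin and at infinity by a logarithmic cutoff.

For `Re z ≤ 0` one tests the equation with `ū` and `Δu` with `ū / |x|²`. Together with Hardy's
inequality this relates the norms of `Δu`, `∇u / |x|`, `u / |x|²` and `|x|² g`
(`IsRegular.rellich_bounds`). The elementary `rellich_algebra` extracts from these relations
`(√C_R - a / √C_HR) ‖Δu‖ + a ‖∇u / |x|‖ ≤ ‖|x|² g‖`, sharp enough to give the constant `c_{a,d}`.

For `Re z ≥ 0` let `k = √z`, so that `|Im k| ≤ Re k`, and factor `Δ² - z = (Δ - k)(Δ + k)`. With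
`w = (Δ + k) u` the elliptic equation `(Δ - k) w = g` bounds `|x| ∇w` by `|x|² g`. Every derivative
`∂_j u` solves the Helmholtz equation `(Δ + k) ∂_j u = ∂_j w`, and the radiation-gauge multiplier
`2 x · ∇q̄ + (d - 1) q̄ + τ |x| q̄`, applied to `q = e^{-iθ|x|} ∂_j u` with `θ = √(Re k) sgn(Im k)`,
bounds `∇q` by `|x| ∂_j w` (`integral_gradSq_le_of_gauge`, `IsRegular.gauge_bounds`). By Hardy's
inequality the same quantity controls `∇u / |x|`.

A weak solution is reduced to this situation by mollification, with `g` the mollification of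
`f - V u`. Mollification is asymptotically non-expansive in `L²(|x|⁴ dx)`
(`exists_tendsto_weighted_conv`), which uses that `|x|⁻⁴` is locally integrable for `d ≥ 5`, and
Fatou's lemma passes the bounds to the limit. The hypothesis on `V` bounds `|x|² V u` by
`a ‖∇u / |x|‖`, finite by Hardy's inequality, and the smallness of `a` allows this term to be
absorbed.
-/

namespace Bilaplacian

open Filter Topology Set

/-! ### Partial derivatives -/

/-- The classical partial derivative `∂_i f`. -/
noncomputable def pd {d : ℕ} (i : Fin d) (f : Space d → ℂ) (x : Space d) : ℂ :=
  fderiv ℝ f x (EuclideanSpace.single i 1)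

/-- `f` is differentiable at `x` and `c` is its partial derivative `∂_i f(x)`. -/
def HasPd {d : ℕ} (i : Fin d) (f : Space d → ℂ) (c : ℂ) (x : Space d) : Prop :=
  DifferentiableAt ℝ f x ∧ pd i f x = c

section calculus

variable {d : ℕ} {i : Fin d} {f g : Space d → ℂ} {a b : ℂ} {x : Space d}

theorem DifferentiableAt.hasPd (i : Fin d) (h : DifferentiableAt ℝ f x) :
    HasPd i f (pd i f x) x := ⟨h, rfl⟩

theorem HasFDerivAt.hasPd {L : Space d →L[ℝ] ℂ} (i : Fin d) (h : HasFDerivAt f L x) :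
    HasPd i f (L (EuclideanSpace.single i 1)) x :=
  ⟨h.differentiableAt, by rw [pd, h.fderiv]⟩

theorem HasPd.hasFDerivAt (h : HasPd i f a x) :
    ∃ L : Space d →L[ℝ] ℂ, HasFDerivAt f L x ∧ L (EuclideanSpace.single i 1) = a :=
  ⟨_, h.1.hasFDerivAt, h.2⟩

theorem HasPd.congr_val (h : HasPd i f a x) (hab : a = b) : HasPd i f b x := hab ▸ h

theorem HasPd.congr_of_eventuallyEq (h : HasPd i f a x) (hfg : g =ᶠ[𝓝 x] f) : HasPd i g a x :=
  ⟨h.1.congr_of_eventuallyEq hfg, by rw [pd, hfg.fderiv_eq]; exact h.2⟩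

theorem HasPd.add (hf : HasPd i f a x) (hg : HasPd i g b x) :
    HasPd i (fun y => f y + g y) (a + b) x := by
  obtain ⟨L, hL, rfl⟩ := hf.hasFDerivAt
  obtain ⟨M, hM, rfl⟩ := hg.hasFDerivAt
  exact HasFDerivAt.hasPd i (hL.add hM)

theorem HasPd.sub (hf : HasPd i f a x) (hg : HasPd i g b x) :
    HasPd i (fun y => f y - g y) (a - b) x := by
  obtain ⟨L, hL, rfl⟩ := hf.hasFDerivAt
  obtain ⟨M, hM, rfl⟩ := hg.hasFDerivAt
  exact HasFDerivAt.hasPd i (hL.sub hM)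

theorem HasPd.mul (hf : HasPd i f a x) (hg : HasPd i g b x) :
    HasPd i (fun y => f y * g y) (a * g x + f x * b) x := by
  obtain ⟨L, hL, rfl⟩ := hf.hasFDerivAt
  obtain ⟨M, hM, rfl⟩ := hg.hasFDerivAt
  refine (HasFDerivAt.hasPd i (hL.mul hM)).congr_val ?_
  simp
  ring

theorem hasPd_const (c : ℂ) : HasPd i (fun _ : Space d => c) 0 x :=
  (HasFDerivAt.hasPd i (hasFDerivAt_const c x)).congr_val (by simp)

theorem HasPd.const_mul (c : ℂ) (hf : HasPd i f a x) : HasPd i (fun y => c * f y) (c * a) x :=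
  ((hasPd_const c).mul hf).congr_val (by ring)

theorem HasPd.sum {ι : Type*} (s : Finset ι) {F : ι → Space d → ℂ} {A : ι → ℂ}
    (h : ∀ l ∈ s, HasPd i (F l) (A l) x) :
    HasPd i (fun y => ∑ l ∈ s, F l y) (∑ l ∈ s, A l) x := by
  have h' : HasFDerivAt (fun y => ∑ l ∈ s, F l y) (∑ l ∈ s, fderiv ℝ (F l) x) x :=
    HasFDerivAt.fun_sum fun l hl => (h l hl).1.hasFDerivAt
  refine (HasFDerivAt.hasPd i h').congr_val ?_
  rw [sum_apply]
  exact Finset.sum_congr rfl fun l hl => (h l hl).2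

theorem HasPd.conj (hf : HasPd i f a x) :
    HasPd i (fun y => starRingEnd ℂ (f y)) (starRingEnd ℂ a) x := by
  obtain ⟨L, hL, rfl⟩ := hf.hasFDerivAt
  have := (Complex.conjCLE.toContinuousLinearMap.hasFDerivAt (x := f x)).comp x hL
  exact (HasFDerivAt.hasPd i this).congr_val (by simp)

theorem HasPd.cexp (hf : HasPd i f a x) :
    HasPd i (fun y => Complex.exp (f y)) (Complex.exp (f x) * a) x := by
  obtain ⟨L, hL, rfl⟩ := hf.hasFDerivAt
  exact (HasFDerivAt.hasPd i hL.cexp).congr_val (by simp)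

theorem hasPd_coord (i l : Fin d) (x : Space d) :
    HasPd i (fun y : Space d => ((y l : ℝ) : ℂ)) (if l = i then 1 else 0) x := by
  have h := (Complex.ofRealCLM.comp (EuclideanSpace.proj (𝕜 := ℝ) l)).hasFDerivAt (x := x)
  refine (HasFDerivAt.hasPd i h).congr_val ?_
  simp
  split_ifs <;> simp

theorem hasPd_norm_sq (i : Fin d) (x : Space d) :
    HasPd i (fun y : Space d => ((‖y‖ : ℝ) : ℂ) ^ 2) (2 * (x i : ℂ)) x := by
  have h := (Complex.ofRealCLM.hasFDerivAt (x := ‖x‖ ^ 2)).comp x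
    (hasStrictFDerivAt_norm_sq x).hasFDerivAt
  have h2 : HasPd i (fun y : Space d => ((‖y‖ ^ 2 : ℝ) : ℂ)) (2 * (x i : ℂ)) x := by
    refine (HasFDerivAt.hasPd i h).congr_val ?_
    simp [EuclideanSpace.inner_single_right]
  simpa using h2

theorem hasPd_norm (i : Fin d) (hx : x ≠ 0) :
    HasPd i (fun y : Space d => ((‖y‖ : ℝ) : ℂ)) ((x i : ℂ) / ‖x‖) x := by
  have hx' : ‖x‖ ≠ 0 := norm_ne_zero_iff.2 hx
  have h1 : DifferentiableAt ℝ (fun y : Space d => ((‖y‖ : ℝ) : ℂ)) x :=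
    (Complex.ofRealCLM.differentiableAt).comp x (differentiableAt_id.norm ℝ hx)
  have h2 := DifferentiableAt.hasPd i h1
  have h3 := (h2.mul h2).2
  have h4 := (hasPd_norm_sq i x).2
  simp only [pow_two] at h4
  refine h2.congr_val ?_
  rw [h3] at h4
  have : ((‖x‖ : ℝ) : ℂ) ≠ 0 := by exact_mod_cast hx'
  field_simp
  linear_combination h4 / 2

theorem sum_coord_sq (x : Space d) : ∑ i, (x i : ℂ) * (x i : ℂ) = (‖x‖ : ℂ) ^ 2 := by
  have := EuclideanSpace.real_norm_sq_eq x
  rw [← Complex.ofReal_pow, this]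
  push_cast
  exact Finset.sum_congr rfl fun i _ => by ring

theorem continuousOn_pd {s : Set (Space d)} (hs : IsOpen s) (i : Fin d)
    (hf : ContDiffOn ℝ 1 f s) : ContinuousOn (pd i f) s :=
  (hf.continuousOn_fderiv_of_isOpen hs le_rfl).clm_apply continuousOn_const

theorem contDiff_pd {n m : WithTop ℕ∞} (hmn : m + 1 ≤ n) (i : Fin d) (hf : ContDiff ℝ n f) :
    ContDiff ℝ m (pd i f) :=
  (hf.fderiv_right hmn).clm_apply contDiff_const

theorem pd_comm (hf : ContDiff ℝ 2 f) (i j : Fin d) (x : Space d) :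
    pd i (pd j f) x = pd j (pd i f) x := by
  have hd : DifferentiableAt ℝ (fderiv ℝ f) x :=
    (hf.fderiv_right (m := 1) (by norm_num)).differentiable (by norm_num) x
  have key : ∀ k l : Fin d, pd k (pd l f) x
      = fderiv ℝ (fderiv ℝ f) x (EuclideanSpace.single k 1) (EuclideanSpace.single l 1) := by
    intro k l
    have : HasFDerivAt (pd l f) _ x :=
      hd.hasFDerivAt.clm_apply (hasFDerivAt_const (EuclideanSpace.single l (1 : ℝ)) x)
    rw [pd, this.fderiv]
    simp
  rw [key, key]
  exact (hf.contDiffAt.isSymmSndFDerivAt (by simp)) _ _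

end calculus

/-! ### Cutting off near the origin and near infinity -/

/-- Logarithmic cutoffs: `C¹` functions supported away from `0` and `∞` that converge to `1`
off the origin, with `∂_i ζ_n = b_n x_i / |x|²` and `b_n = O(1/n)` uniformly. -/
theorem exists_cutoff (d : ℕ) : ∃ (M : ℝ) (ζ b : ℕ → Space d → ℝ), 0 ≤ M ∧
    (∀ n, ContDiff ℝ 1 (ζ n)) ∧ (∀ n, HasCompactSupport (ζ n)) ∧
    (∀ n, (0 : Space d) ∉ tsupport (ζ n)) ∧ (∀ n x, 0 ≤ ζ n x) ∧ (∀ n x, ζ n x ≤ 1) ∧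
    (∀ x, x ≠ 0 → ∀ᶠ n in atTop, ζ n x = 1) ∧
    (∀ n x, |b n x| ≤ M / (n + 1)) ∧
    ∀ n i x, pd i (fun y => (ζ n y : ℂ)) x = b n x * x i / (‖x‖ : ℂ) ^ 2 := by
  let β : ContDiffBump (0 : ℝ) := ⟨1, 2, by norm_num, by norm_num⟩
  have hβd : Continuous (deriv β) := (β.contDiff (n := 1)).continuous_deriv le_rfl
  obtain ⟨M, hM⟩ := hβd.bounded_above_of_compact_support β.hasCompactSupport.deriv
  have hM0 : 0 ≤ M := (norm_nonneg _).trans (hM 0)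
  let L : ℕ → Space d → ℝ := fun n x => Real.log (‖x‖ ^ 2) / (n + 1)
  let ζ : ℕ → Space d → ℝ := fun n x => if x = 0 then 0 else β (L n x)
  have hpos : ∀ n : ℕ, (0 : ℝ) < n + 1 := fun n => by positivity
  have hev : ∀ n x, x ≠ 0 → ζ n =ᶠ[𝓝 x] fun y => β (L n y) := by
    intro n x hx
    filter_upwards [isOpen_ne.mem_nhds hx] with y hy
    simp [ζ, show y ≠ 0 from hy]
  -- near the origin the logarithm is large and the cutoff vanishes
  have hsmall : ∀ (n : ℕ) (x : Space d), ‖x‖ ^ 2 < Real.exp (-(2 * (n + 1))) → ζ n x = 0 := by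
    intro n x hx
    by_cases h0 : x = 0
    · simp [ζ, h0]
    have hx0 : 0 < ‖x‖ ^ 2 := by positivity
    have hl : Real.log (‖x‖ ^ 2) < -(2 * (n + 1)) := (Real.log_lt_iff_lt_exp hx0).2 hx
    simp only [ζ, h0, if_false]
    apply β.zero_of_le_dist
    rw [Real.dist_eq, sub_zero]
    have : L n x ≤ -2 := by
      rw [div_le_iff₀ (hpos n)]; linarith
    change (2 : ℝ) ≤ |L n x|
    rw [abs_of_nonpos (by linarith)]; linarith
  have hlarge : ∀ (n : ℕ) (x : Space d), Real.exp (2 * (n + 1)) < ‖x‖ ^ 2 → ζ n x = 0 := by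
    intro n x hx
    by_cases h0 : x = 0
    · simp [ζ, h0]
    have hx0 : 0 < ‖x‖ ^ 2 := by positivity
    have hl : 2 * (n + 1) < Real.log (‖x‖ ^ 2) := (Real.lt_log_iff_exp_lt hx0).2 hx
    simp only [ζ, h0, if_false]
    apply β.zero_of_le_dist
    rw [Real.dist_eq, sub_zero]
    have : 2 ≤ L n x := by
      rw [le_div_iff₀ (hpos n)]; linarith
    exact this.trans (le_abs_self _)
  have hnear : ∀ n, ∀ᶠ x in 𝓝 (0 : Space d), ζ n x = 0 := by
    intro n
    have : Tendsto (fun x : Space d => ‖x‖ ^ 2) (𝓝 0) (𝓝 0) := by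
      have : Continuous fun x : Space d => ‖x‖ ^ 2 := by fun_prop
      simpa using this.tendsto 0
    filter_upwards [this.eventually_lt_const (Real.exp_pos (-(2 * (n + 1) : ℝ)))] with x hx
    exact hsmall n x hx
  have hL : ∀ n x, x ≠ 0 → HasFDerivAt (L n)
      ((1 / (n + 1 : ℝ)) • ((‖x‖ ^ 2)⁻¹ • (2 • innerSL ℝ x))) x := by
    intro n x hx
    have h1 := ((hasStrictFDerivAt_norm_sq x).hasFDerivAt).log (by positivity)
    have h2 := h1.const_mul (1 / (n + 1 : ℝ))
    exact h2.congr_of_eventuallyEq (Eventually.of_forall fun y => by simp only [L]; ring)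
  refine ⟨2 * M, ζ, fun n x => if x = 0 then 0 else deriv β (L n x) * (2 / (n + 1)), by positivity,
    ?_, ?_, ?_, ?_, ?_, ?_, ?_, ?_⟩
  · intro n
    rw [contDiff_iff_contDiffAt]
    intro x
    by_cases hx : x = 0
    · subst hx
      exact (contDiffAt_const (c := (0 : ℝ))).congr_of_eventuallyEq (hnear n)
    · refine ContDiffAt.congr_of_eventuallyEq ?_ (hev n x hx)
      have h1 : ContDiffAt ℝ 1 (L n) x := by
        apply ContDiffAt.div_const
        exact ContDiffAt.log (contDiff_norm_sq ℝ).contDiffAt (by positivity)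
      exact β.contDiff.contDiffAt.comp x h1
  · intro n
    refine HasCompactSupport.intro (isCompact_closedBall (0 : Space d)
      (Real.sqrt (Real.exp (2 * (n + 1))))) fun x hx => hlarge n x ?_
    rw [mem_closedBall_zero_iff, not_le] at hx
    exact (Real.sqrt_lt' (lt_of_le_of_lt (Real.sqrt_nonneg _) hx)).1 hx
  · intro n
    rw [notMem_tsupport_iff_eventuallyEq]
    exact hnear n
  · intro n x
    by_cases hx : x = 0
    · simp [ζ, hx]
    · simp only [ζ, hx, if_false]; exact β.nonneg
  · intro n x
    by_cases hx : x = 0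
    · simp [ζ, hx]
    · simp only [ζ, hx, if_false]; exact β.le_one
  · intro x hx
    obtain ⟨N, hN⟩ := exists_nat_ge |Real.log (‖x‖ ^ 2)|
    filter_upwards [eventually_ge_atTop N] with n hn
    simp only [ζ, hx, if_false]
    apply β.one_of_mem_closedBall
    rw [mem_closedBall_zero_iff, Real.norm_eq_abs]
    change |Real.log (‖x‖ ^ 2) / (n + 1)| ≤ 1
    rw [abs_div, abs_of_pos (hpos n), div_le_one (hpos n)]
    have : (N : ℝ) ≤ n := by exact_mod_cast hn
    linarith
  · intro n x
    by_cases hx : x = 0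
    · simp only [hx, if_true, abs_zero]; positivity
    · simp only [hx, if_false, abs_mul, abs_of_pos (show (0 : ℝ) < 2 / (n + 1) by positivity)]
      calc |deriv β (L n x)| * (2 / (n + 1)) ≤ M * (2 / (n + 1)) := by
            gcongr; exact hM _
        _ = 2 * M / (n + 1) := by ring
  · intro n i x
    by_cases hx : x = 0
    · subst hx
      have : (fun y : Space d => (ζ n y : ℂ)) =ᶠ[𝓝 0] fun _ => 0 := by
        filter_upwards [hnear n] with y hy
        simp [hy]
      rw [pd, this.fderiv_eq]
      simp
    · have h1 : HasFDerivAt (ζ n) _ x :=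
        (((β.contDiff (n := 1)).differentiable (by simp) (L n x)).hasDerivAt.comp_hasFDerivAt x
          (hL n x hx)).congr_of_eventuallyEq (hev n x hx)
      have h2 := (Complex.ofRealCLM.hasFDerivAt (x := ζ n x)).comp x h1
      have h3 := (HasFDerivAt.hasPd i h2).2
      change pd i (fun y => (ζ n y : ℂ)) x = _ at h3
      rw [h3]
      simp only [hx, if_false]
      simp [EuclideanSpace.inner_single_right]
      ring

variable {d : ℕ}

/-- The origin is negligible. -/
theorem ae_ne_zero [NeZero d] : ∀ᵐ x : Space d, x ≠ 0 := by
  have : (volume : Measure (Space d)) {0} = 0 := measure_singleton 0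
  rw [ae_iff]
  simp

theorem aestronglyMeasurable_of_continuousOn_ne_zero [NeZero d] {F : Type*} [NormedAddCommGroup F]
    [SecondCountableTopology F] {f : Space d → F}
    (hf : ContinuousOn f {0}ᶜ) : AEStronglyMeasurable f volume := by
  have h := hf.aestronglyMeasurable (μ := volume) (isOpen_compl_singleton.measurableSet)
  rwa [Measure.restrict_eq_self_of_ae_mem] at h
  exact ae_ne_zero

theorem integrable_of_support_subset_compact {F : Type*} [NormedAddCommGroup F]
    {f : Space d → F} {K : Set (Space d)} (hK : IsCompact K) (hf : ContinuousOn f K)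
    (hs : Function.support f ⊆ K) : Integrable f volume :=
  (integrableOn_iff_integrable_of_support_subset hs).1 (hf.integrableOn_compact hK)

/-- Integrating a differential inequality `φ ≤ ψ + Re div G` that holds off the origin. No decay
of `G` is needed beyond `t |x · G| ≤ |x|² (t² φ + K)` for `t ∈ [0, 1]` with `K` integrable: the
gradient of a logarithmic cutoff is `o(1) / |x|`, so the boundary terms disappear in the limit. -/
theorem integral_le_of_div [NeZero d] {φ ψ K : Space d → ℝ} {G : Fin d → Space d → ℂ}
    (hφ : ContinuousOn φ {0}ᶜ) (hφ0 : ∀ x, x ≠ 0 → 0 ≤ φ x)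
    (hψ : Integrable ψ volume) (hK : Integrable K volume)
    (hG : ∀ i, ContDiffOn ℝ 1 (G i) {0}ᶜ)
    (hdiv : ∀ x, x ≠ 0 → φ x ≤ ψ x + (∑ i, pd i (G i) x).re)
    (hflux : ∀ x, x ≠ 0 → ∀ t ∈ Icc (0 : ℝ) 1,
      t * |(∑ i, (x i : ℂ) * G i x).re| ≤ ‖x‖ ^ 2 * (t ^ 2 * φ x + K x)) :
    Integrable φ volume ∧ ∫ x, φ x ≤ ∫ x, ψ x := by
  obtain ⟨M, ζ, b, hM, hζd, hζc, hζ0, hζnn, hζ1, hζlim, hb, hpd⟩ := exists_cutoff d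
  have hopen : IsOpen ({0}ᶜ : Set (Space d)) := isOpen_compl_singleton
  have hsub : ∀ n, tsupport (ζ n) ⊆ {0}ᶜ := fun n x hx h0 => hζ0 n (by rwa [← h0])
  have hζcont : ∀ n, Continuous (ζ n) := fun n => (hζd n).continuous
  let χ : ℕ → Space d → ℂ := fun n x => (ζ n x : ℂ) * ζ n x
  have hζC : ∀ n, ContDiff ℝ 1 (fun x => (ζ n x : ℂ)) := fun n =>
    Complex.ofRealCLM.contDiff.comp (hζd n)
  have hχd : ∀ n, ContDiff ℝ 1 (χ n) := fun n => (hζC n).mul (hζC n)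
  have hχs : ∀ n, Function.support (χ n) ⊆ Function.support (ζ n) := by
    intro n x hx h0
    exact hx (by simp only [χ, h0]; simp)
  have hχts : ∀ n, tsupport (χ n) ⊆ tsupport (ζ n) := fun n => closure_mono (hχs n)
  have hχpd : ∀ n i x, pd i (χ n) x = 2 * ζ n x * (b n x * x i / (‖x‖ : ℂ) ^ 2) := by
    intro n i x
    have h := DifferentiableAt.hasPd i ((hζC n).differentiable (by simp) x)
    rw [(h.mul h).2, hpd]
    ring
  -- integration by parts against the cutoff
  have hibp : ∀ n, ∫ x, ζ n x ^ 2 * (∑ i, pd i (G i) x).re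
      = -∫ x, 2 * ζ n x * b n x * (∑ i, (x i : ℂ) * G i x).re / ‖x‖ ^ 2 := by
    intro n
    have hGd : ∀ i, ∀ x ∈ tsupport (χ n), DifferentiableAt ℝ (G i) x := fun i x hx =>
      ((hG i).differentiableOn (by simp)).differentiableAt
        (hopen.mem_nhds (hsub n (hχts n hx)))
    have hGc : ∀ i, ContinuousOn (G i) (tsupport (ζ n)) := fun i =>
      (hG i).continuousOn.mono (hsub n)
    have hGp : ∀ i, ContinuousOn (pd i (G i)) (tsupport (ζ n)) := fun i =>
      (continuousOn_pd hopen i (hG i)).mono (hsub n)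
    have hχc : Continuous (χ n) := (hχd n).continuous
    have hpc : ∀ i, Continuous (pd i (χ n)) := fun i =>
      (contDiff_pd (n := 1) (m := 0) (by norm_num) i (hχd n)).continuous
    have i1 : ∀ i, Integrable (fun x => χ n x * pd i (G i) x) volume := fun i =>
      integrable_of_support_subset_compact (hζc n) (hχc.continuousOn.mul (hGp i))
        ((Function.support_mul_subset_left _ _).trans ((hχs n).trans (subset_tsupport _)))
    have i2 : ∀ i, Integrable (fun x => pd i (χ n) x * G i x) volume := by
      intro i
      refine integrable_of_support_subset_compact (hζc n) ((hpc i).continuousOn.mul (hGc i))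
        ((Function.support_mul_subset_left _ _).trans ?_)
      intro x hx
      by_contra h
      apply hx
      rw [hχpd, show ζ n x = 0 from image_eq_zero_of_notMem_tsupport h]
      simp
    have i3 : ∀ i, Integrable (fun x => χ n x * G i x) volume := fun i =>
      integrable_of_support_subset_compact (hζc n) (hχc.continuousOn.mul (hGc i))
        ((Function.support_mul_subset_left _ _).trans ((hχs n).trans (subset_tsupport _)))
    have h1 : ∀ i, ∫ x, χ n x * pd i (G i) x = -∫ x, pd i (χ n) x * G i x := fun i =>
      integral_mul_fderiv_eq_neg_fderiv_mul_of_integrable (i2 i) (i1 i) (i3 i)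
        (fun x _ => (hχd n).differentiable (by simp) x) (hGd i)
    have h2 : ∫ x, ∑ i, χ n x * pd i (G i) x = -∫ x, ∑ i, pd i (χ n) x * G i x := by
      rw [integral_finsetSum _ fun i _ => i1 i, integral_finsetSum _ fun i _ => i2 i,
        ← Finset.sum_neg_distrib]
      exact Finset.sum_congr rfl fun i _ => h1 i
    have h3 := congrArg Complex.re h2
    rw [Complex.neg_re] at h3
    have e1 := integral_re (integrable_finsetSum _ fun i (_ : i ∈ Finset.univ) => i1 i)
    have e2 := integral_re (integrable_finsetSum _ fun i (_ : i ∈ Finset.univ) => i2 i)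
    simp only [RCLike.re_to_complex] at e1 e2
    rw [← e1, ← e2] at h3
    have f1 : (fun x => ζ n x ^ 2 * (∑ i, pd i (G i) x).re)
        = fun x => (∑ i, χ n x * pd i (G i) x).re := by
      funext x
      rw [← Finset.mul_sum, show χ n x = ((ζ n x ^ 2 : ℝ) : ℂ) by simp [χ, pow_two],
        Complex.re_ofReal_mul]
    have f2 : (fun x => 2 * ζ n x * b n x * (∑ i, (x i : ℂ) * G i x).re / ‖x‖ ^ 2)
        = fun x => (∑ i, pd i (χ n) x * G i x).re := by
      funext x
      rw [show ∑ i, pd i (χ n) x * G i x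
        = ((2 * ζ n x * b n x / ‖x‖ ^ 2 : ℝ) : ℂ) * ∑ i, (x i : ℂ) * G i x by
          rw [Finset.mul_sum]
          refine Finset.sum_congr rfl fun i _ => ?_
          rw [hχpd]; push_cast; ring]
      rw [Complex.re_ofReal_mul]
      ring
    rw [f1, f2]
    exact h3
  have intc : ∀ n (F : Space d → ℝ), ContinuousOn F {0}ᶜ →
      Integrable (fun x => ζ n x ^ 2 * F x) volume := by
    intro n F hF
    refine integrable_of_support_subset_compact (hζc n)
      (((hζcont n).pow 2).continuousOn.mul (hF.mono (hsub n))) ?_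
    intro x hx
    apply subset_tsupport
    intro h0
    apply hx
    simp [h0]
  have hψi : ∀ n, Integrable (fun x => ζ n x ^ 2 * ψ x) volume := by
    intro n
    refine hψ.bdd_mul (c := 1) ((hζcont n).pow 2).aestronglyMeasurable ?_
    filter_upwards with x
    rw [Real.norm_of_nonneg (by positivity)]
    exact pow_le_one₀ (hζnn n x) (hζ1 n x)
  have hdivc : ContinuousOn (fun x => (∑ i, pd i (G i) x).re) {0}ᶜ :=
    Complex.continuous_re.comp_continuousOn
      (continuousOn_finsetSum _ fun i _ => continuousOn_pd hopen i (hG i))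
  set κ := ∫ x, K x
  have hmain : ∀ n : ℕ, ∫ x, ζ n x ^ 2 * φ x ≤ (∫ x, ζ n x ^ 2 * ψ x)
      + 2 * M / (n + 1) * ((∫ x, ζ n x ^ 2 * φ x) + κ) := by
    intro n
    have s1 : ∫ x, ζ n x ^ 2 * φ x
        ≤ ∫ x, (ζ n x ^ 2 * ψ x + ζ n x ^ 2 * (∑ i, pd i (G i) x).re) := by
      refine integral_mono_ae (intc n φ hφ) ((hψi n).add (intc n _ hdivc)) ?_
      filter_upwards [ae_ne_zero] with x hx
      have := mul_le_mul_of_nonneg_left (hdiv x hx) (sq_nonneg (ζ n x))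
      simpa [mul_add] using this
    rw [integral_add (hψi n) (intc n _ hdivc), hibp n] at s1
    have s2 : -∫ x, 2 * ζ n x * b n x * (∑ i, (x i : ℂ) * G i x).re / ‖x‖ ^ 2
        ≤ ∫ x, 2 * M / (n + 1) * (ζ n x ^ 2 * φ x + K x) := by
      have hi : Integrable (fun x => 2 * M / (n + 1) * (ζ n x ^ 2 * φ x + K x)) volume :=
        ((intc n φ hφ).add hK).const_mul _
      refine (neg_le_abs _).trans ?_
      rw [← Real.norm_eq_abs]
      refine norm_integral_le_of_norm_le hi ?_
      filter_upwards [ae_ne_zero] with x hx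
      have hx2 : 0 < ‖x‖ ^ 2 := by positivity
      have h1 := hflux x hx (ζ n x) ⟨hζnn n x, hζ1 n x⟩
      rw [Real.norm_eq_abs, abs_div, abs_of_pos hx2, div_le_iff₀ hx2, abs_mul, abs_mul, abs_mul,
        abs_of_nonneg (hζnn n x), abs_of_nonneg (zero_le_two (α := ℝ))]
      have h2 := mul_le_mul (hb n x) h1 (mul_nonneg (hζnn n x) (abs_nonneg _)) (by positivity)
      calc _ = 2 * (|b n x| * (ζ n x * |(∑ i, (x i : ℂ) * G i x).re|)) := by ring
        _ ≤ 2 * (M / (n + 1) * (‖x‖ ^ 2 * (ζ n x ^ 2 * φ x + K x))) := by linarith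
        _ = _ := by ring
    rw [integral_const_mul, integral_add (intc n φ hφ) hK] at s2
    linarith
  have hδ : Tendsto (fun n : ℕ => 2 * M / ((n : ℝ) + 1)) atTop (𝓝 0) :=
    tendsto_const_div_atTop_nhds_zero_nat (2 * M) |>.comp (tendsto_add_atTop_nat 1) |>.congr
      fun n => by simp
  have hΨ : Tendsto (fun n : ℕ => ∫ x, ζ n x ^ 2 * ψ x) atTop (𝓝 (∫ x, ψ x)) := by
    refine tendsto_integral_of_dominated_convergence (fun x => ‖ψ x‖)
      (fun n => (hψi n).aestronglyMeasurable) hψ.norm ?_ ?_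
    · intro n
      filter_upwards with x
      rw [norm_mul, Real.norm_of_nonneg (sq_nonneg (ζ n x))]
      exact mul_le_of_le_one_left (norm_nonneg _) (pow_le_one₀ (hζnn n x) (hζ1 n x))
    · filter_upwards [ae_ne_zero] with x hx
      refine tendsto_const_nhds.congr' ?_
      filter_upwards [hζlim x hx] with n hn
      simp [hn]
  have hA0 : ∀ n, 0 ≤ ∫ x, ζ n x ^ 2 * φ x := by
    intro n
    refine integral_nonneg_of_ae ?_
    filter_upwards [ae_ne_zero] with x hx
    exact mul_nonneg (sq_nonneg _) (hφ0 x hx)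
  have hB : Tendsto (fun n : ℕ => ((∫ x, ζ n x ^ 2 * ψ x) + 2 * M / ((n : ℝ) + 1) * κ)
      / (1 - 2 * M / ((n : ℝ) + 1))) atTop (𝓝 (∫ x, ψ x)) := by
    have := (hΨ.add (hδ.mul_const κ)).div (tendsto_const_nhds.sub hδ)
      (show (1 : ℝ) - 0 ≠ 0 by norm_num)
    simp only [zero_mul, add_zero, sub_zero, div_one] at this
    exact this
  have hAB : ∀ᶠ n : ℕ in atTop, ∫ x, ζ n x ^ 2 * φ x
      ≤ ((∫ x, ζ n x ^ 2 * ψ x) + 2 * M / ((n : ℝ) + 1) * κ) / (1 - 2 * M / ((n : ℝ) + 1)) := by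
    filter_upwards [hδ.eventually_lt_const one_pos] with n hn
    rw [le_div_iff₀ (by linarith)]
    linarith [hmain n]
  have hψ0 : 0 ≤ ∫ x, ψ x := ge_of_tendsto hB (hAB.mono fun n hn => (hA0 n).trans hn)
  have hφm : AEStronglyMeasurable φ volume := aestronglyMeasurable_of_continuousOn_ne_zero hφ
  have hfatou : ∫⁻ x, ENNReal.ofReal (φ x) ≤ ENNReal.ofReal (∫ x, ψ x) := by
    calc ∫⁻ x, ENNReal.ofReal (φ x)
        = ∫⁻ x, liminf (fun n => ENNReal.ofReal (ζ n x ^ 2 * φ x)) atTop := by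
          refine lintegral_congr_ae ?_
          filter_upwards [ae_ne_zero] with x hx
          refine (Tendsto.liminf_eq (tendsto_const_nhds.congr' ?_)).symm
          filter_upwards [hζlim x hx] with n hn
          simp [hn]
      _ ≤ liminf (fun n => ∫⁻ x, ENNReal.ofReal (ζ n x ^ 2 * φ x)) atTop :=
          lintegral_liminf_le' fun n => (intc n φ hφ).aemeasurable.ennreal_ofReal
      _ = liminf (fun n => ENNReal.ofReal (∫ x, ζ n x ^ 2 * φ x)) atTop := by
          congr 1
          funext n
          rw [ofReal_integral_eq_lintegral_ofReal (intc n φ hφ)]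
          filter_upwards [ae_ne_zero] with x hx
          exact mul_nonneg (sq_nonneg _) (hφ0 x hx)
      _ ≤ liminf (fun n : ℕ => ENNReal.ofReal (((∫ x, ζ n x ^ 2 * ψ x)
            + 2 * M / ((n : ℝ) + 1) * κ) / (1 - 2 * M / ((n : ℝ) + 1)))) atTop :=
          liminf_le_liminf (hAB.mono fun n hn => ENNReal.ofReal_le_ofReal hn)
      _ = ENNReal.ofReal (∫ x, ψ x) := (ENNReal.tendsto_ofReal hB).liminf_eq
  have hφ0' : 0 ≤ᵐ[volume] φ := by
    filter_upwards [ae_ne_zero] with x hx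
    exact hφ0 x hx
  refine ⟨(lintegral_ofReal_ne_top_iff_integrable hφm hφ0').1
    (ne_top_of_le_ne_top ENNReal.ofReal_ne_top hfatou), ?_⟩
  rw [integral_eq_lintegral_of_nonneg_ae hφ0' hφm]
  exact ENNReal.toReal_le_of_le_ofReal hψ0 hfatou

/-! ### Radial vector fields built from a function and their divergences -/

/-- The squared length `|∇q|²` of the classical gradient. -/
noncomputable def gradSq (q : Space d → ℂ) (x : Space d) : ℝ := ∑ i, ‖pd i q x‖ ^ 2

/-- The Euler operator `x · ∇q`. -/
noncomputable def euler (q : Space d → ℂ) (x : Space d) : ℂ := ∑ i, (x i : ℂ) * pd i q x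

/-- The classical Laplacian as a sum of second partial derivatives. -/
noncomputable def lap (q : Space d → ℂ) (x : Space d) : ℂ := ∑ i, pd i (pd i q) x

/-- `D` is the real part of the divergence of the vector field `G` at `x`. -/
def HasReDiv (G : Fin d → Space d → ℂ) (D : ℝ) (x : Space d) : Prop :=
  (∀ i, DifferentiableAt ℝ (G i) x) ∧ (∑ i, pd i (G i) x).re = D

theorem HasReDiv.of_hasPd {G : Fin d → Space d → ℂ} {c : Fin d → ℂ} {x : Space d}
    (h : ∀ i, HasPd i (G i) (c i) x) : HasReDiv G (∑ i, c i).re x :=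
  ⟨fun i => (h i).1, by rw [Finset.sum_congr rfl fun i _ => (h i).2]⟩

theorem HasReDiv.add {G H : Fin d → Space d → ℂ} {D D' : ℝ} {x : Space d}
    (hG : HasReDiv G D x) (hH : HasReDiv H D' x) :
    HasReDiv (fun i y => G i y + H i y) (D + D') x := by
  obtain ⟨h1, rfl⟩ := hG
  obtain ⟨h2, rfl⟩ := hH
  refine ⟨fun i => (h1 i).add (h2 i), ?_⟩
  rw [← Complex.add_re, ← Finset.sum_add_distrib]
  congr 1
  exact Finset.sum_congr rfl fun i _ =>
    ((DifferentiableAt.hasPd i (h1 i)).add (DifferentiableAt.hasPd i (h2 i))).2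

theorem HasReDiv.smul {G : Fin d → Space d → ℂ} {D : ℝ} {x : Space d} (c : ℝ)
    (hG : HasReDiv G D x) : HasReDiv (fun i y => (c : ℂ) * G i y) (c * D) x := by
  obtain ⟨h1, rfl⟩ := hG
  refine ⟨fun i => (h1 i).const_mul _, ?_⟩
  rw [← Complex.re_ofReal_mul, Finset.mul_sum]
  congr 1
  exact Finset.sum_congr rfl fun i _ => ((DifferentiableAt.hasPd i (h1 i)).const_mul _).2

theorem hasPd_norm_zpow (i : Fin d) (k : ℤ) {x : Space d} (hx : x ≠ 0) :
    HasPd i (fun y : Space d => ((‖y‖ ^ k : ℝ) : ℂ)) ((k * ‖x‖ ^ (k - 2) * x i : ℝ) : ℂ) x := by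
  have hx' : ‖x‖ ≠ 0 := norm_ne_zero_iff.2 hx
  obtain ⟨L, hL, hv⟩ := (hasPd_norm i hx).hasFDerivAt
  have h1 := ((hasDerivAt_zpow k ((‖x‖ : ℝ) : ℂ)
    (Or.inl (by exact_mod_cast hx'))).hasFDerivAt.restrictScalars ℝ).comp x hL
  have h2 := HasFDerivAt.hasPd i h1
  have h3 : HasPd i (fun y : Space d => ((‖y‖ : ℝ) : ℂ) ^ k)
      ((k * ‖x‖ ^ (k - 2) * x i : ℝ) : ℂ) x := by
    refine h2.congr_val ?_
    have e : ((‖x‖ : ℝ) : ℂ) ^ (k - 1) = ((‖x‖ : ℝ) : ℂ) ^ (k - 2) * ‖x‖ := by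
      rw [← zpow_add_one₀ (by exact_mod_cast hx')]; congr 1; ring
    have hc : ((‖x‖ : ℝ) : ℂ) ≠ 0 := by exact_mod_cast hx'
    simp [hv, e]
    field_simp
  simpa using h3

theorem contDiffOn_coord (i : Fin d) {n : WithTop ℕ∞} {s : Set (Space d)} :
    ContDiffOn ℝ n (fun y : Space d => ((y i : ℝ) : ℂ)) s :=
  (Complex.ofRealCLM.comp (EuclideanSpace.proj (𝕜 := ℝ) i)).contDiff.contDiffOn

theorem contDiffOn_norm_zpow (k : ℤ) {n : WithTop ℕ∞} :
    ContDiffOn ℝ n (fun y : Space d => ((‖y‖ ^ k : ℝ) : ℂ)) {0}ᶜ := by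
  intro x hx
  have hx0 : x ≠ 0 := hx
  have h1 : ContDiffAt ℝ n (fun y : Space d => ‖y‖) x := contDiffAt_norm ℝ hx0
  have h2 : ContDiffAt ℝ n (fun y : Space d => ‖y‖ ^ k) x := by
    have hx' : ‖x‖ ≠ 0 := norm_ne_zero_iff.2 hx0
    cases k with
    | ofNat m => simpa using h1.pow m
    | negSucc m =>
      simp only [zpow_negSucc]
      exact (h1.pow (m + 1)).inv (pow_ne_zero _ hx')
  exact (Complex.ofRealCLM.contDiff.contDiffAt.comp x h2).contDiffWithinAt

theorem ContDiffOn.conj {n : WithTop ℕ∞} {s : Set (Space d)} {f : Space d → ℂ}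
    (hf : ContDiffOn ℝ n f s) : ContDiffOn ℝ n (fun y => starRingEnd ℂ (f y)) s :=
  Complex.conjCLE.toContinuousLinearMap.contDiff.comp_contDiffOn hf

theorem contDiffOn_pd {n m : WithTop ℕ∞} (hmn : m + 1 ≤ n) (i : Fin d) {f : Space d → ℂ}
    (hf : ContDiffOn ℝ n f {0}ᶜ) : ContDiffOn ℝ m (pd i f) {0}ᶜ :=
  (hf.fderiv_of_isOpen isOpen_compl_singleton hmn).clm_apply contDiffOn_const

theorem differentiableAt_of_contDiffOn {f : Space d → ℂ} (hf : ContDiffOn ℝ 1 f {0}ᶜ)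
    {x : Space d} (hx : x ≠ 0) : DifferentiableAt ℝ f x :=
  (hf.differentiableOn (by simp)).differentiableAt (isOpen_compl_singleton.mem_nhds hx)

theorem pd_comm_of_contDiffOn {f : Space d → ℂ} (hf : ContDiffOn ℝ 2 f {0}ᶜ) (i j : Fin d)
    {x : Space d} (hx : x ≠ 0) : pd i (pd j f) x = pd j (pd i f) x := by
  have hxn : ({0}ᶜ : Set (Space d)) ∈ 𝓝 x := isOpen_compl_singleton.mem_nhds hx
  have hc : ContDiffAt ℝ 2 f x := hf.contDiffAt hxn
  have hd : DifferentiableAt ℝ (fderiv ℝ f) x :=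
    (hc.fderiv_right (m := 1) (by norm_num)).differentiableAt (by norm_num)
  have key : ∀ k l : Fin d, pd k (pd l f) x
      = fderiv ℝ (fderiv ℝ f) x (EuclideanSpace.single k 1) (EuclideanSpace.single l 1) := by
    intro k l
    have : HasFDerivAt (pd l f) _ x :=
      hd.hasFDerivAt.clm_apply (hasFDerivAt_const (EuclideanSpace.single l (1 : ℝ)) x)
    rw [pd, this.fderiv]
    simp
  rw [key, key]
  exact (hc.isSymmSndFDerivAt (by simp)) _ _

theorem gradSq_nonneg (q : Space d → ℂ) (x : Space d) : 0 ≤ gradSq q x :=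
  Finset.sum_nonneg fun _ _ => by positivity

theorem gradSq_coe (q : Space d → ℂ) (x : Space d) :
    (gradSq q x : ℂ) = ∑ i, pd i q x * starRingEnd ℂ (pd i q x) := by
  simp only [gradSq, Complex.ofReal_sum]
  exact Finset.sum_congr rfl fun i _ => by rw [Complex.mul_conj']; push_cast; rfl

theorem norm_euler_le (q : Space d → ℂ) (x : Space d) :
    ‖euler q x‖ ≤ ‖x‖ * √(gradSq q x) := by
  have h1 : ‖euler q x‖ ≤ ∑ i, ‖x i‖ * ‖pd i q x‖ := by
    refine (norm_sum_le _ _).trans (Finset.sum_le_sum fun i _ => ?_)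
    simp
  have h2 := Real.sum_mul_le_sqrt_mul_sqrt Finset.univ (fun i => ‖x i‖) (fun i => ‖pd i q x‖)
  rw [EuclideanSpace.norm_eq]
  exact h1.trans h2

/-- The field `2 Re((∇q) conj(x·∇q)) - x |∇q|²`, whose divergence is the Pohozaev identity. -/
noncomputable def pohozaevField (q : Space d → ℂ) (i : Fin d) (x : Space d) : ℂ :=
  pd i q x * starRingEnd ℂ (euler q x) + starRingEnd ℂ (pd i q x) * euler q x
    - (x i : ℂ) * ∑ l, pd l q x * starRingEnd ℂ (pd l q x)

/-- The field `|x|^k ∇|q|²`. -/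
noncomputable def gradField (k : ℤ) (q : Space d → ℂ) (i : Fin d) (x : Space d) : ℂ :=
  ((‖x‖ ^ k : ℝ) : ℂ) * (pd i q x * starRingEnd ℂ (q x) + starRingEnd ℂ (pd i q x) * q x)

/-- The field `|x|^k |q|² x`. -/
noncomputable def radialField (k : ℤ) (q : Space d → ℂ) (i : Fin d) (x : Space d) : ℂ :=
  (x i : ℂ) * (((‖x‖ ^ k : ℝ) : ℂ) * (q x * starRingEnd ℂ (q x)))

section fields

variable {q : Space d → ℂ}

theorem contDiffOn_euler (hq : ContDiffOn ℝ 2 q {0}ᶜ) : ContDiffOn ℝ 1 (euler q) {0}ᶜ :=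
  ContDiffOn.sum fun i _ => (contDiffOn_coord i).mul (contDiffOn_pd (by norm_num) i hq)

theorem contDiffOn_pohozaevField (hq : ContDiffOn ℝ 2 q {0}ᶜ) (i : Fin d) :
    ContDiffOn ℝ 1 (pohozaevField q i) {0}ᶜ := by
  have h1 : ∀ l, ContDiffOn ℝ 1 (pd l q) {0}ᶜ := fun l => contDiffOn_pd (by norm_num) l hq
  have h2 := contDiffOn_euler hq
  exact (((h1 i).mul (ContDiffOn.conj h2)).add ((ContDiffOn.conj (h1 i)).mul h2)).sub
    ((contDiffOn_coord i).mul (ContDiffOn.sum fun l _ => (h1 l).mul (ContDiffOn.conj (h1 l))))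

theorem contDiffOn_gradField (k : ℤ) (hq : ContDiffOn ℝ 2 q {0}ᶜ) (i : Fin d) :
    ContDiffOn ℝ 1 (gradField k q i) {0}ᶜ := by
  have h1 : ContDiffOn ℝ 1 (pd i q) {0}ᶜ := contDiffOn_pd (by norm_num) i hq
  have h0 : ContDiffOn ℝ 1 q {0}ᶜ := hq.of_le (by norm_num)
  exact (contDiffOn_norm_zpow k).mul
    ((h1.mul (ContDiffOn.conj h0)).add ((ContDiffOn.conj h1).mul h0))

theorem contDiffOn_radialField (k : ℤ) (hq : ContDiffOn ℝ 1 q {0}ᶜ) (i : Fin d) :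
    ContDiffOn ℝ 1 (radialField k q i) {0}ᶜ :=
  (contDiffOn_coord i).mul ((contDiffOn_norm_zpow k).mul (hq.mul (ContDiffOn.conj hq)))

theorem hasReDiv_radialField (k : ℤ) (hq : ContDiffOn ℝ 1 q {0}ᶜ) {x : Space d} (hx : x ≠ 0) :
    HasReDiv (radialField k q)
      ((d + k) * ‖x‖ ^ k * ‖q x‖ ^ 2
        + 2 * ‖x‖ ^ k * (euler q x * starRingEnd ℂ (q x)).re) x := by
  have hx' : ‖x‖ ≠ 0 := norm_ne_zero_iff.2 hx
  have hc : ((‖x‖ : ℝ) : ℂ) ≠ 0 := by exact_mod_cast hx'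
  have hqd := differentiableAt_of_contDiffOn hq hx
  have h := HasReDiv.of_hasPd (x := x) (G := radialField k q) fun i =>
    (hasPd_coord i i x).mul ((hasPd_norm_zpow i k hx).mul
      ((DifferentiableAt.hasPd i hqd).mul (HasPd.conj (DifferentiableAt.hasPd i hqd))))
  convert h using 1
  have e : ((‖x‖ ^ (k - 2) : ℝ) : ℂ) * (‖x‖ : ℂ) ^ 2 = ((‖x‖ ^ k : ℝ) : ℂ) := by
    push_cast
    rw [← zpow_natCast ((‖x‖ : ℝ) : ℂ) 2, ← zpow_add₀ hc]
    congr 1; push_cast; ring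
  have : ∑ i, ((if i = i then (1 : ℂ) else 0)
        * (((‖x‖ ^ k : ℝ) : ℂ) * (q x * starRingEnd ℂ (q x)))
      + (x i : ℂ) * (((k * ‖x‖ ^ (k - 2) * x i : ℝ) : ℂ) * (q x * starRingEnd ℂ (q x))
        + ((‖x‖ ^ k : ℝ) : ℂ) * (pd i q x * starRingEnd ℂ (q x)
          + q x * starRingEnd ℂ (pd i q x))))
      = (((d + k) * ‖x‖ ^ k * ‖q x‖ ^ 2 : ℝ) : ℂ)
        + ((‖x‖ ^ k : ℝ) : ℂ) * (euler q x * starRingEnd ℂ (q x)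
          + starRingEnd ℂ (euler q x * starRingEnd ℂ (q x))) := by
    have hS : (((d + k) * ‖x‖ ^ k * ‖q x‖ ^ 2 : ℝ) : ℂ)
        = (d + k) * ((‖x‖ ^ k : ℝ) : ℂ) * (q x * starRingEnd ℂ (q x)) := by
      rw [Complex.mul_conj']; push_cast; rfl
    have hk : (k : ℂ) * ((‖x‖ ^ k : ℝ) : ℂ) = k * ((‖x‖ ^ (k - 2) : ℝ) : ℂ)
        * ∑ i, (x i : ℂ) * (x i : ℂ) := by
      rw [sum_coord_sq, mul_assoc, e]
    rw [hS, add_mul, add_mul, hk]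
    simp only [euler, map_mul, map_sum, Finset.sum_mul, Finset.mul_sum, Complex.conj_ofReal,
      Complex.conj_conj, if_true, mul_add, Finset.sum_add_distrib, Finset.sum_const,
      Finset.card_univ, Fintype.card_fin, nsmul_eq_mul, add_assoc]
    push_cast
    congr 1
    · ring
    congr 1
    · exact Finset.sum_congr rfl fun i _ => by ring
    · congr 1 <;> exact Finset.sum_congr rfl fun i _ => by ring
  rw [this, Complex.add_re, Complex.ofReal_re, Complex.re_ofReal_mul, Complex.add_re,
    Complex.conj_re]
  ring

theorem hasReDiv_gradField (k : ℤ) (hq : ContDiffOn ℝ 2 q {0}ᶜ) {x : Space d} (hx : x ≠ 0) :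
    HasReDiv (gradField k q)
      (‖x‖ ^ k * (2 * (lap q x * starRingEnd ℂ (q x)).re + 2 * gradSq q x)
        + 2 * k * ‖x‖ ^ (k - 2) * (euler q x * starRingEnd ℂ (q x)).re) x := by
  have hqd := differentiableAt_of_contDiffOn (hq.of_le (by norm_num)) hx
  have hqd2 : ∀ i, DifferentiableAt ℝ (pd i q) x := fun i =>
    differentiableAt_of_contDiffOn (contDiffOn_pd (by norm_num) i hq) hx
  have h := HasReDiv.of_hasPd (x := x) (G := gradField k q) fun i =>
    (hasPd_norm_zpow i k hx).mul
      (((DifferentiableAt.hasPd i (hqd2 i)).mul (HasPd.conj (DifferentiableAt.hasPd i hqd))).add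
      ((HasPd.conj (DifferentiableAt.hasPd i (hqd2 i))).mul (DifferentiableAt.hasPd i hqd)))
  convert h using 1
  have : ∑ i, (((k * ‖x‖ ^ (k - 2) * x i : ℝ) : ℂ)
        * (pd i q x * starRingEnd ℂ (q x) + starRingEnd ℂ (pd i q x) * q x)
      + ((‖x‖ ^ k : ℝ) : ℂ) * ((pd i (pd i q) x * starRingEnd ℂ (q x)
          + pd i q x * starRingEnd ℂ (pd i q x))
        + (starRingEnd ℂ (pd i (pd i q) x) * q x + starRingEnd ℂ (pd i q x) * pd i q x)))
      = ((‖x‖ ^ k : ℝ) : ℂ) * ((lap q x * starRingEnd ℂ (q x)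
          + starRingEnd ℂ (lap q x * starRingEnd ℂ (q x))) + ((2 * gradSq q x : ℝ) : ℂ))
        + ((k * ‖x‖ ^ (k - 2) : ℝ) : ℂ) * (euler q x * starRingEnd ℂ (q x)
          + starRingEnd ℂ (euler q x * starRingEnd ℂ (q x))) := by
    push_cast
    rw [gradSq_coe]
    simp only [euler, lap, map_mul, map_sum, Finset.sum_mul, Finset.mul_sum, Complex.conj_ofReal,
      Complex.conj_conj, ← Finset.sum_add_distrib]
    exact Finset.sum_congr rfl fun i _ => by ring
  rw [this]
  simp only [Complex.add_re, Complex.ofReal_re, Complex.re_ofReal_mul, Complex.conj_re]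
  ring

theorem hasReDiv_pohozaevField (hq : ContDiffOn ℝ 2 q {0}ᶜ) {x : Space d} (hx : x ≠ 0) :
    HasReDiv (pohozaevField q)
      (2 * (lap q x * starRingEnd ℂ (euler q x)).re + (2 - d) * gradSq q x) x := by
  have hqd2 : ∀ i l, HasPd i (pd l q) (pd i (pd l q) x) x := fun i l => DifferentiableAt.hasPd i <|
    differentiableAt_of_contDiffOn (contDiffOn_pd (by norm_num) l hq) hx
  have hE : ∀ i, HasPd i (euler q) (pd i q x + ∑ l, (x l : ℂ) * pd i (pd l q) x) x := by
    intro i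
    refine (HasPd.sum Finset.univ fun l _ => (hasPd_coord i l x).mul (hqd2 i l)).congr_val ?_
    simp [Finset.sum_add_distrib]
  have hN : ∀ i, HasPd i (fun y => ∑ l, pd l q y * starRingEnd ℂ (pd l q y))
      (∑ l, (pd i (pd l q) x * starRingEnd ℂ (pd l q x)
        + pd l q x * starRingEnd ℂ (pd i (pd l q) x))) x := fun i =>
    HasPd.sum Finset.univ fun l _ => (hqd2 i l).mul (HasPd.conj (hqd2 i l))
  have h := HasReDiv.of_hasPd (x := x) (G := pohozaevField q) fun i =>
    (((hqd2 i i).mul (HasPd.conj (hE i))).add ((HasPd.conj (hqd2 i i)).mul (hE i))).sub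
      ((hasPd_coord i i x).mul (hN i))
  convert h using 1
  set T : ℂ := ∑ i, ∑ l, (x i : ℂ) * (pd l q x * starRingEnd ℂ (pd i (pd l q) x)) with hT
  have hT' : ∑ i, pd i q x * starRingEnd ℂ (∑ l, (x l : ℂ) * pd i (pd l q) x) = T := by
    rw [hT, Finset.sum_comm]
    refine Finset.sum_congr rfl fun i _ => ?_
    rw [map_sum, Finset.mul_sum]
    refine Finset.sum_congr rfl fun l _ => ?_
    rw [pd_comm_of_contDiffOn hq i l hx, map_mul, Complex.conj_ofReal]
    ring
  have hTc : starRingEnd ℂ T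
      = ∑ i, ∑ l, (x i : ℂ) * (pd i (pd l q) x * starRingEnd ℂ (pd l q x)) := by
    simp only [hT, map_sum, map_mul, Complex.conj_ofReal, Complex.conj_conj]
    exact Finset.sum_congr rfl fun i _ => Finset.sum_congr rfl fun l _ => by ring
  have : ∑ i, (((pd i (pd i q) x * starRingEnd ℂ (euler q x)
        + pd i q x * starRingEnd ℂ (pd i q x + ∑ l, (x l : ℂ) * pd i (pd l q) x))
      + (starRingEnd ℂ (pd i (pd i q) x) * euler q x
        + starRingEnd ℂ (pd i q x) * (pd i q x + ∑ l, (x l : ℂ) * pd i (pd l q) x)))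
      - ((if i = i then (1 : ℂ) else 0) * (∑ l, pd l q x * starRingEnd ℂ (pd l q x))
        + (x i : ℂ) * ∑ l, (pd i (pd l q) x * starRingEnd ℂ (pd l q x)
        + pd l q x * starRingEnd ℂ (pd i (pd l q) x))))
      = (lap q x * starRingEnd ℂ (euler q x)
          + starRingEnd ℂ (lap q x * starRingEnd ℂ (euler q x)))
        + (((2 - d) * gradSq q x : ℝ) : ℂ) := by
    have hT2 : ∑ i, starRingEnd ℂ (pd i q x) * ∑ l, (x l : ℂ) * pd i (pd l q) x
        = starRingEnd ℂ T := by
      rw [← hT', map_sum]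
      exact Finset.sum_congr rfl fun i _ => by rw [map_mul, Complex.conj_conj]
    push_cast
    rw [gradSq_coe]
    simp only [if_true, map_add, mul_add, Finset.sum_add_distrib, Finset.sum_sub_distrib, hT', hT2,
      Finset.sum_const, Finset.card_univ, Fintype.card_fin, nsmul_eq_mul, one_mul]
    have h3 : ∑ i, (x i : ℂ) * ∑ l, pd i (pd l q) x * starRingEnd ℂ (pd l q x)
        = starRingEnd ℂ T := by
      rw [hTc]; exact Finset.sum_congr rfl fun i _ => Finset.mul_sum _ _ _
    have h4 : ∑ i, (x i : ℂ) * ∑ l, pd l q x * starRingEnd ℂ (pd i (pd l q) x) = T := by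
      rw [hT]; exact Finset.sum_congr rfl fun i _ => Finset.mul_sum _ _ _
    rw [h3, h4, ← Finset.sum_mul, ← Finset.sum_mul, ← map_sum,
      Finset.sum_congr rfl fun i _ => mul_comm (starRingEnd ℂ (pd i q x)) (pd i q x)]
    simp only [lap, map_mul, Complex.conj_conj]
    ring
  rw [this]
  simp only [Complex.add_re, Complex.ofReal_re, Complex.conj_re]
  ring

theorem sum_coord_radialField (k : ℤ) (q : Space d → ℂ) (x : Space d) :
    (∑ i, (x i : ℂ) * radialField k q i x).re = ‖x‖ ^ 2 * ‖x‖ ^ k * ‖q x‖ ^ 2 := by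
  have : ∑ i, (x i : ℂ) * radialField k q i x
      = ((‖x‖ ^ 2 * ‖x‖ ^ k * ‖q x‖ ^ 2 : ℝ) : ℂ) := by
    simp only [radialField, ← mul_assoc]
    rw [← Finset.sum_mul, ← Finset.sum_mul, ← Finset.sum_mul, sum_coord_sq, mul_assoc,
      Complex.mul_conj']
    push_cast; ring
  rw [this, Complex.ofReal_re]

theorem sum_coord_gradField (k : ℤ) (q : Space d → ℂ) (x : Space d) :
    (∑ i, (x i : ℂ) * gradField k q i x).re
      = 2 * ‖x‖ ^ k * (euler q x * starRingEnd ℂ (q x)).re := by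
  have : ∑ i, (x i : ℂ) * gradField k q i x
      = ((‖x‖ ^ k : ℝ) : ℂ) * (euler q x * starRingEnd ℂ (q x)
        + starRingEnd ℂ (euler q x * starRingEnd ℂ (q x))) := by
    simp only [gradField, euler, map_mul, map_sum, Finset.sum_mul, Finset.mul_sum,
      Complex.conj_ofReal, Complex.conj_conj, ← Finset.sum_add_distrib]
    exact Finset.sum_congr rfl fun i _ => by ring
  rw [this, Complex.re_ofReal_mul, Complex.add_re, Complex.conj_re]
  ring

theorem sum_coord_pohozaevField (q : Space d → ℂ) (x : Space d) :
    (∑ i, (x i : ℂ) * pohozaevField q i x).re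
      = 2 * ‖euler q x‖ ^ 2 - ‖x‖ ^ 2 * gradSq q x := by
  have : ∑ i, (x i : ℂ) * pohozaevField q i x
      = ((2 * ‖euler q x‖ ^ 2 - ‖x‖ ^ 2 * gradSq q x : ℝ) : ℂ) := by
    push_cast
    rw [gradSq_coe, ← Complex.mul_conj', ← sum_coord_sq]
    have : ∑ i, (x i : ℂ) * pohozaevField q i x
        = euler q x * starRingEnd ℂ (euler q x) + starRingEnd ℂ (euler q x) * euler q x
          - (∑ i, (x i : ℂ) * (x i : ℂ)) * ∑ l, pd l q x * starRingEnd ℂ (pd l q x) := by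
      have e1 : ∀ c, euler q x * c = ∑ i, (x i : ℂ) * pd i q x * c := fun c =>
        Finset.sum_mul _ _ _
      have e2 : ∀ c, starRingEnd ℂ (euler q x) * c
          = ∑ i, (x i : ℂ) * starRingEnd ℂ (pd i q x) * c := by
        intro c
        simp only [euler, map_sum, map_mul, Complex.conj_ofReal, Finset.sum_mul]
      rw [e1, e2, Finset.sum_mul, ← Finset.sum_add_distrib, ← Finset.sum_sub_distrib]
      exact Finset.sum_congr rfl fun i _ => by simp only [pohozaevField]; ring
    rw [this]
    ring
  rw [this, Complex.ofReal_re]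

end fields

/-! ### Multiplier inequalities for functions that are smooth off the origin -/

theorem sum_coord_add (a b : Fin d → ℂ) (x : Space d) :
    (∑ i, (x i : ℂ) * (a i + b i)).re
      = (∑ i, (x i : ℂ) * a i).re + (∑ i, (x i : ℂ) * b i).re := by
  rw [← Complex.add_re, ← Finset.sum_add_distrib]
  simp only [mul_add]

theorem sum_coord_smul (c : ℝ) (a : Fin d → ℂ) (x : Space d) :
    (∑ i, (x i : ℂ) * ((c : ℂ) * a i)).re = c * (∑ i, (x i : ℂ) * a i).re := by
  rw [← Complex.re_ofReal_mul, Finset.mul_sum]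
  congr 1
  exact Finset.sum_congr rfl fun i _ => by ring

theorem continuousOn_norm_zpow (k : ℤ) :
    ContinuousOn (fun x : Space d => ‖x‖ ^ k) {0}ᶜ :=
  continuous_norm.continuousOn.zpow₀ k fun _ hx => Or.inl (norm_ne_zero_iff.2 hx)

theorem continuousOn_gradSq {q : Space d → ℂ} (hq : ContDiffOn ℝ 1 q {0}ᶜ) :
    ContinuousOn (gradSq q) {0}ᶜ :=
  continuousOn_finsetSum _ fun i _ =>
    ((continuousOn_pd isOpen_compl_singleton i hq).norm.pow 2)

theorem abs_re_euler_mul_conj_le (q : Space d → ℂ) (x : Space d) (c : ℂ) :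
    |(euler q x * starRingEnd ℂ c).re| ≤ ‖x‖ * √(gradSq q x) * ‖c‖ := by
  refine (Complex.abs_re_le_norm _).trans ?_
  rw [norm_mul, RCLike.norm_conj]
  gcongr
  exact norm_euler_le q x

theorem abs_re_mul_conj_le (a b : ℂ) : |(a * starRingEnd ℂ b).re| ≤ ‖a‖ * ‖b‖ := by
  refine (Complex.abs_re_le_norm _).trans ?_
  rw [norm_mul, RCLike.norm_conj]

theorem abs_im_mul_conj_le (a b : ℂ) : |(a * starRingEnd ℂ b).im| ≤ ‖a‖ * ‖b‖ := by
  refine (Complex.abs_im_le_norm _).trans ?_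
  rw [norm_mul, RCLike.norm_conj]

theorem integral_le_of_hasReDiv [NeZero d] {φ ψ K : Space d → ℝ} {G : Fin d → Space d → ℂ}
    (hφ : ContinuousOn φ {0}ᶜ) (hφ0 : ∀ x, x ≠ 0 → 0 ≤ φ x)
    (hψ : Integrable ψ volume) (hK : Integrable K volume)
    (hG : ∀ i, ContDiffOn ℝ 1 (G i) {0}ᶜ) {D : Space d → ℝ}
    (hD : ∀ x, x ≠ 0 → HasReDiv G (D x) x)
    (hdiv : ∀ x, x ≠ 0 → φ x ≤ ψ x + D x)
    (hflux : ∀ x, x ≠ 0 → ∀ t ∈ Icc (0 : ℝ) 1,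
      t * |(∑ i, (x i : ℂ) * G i x).re| ≤ ‖x‖ ^ 2 * (t ^ 2 * φ x + K x)) :
    Integrable φ volume ∧ ∫ x, φ x ≤ ∫ x, ψ x :=
  integral_le_of_div hφ hφ0 hψ hK hG (fun x hx => by rw [(hD x hx).2]; exact hdiv x hx) hflux

/-- Hardy's inequality with the weight `|x|^k`, with its sharp constant. -/
theorem hardy [NeZero d] (k : ℤ) (hk : (0 : ℝ) ≤ d + k - 2) {q : Space d → ℂ}
    (hq : ContDiffOn ℝ 1 q {0}ᶜ)
    (hS : Integrable (fun x => ‖x‖ ^ (k - 2) * ‖q x‖ ^ 2) volume)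
    (hN : Integrable (fun x => ‖x‖ ^ k * gradSq q x) volume) :
    ((d + k - 2) / 2) ^ 2 * ∫ x, ‖x‖ ^ (k - 2) * ‖q x‖ ^ 2 ≤ ∫ x, ‖x‖ ^ k * gradSq q x := by
  set α : ℝ := (d + k - 2) / 2 with hα
  have hα0 : 0 ≤ α := by rw [hα]; linarith
  rw [← integral_const_mul]
  refine (integral_le_of_hasReDiv (φ := fun x => α ^ 2 * (‖x‖ ^ (k - 2) * ‖q x‖ ^ 2))
    (G := fun i y => (α : ℂ) * radialField (k - 2) q i y)
    (K := fun x => α * (‖x‖ ^ (k - 2) * ‖q x‖ ^ 2))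
    (continuousOn_const.mul ((continuousOn_norm_zpow _).mul (hq.continuousOn.norm.pow 2)))
    (fun x _ => by positivity) hN (hS.const_mul _)
    (fun i => contDiffOn_const.mul (contDiffOn_radialField _ hq i))
    (fun x hx => (hasReDiv_radialField (k - 2) hq hx).smul α) ?_ ?_).2
  · intro x hx
    have hr : 0 < ‖x‖ := norm_pos_iff.2 hx
    have hA : 0 < ‖x‖ ^ (k - 2) := zpow_pos hr _
    have hk2 : ‖x‖ ^ k = ‖x‖ ^ (k - 2) * ‖x‖ ^ 2 := by
      rw [← zpow_natCast ‖x‖ 2, ← zpow_add₀ hr.ne']; congr 1; push_cast; ring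
    have he := abs_le.1 (abs_re_euler_mul_conj_le q x (q x))
    have hn := Real.sq_sqrt (gradSq_nonneg q x)
    set e := (euler q x * starRingEnd ℂ (q x)).re
    set n := √(gradSq q x)
    have hdk : (d : ℝ) + ((k - 2 : ℤ) : ℝ) = 2 * α := by rw [hα]; push_cast; ring
    rw [hk2, hdk, ← hn]
    -- completing the square, with the Cauchy–Schwarz defect of `x · ∇q` as the remainder
    have h1 : 0 ≤ ‖x‖ ^ (k - 2) * ((‖x‖ * n - α * ‖q x‖) ^ 2
        + 2 * α * (e + ‖x‖ * n * ‖q x‖)) := by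
      have : 0 ≤ e + ‖x‖ * n * ‖q x‖ := by linarith [he.1]
      positivity
    nlinarith [h1]
  · intro x hx t ht
    have hA : 0 ≤ ‖x‖ ^ (k - 2) := by positivity
    rw [sum_coord_smul, sum_coord_radialField, abs_of_nonneg (by positivity)]
    have h0 : 0 ≤ α * (‖x‖ ^ 2 * ‖x‖ ^ (k - 2) * ‖q x‖ ^ 2) := by positivity
    have h1 := mul_le_of_le_one_left h0 ht.2
    have h2 : 0 ≤ ‖x‖ ^ 2 * (t ^ 2 * (α ^ 2 * (‖x‖ ^ (k - 2) * ‖q x‖ ^ 2))) := by positivity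
    nlinarith [h1, h2]

/-- Testing `Δu` with `ū / |x|²`. -/
theorem integral_gradSq_div_sq_le [NeZero d] (hd : 4 ≤ d) {u : Space d → ℂ}
    (hu : ContDiffOn ℝ 2 u {0}ᶜ)
    (hS : Integrable (fun x => ‖x‖ ^ (-4 : ℤ) * ‖u x‖ ^ 2) volume)
    (hL : Integrable (fun x => ‖x‖ ^ (-2 : ℤ) * (‖lap u x‖ * ‖u x‖)) volume) :
    Integrable (fun x => ‖x‖ ^ (-2 : ℤ) * gradSq u x
        + (d - 4) * (‖x‖ ^ (-4 : ℤ) * ‖u x‖ ^ 2)) volume ∧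
      ∫ x, (‖x‖ ^ (-2 : ℤ) * gradSq u x + (d - 4) * (‖x‖ ^ (-4 : ℤ) * ‖u x‖ ^ 2))
        ≤ ∫ x, ‖x‖ ^ (-2 : ℤ) * (‖lap u x‖ * ‖u x‖) := by
  have hd4 : (0 : ℝ) ≤ d - 4 := by
    have : (4 : ℝ) ≤ d := by exact_mod_cast hd
    linarith
  have hu1 : ContDiffOn ℝ 1 u {0}ᶜ := hu.of_le (by norm_num)
  refine integral_le_of_hasReDiv
    (G := fun i y => ((1 / 2 : ℝ) : ℂ) * gradField (-2) u i y + radialField (-4) u i y)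
    (K := fun x => 2 * (‖x‖ ^ (-4 : ℤ) * ‖u x‖ ^ 2))
    (((continuousOn_norm_zpow _).mul (continuousOn_gradSq hu1)).add
      (continuousOn_const.mul ((continuousOn_norm_zpow _).mul (hu.continuousOn.norm.pow 2))))
    (fun x _ => ?_) hL (hS.const_mul _)
    (fun i => (contDiffOn_const.mul (contDiffOn_gradField _ hu i)).add
      (contDiffOn_radialField _ hu1 i))
    (fun x hx => ((hasReDiv_gradField (-2) hu hx).smul (1 / 2)).add
      (hasReDiv_radialField (-4) hu1 hx)) ?_ ?_
  · have := gradSq_nonneg u x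
    positivity
  · intro x hx
    have hA : 0 ≤ ‖x‖ ^ (-2 : ℤ) := by positivity
    have h1 := (abs_le.1 (abs_re_mul_conj_le (lap u x) (u x))).1
    have h2 := mul_le_mul_of_nonneg_left h1 hA
    norm_num at h2 ⊢
    nlinarith [h2]
  · intro x hx t ht
    have hr : 0 < ‖x‖ := norm_pos_iff.2 hx
    rw [sum_coord_add, sum_coord_smul, sum_coord_radialField, sum_coord_gradField]
    have h4 : ‖x‖ ^ (-4 : ℤ) = ‖x‖ ^ (-2 : ℤ) * ‖x‖ ^ (-2 : ℤ) := by
      rw [← zpow_add₀ hr.ne']; norm_num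
    have h2 : ‖x‖ ^ 2 * ‖x‖ ^ (-2 : ℤ) = 1 := by
      rw [← zpow_natCast ‖x‖ 2, ← zpow_add₀ hr.ne']; norm_num
    have hA : 0 < ‖x‖ ^ (-2 : ℤ) := zpow_pos hr _
    have he := abs_re_euler_mul_conj_le u x (u x)
    have hn := Real.sq_sqrt (gradSq_nonneg u x)
    rw [h4, ← hn]
    set e := (euler u x * starRingEnd ℂ (u x)).re
    set n := √(gradSq u x)
    set A := ‖x‖ ^ (-2 : ℤ)
    set s := ‖u x‖
    set r := ‖x‖
    have ht0 := ht.1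
    have hs : 0 ≤ s := norm_nonneg _
    have hAs : 0 ≤ A * s ^ 2 := by positivity
    have hb : |1 / 2 * (2 * A * e) + r ^ 2 * (A * A) * s ^ 2| ≤ A * (r * n * s) + A * s ^ 2 := by
      have : r ^ 2 * (A * A) * s ^ 2 = A * s ^ 2 := by
        linear_combination A * s ^ 2 * h2
      rw [this]
      refine (abs_add_le _ _).trans ?_
      rw [abs_of_nonneg hAs, show 1 / 2 * (2 * A * e) = A * e by ring, abs_mul, abs_of_pos hA]
      gcongr
    have hsq : 0 ≤ (t * n - A * r * s) ^ 2 := sq_nonneg _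
    have e1 : (A * r * s) ^ 2 = A * s ^ 2 := by linear_combination A * s ^ 2 * h2
    have e2 : r ^ 2 * (t ^ 2 * (A * n ^ 2 + (d - 4) * (A * A * s ^ 2)) + 2 * (A * A * s ^ 2))
        = t ^ 2 * n ^ 2 + t ^ 2 * ((d - 4) * (A * s ^ 2)) + 2 * (A * s ^ 2) := by
      linear_combination (t ^ 2 * n ^ 2 + t ^ 2 * ((d - 4) * (A * s ^ 2)) + 2 * (A * s ^ 2)) * h2
    rw [e2]
    have h5 : 0 ≤ t ^ 2 * ((d - 4) * (A * s ^ 2)) := by positivity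
    have h6 : t * (A * s ^ 2) ≤ A * s ^ 2 := mul_le_of_le_one_left hAs ht.2
    have h7 := mul_le_mul_of_nonneg_left hb ht0
    nlinarith [h5, h6, h7, hsq, e1]

/-- Testing the biharmonic equation with `ū`. -/
theorem integral_sq_lap_le [NeZero d] {z : ℂ} (hz : z.re ≤ 0) {u g : Space d → ℂ}
    (hu : ContDiff ℝ 4 u) (heq : ∀ x, lap (lap u) x = z * u x + g x)
    (hg : Integrable (fun x => ‖g x‖ * ‖u x‖) volume)
    (h1 : Integrable (gradSq (lap u)) volume)
    (h2 : Integrable (fun x => ‖x‖ ^ (-2 : ℤ) * ‖u x‖ ^ 2) volume)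
    (h3 : Integrable (fun x => ‖lap u x‖ ^ 2) volume)
    (h4 : Integrable (fun x => ‖x‖ ^ (-2 : ℤ) * gradSq u x) volume) :
    ∫ x, ‖lap u x‖ ^ 2 ≤ ∫ x, ‖g x‖ * ‖u x‖ := by
  have hpu : ∀ i, ContDiff ℝ 3 (pd i u) := fun i => contDiff_pd (by norm_num) i hu
  have hL : ContDiff ℝ 2 (lap u) :=
    ContDiff.sum fun i _ => contDiff_pd (by norm_num) i (hpu i)
  have hpL : ∀ i, ContDiff ℝ 1 (pd i (lap u)) := fun i => contDiff_pd (by norm_num) i hL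
  have hconj : ∀ {n : WithTop ℕ∞} {f : Space d → ℂ}, ContDiff ℝ n f →
      ContDiff ℝ n fun y => starRingEnd ℂ (f y) := fun h =>
    Complex.conjCLE.toContinuousLinearMap.contDiff.comp h
  refine (integral_le_of_hasReDiv (φ := fun x => ‖lap u x‖ ^ 2)
    (G := fun i y => lap u y * starRingEnd ℂ (pd i u y) - pd i (lap u) y * starRingEnd ℂ (u y))
    (K := fun x => (gradSq (lap u) x + ‖x‖ ^ (-2 : ℤ) * ‖u x‖ ^ 2) + (‖lap u x‖ ^ 2
      + ‖x‖ ^ (-2 : ℤ) * gradSq u x))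
    (hL.continuous.norm.pow 2).continuousOn (fun x _ => by positivity) hg
    ((h1.add h2).add (h3.add h4))
    (fun i => (((hL.of_le (by norm_num)).mul (hconj ((hpu i).of_le (by norm_num)))).sub
      ((hpL i).mul (hconj (hu.of_le (by norm_num))))).contDiffOn)
    (fun x hx => HasReDiv.of_hasPd fun i =>
      ((DifferentiableAt.hasPd i (hL.differentiable (by norm_num) x)).mul
        (HasPd.conj (DifferentiableAt.hasPd i ((hpu i).differentiable (by norm_num) x)))).sub
      ((DifferentiableAt.hasPd i ((hpL i).differentiable (by norm_num) x)).mul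
        (HasPd.conj (DifferentiableAt.hasPd i (hu.differentiable (by norm_num) x))))) ?_ ?_).2
  · intro x hx
    have hsum : ∑ i, ((pd i (lap u) x * starRingEnd ℂ (pd i u x)
          + lap u x * starRingEnd ℂ (pd i (pd i u) x))
        - (pd i (pd i (lap u)) x * starRingEnd ℂ (u x)
          + pd i (lap u) x * starRingEnd ℂ (pd i u x)))
        = lap u x * starRingEnd ℂ (lap u x) - lap (lap u) x * starRingEnd ℂ (u x) := by
      have e1 : lap u x * starRingEnd ℂ (lap u x)
          = ∑ i, lap u x * starRingEnd ℂ (pd i (pd i u) x) := by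
        rw [← Finset.mul_sum, ← map_sum]; rfl
      have e2 : lap (lap u) x * starRingEnd ℂ (u x)
          = ∑ i, pd i (pd i (lap u)) x * starRingEnd ℂ (u x) := Finset.sum_mul _ _ _
      rw [e1, e2, ← Finset.sum_sub_distrib]
      exact Finset.sum_congr rfl fun i _ => by ring
    rw [hsum, heq, Complex.sub_re, Complex.mul_conj', add_mul, mul_assoc, Complex.mul_conj',
      Complex.add_re]
    have hgu := (abs_le.1 (abs_re_mul_conj_le (g x) (u x))).2
    have e1 : ((‖lap u x‖ : ℂ) ^ 2).re = ‖lap u x‖ ^ 2 := by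
      rw [← Complex.ofReal_pow, Complex.ofReal_re]
    have e2 : (z * (‖u x‖ : ℂ) ^ 2).re = z.re * ‖u x‖ ^ 2 := by
      rw [← Complex.ofReal_pow, Complex.re_mul_ofReal]
    rw [e1, e2]
    nlinarith [mul_nonneg (neg_nonneg.2 hz) (sq_nonneg ‖u x‖)]
  · intro x hx t ht
    have hr : 0 < ‖x‖ := norm_pos_iff.2 hx
    have hsum : ∑ i, (x i : ℂ) * (lap u x * starRingEnd ℂ (pd i u x)
          - pd i (lap u) x * starRingEnd ℂ (u x))
        = lap u x * starRingEnd ℂ (euler u x) - euler (lap u) x * starRingEnd ℂ (u x) := by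
      simp only [euler, map_sum, map_mul, Complex.conj_ofReal, Finset.mul_sum, Finset.sum_mul,
        ← Finset.sum_sub_distrib]
      exact Finset.sum_congr rfl fun i _ => by ring
    rw [hsum, Complex.sub_re]
    have hb : |(lap u x * starRingEnd ℂ (euler u x)).re
        - (euler (lap u) x * starRingEnd ℂ (u x)).re|
        ≤ ‖lap u x‖ * (‖x‖ * √(gradSq u x)) + ‖x‖ * √(gradSq (lap u) x) * ‖u x‖ := by
      refine (abs_sub _ _).trans (add_le_add ?_ (abs_re_euler_mul_conj_le _ _ _))
      exact (abs_re_mul_conj_le _ _).trans (by gcongr; exact norm_euler_le _ _)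
    have h2 : ‖x‖ ^ 2 * ‖x‖ ^ (-2 : ℤ) = 1 := by
      rw [← zpow_natCast ‖x‖ 2, ← zpow_add₀ hr.ne']; norm_num
    have hn := Real.sq_sqrt (gradSq_nonneg u x)
    have hm := Real.sq_sqrt (gradSq_nonneg (lap u) x)
    rw [← hn, ← hm]
    set n := √(gradSq u x)
    set m := √(gradSq (lap u) x)
    set A := ‖x‖ ^ (-2 : ℤ)
    set s := ‖u x‖
    set l := ‖lap u x‖
    set r := ‖x‖
    have h3 := mul_le_of_le_one_left (abs_nonneg ((lap u x * starRingEnd ℂ (euler u x)).re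
        - (euler (lap u) x * starRingEnd ℂ (u x)).re)) ht.2
    have e : r ^ 2 * (t ^ 2 * l ^ 2 + ((m ^ 2 + A * s ^ 2) + (l ^ 2 + A * n ^ 2)))
        = r ^ 2 * (t ^ 2 * l ^ 2) + (r * m) ^ 2 + (r * l) ^ 2 + s ^ 2 + n ^ 2 := by
      linear_combination (s ^ 2 + n ^ 2) * h2
    rw [e]
    have h0 : 0 ≤ r ^ 2 * (t ^ 2 * l ^ 2) := by positivity
    nlinarith [sq_nonneg (r * m - s), sq_nonneg (r * l - n), sq_nonneg (r * m), sq_nonneg (r * l),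
      sq_nonneg s, sq_nonneg n]

/-- Testing the Helmholtz equation `Δw - kw = g`, `Re k ≥ 0`, with `|x|² w̄`. -/
theorem integral_sq_mul_gradSq_le [NeZero d] {k : ℂ} (hk : 0 ≤ k.re) {w g : Space d → ℂ}
    (hw : ContDiffOn ℝ 2 w {0}ᶜ) (heq : ∀ x, lap w x = k * w x + g x)
    (hS : Integrable (fun x => ‖w x‖ ^ 2) volume)
    (hg : Integrable (fun x => ‖x‖ ^ 2 * (‖g x‖ * ‖w x‖)) volume) :
    Integrable (fun x => ‖x‖ ^ 2 * gradSq w x) volume ∧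
      ∫ x, ‖x‖ ^ 2 * gradSq w x
        ≤ ∫ x, (‖x‖ ^ 2 * (‖g x‖ * ‖w x‖) + d * ‖w x‖ ^ 2) := by
  have hw1 : ContDiffOn ℝ 1 w {0}ᶜ := hw.of_le (by norm_num)
  refine integral_le_of_hasReDiv
    (G := fun i y => ((1 / 2 : ℝ) : ℂ) * gradField 2 w i y
      + ((-1 : ℝ) : ℂ) * radialField 0 w i y)
    (K := fun x => 2 * ‖w x‖ ^ 2)
    ((continuous_norm.pow 2).continuousOn.mul (continuousOn_gradSq hw1))
    (fun x _ => ?_) (hg.add (hS.const_mul _)) (hS.const_mul _)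
    (fun i => (contDiffOn_const.mul (contDiffOn_gradField _ hw i)).add
      (contDiffOn_const.mul (contDiffOn_radialField _ hw1 i)))
    (fun x hx => ((hasReDiv_gradField 2 hw hx).smul (1 / 2)).add
      ((hasReDiv_radialField 0 hw1 hx).smul (-1))) ?_ ?_
  · have := gradSq_nonneg w x
    positivity
  · intro x hx
    have h1 := (abs_le.1 (abs_re_mul_conj_le (g x) (w x))).1
    have h2 := mul_le_mul_of_nonneg_left h1 (sq_nonneg ‖x‖)
    have h3 : 0 ≤ ‖x‖ ^ 2 * (k.re * ‖w x‖ ^ 2) := by positivity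
    have e2 : (k * (‖w x‖ : ℂ) ^ 2).re = k.re * ‖w x‖ ^ 2 := by
      rw [← Complex.ofReal_pow, Complex.re_mul_ofReal]
    rw [heq, add_mul, mul_assoc, Complex.mul_conj', Complex.add_re, e2]
    have hz : ‖x‖ ^ (2 : ℤ) = ‖x‖ ^ 2 := zpow_natCast _ 2
    simp only [hz, sub_self, zpow_zero, Int.cast_zero, Int.cast_ofNat]
    nlinarith [h2, h3]
  · intro x hx t ht
    rw [sum_coord_add, sum_coord_smul, sum_coord_smul, sum_coord_radialField, sum_coord_gradField]
    have hz : ‖x‖ ^ (2 : ℤ) = ‖x‖ ^ 2 := zpow_natCast _ 2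
    have he := abs_re_euler_mul_conj_le w x (w x)
    have hn := Real.sq_sqrt (gradSq_nonneg w x)
    rw [hz, zpow_zero, ← hn]
    set e := (euler w x * starRingEnd ℂ (w x)).re
    set n := √(gradSq w x)
    set s := ‖w x‖
    set r := ‖x‖
    have ht0 := ht.1
    have hb : |1 / 2 * (2 * r ^ 2 * e) + -1 * (r ^ 2 * 1 * s ^ 2)|
        ≤ r ^ 2 * (r * n * s + s ^ 2) := by
      rw [show 1 / 2 * (2 * r ^ 2 * e) + -1 * (r ^ 2 * 1 * s ^ 2) = r ^ 2 * (e - s ^ 2) by ring,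
        abs_mul, abs_of_nonneg (sq_nonneg r)]
      gcongr
      refine (abs_sub _ _).trans ?_
      rw [abs_of_nonneg (sq_nonneg s)]
      gcongr
    have h7 := mul_le_mul_of_nonneg_left hb ht0
    have h8 : t * (r * n * s + s ^ 2) ≤ t ^ 2 * (r ^ 2 * n ^ 2) + 2 * s ^ 2 := by
      have h6 : t * s ^ 2 ≤ s ^ 2 := mul_le_of_le_one_left (sq_nonneg s) ht.2
      nlinarith [sq_nonneg (t * (r * n) - s), sq_nonneg (t * (r * n)), sq_nonneg s]
    calc _ ≤ t * (r ^ 2 * (r * n * s + s ^ 2)) := h7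
      _ = r ^ 2 * (t * (r * n * s + s ^ 2)) := by ring
      _ ≤ _ := by gcongr

/-- The imaginary part of the Helmholtz equation `Δv + kv = h` tested with `v̄`. -/
theorem abs_im_mul_integral_sq_le [NeZero d] {k : ℂ} {v h : Space d → ℂ}
    (hv : ContDiffOn ℝ 2 v {0}ᶜ) (heq : ∀ x, lap v x + k * v x = h x)
    (hh : Integrable (fun x => ‖h x‖ * ‖v x‖) volume)
    (h1 : Integrable (gradSq v) volume)
    (h2 : Integrable (fun x => ‖x‖ ^ (-2 : ℤ) * ‖v x‖ ^ 2) volume) :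
    |k.im| * ∫ x, ‖v x‖ ^ 2 ≤ ∫ x, ‖h x‖ * ‖v x‖ := by
  have hv1 : ContDiffOn ℝ 1 v {0}ᶜ := hv.of_le (by norm_num)
  obtain ⟨σ, hσ, hσk⟩ : ∃ σ : ℝ, |σ| = 1 ∧ σ * k.im = |k.im| := by
    rcases le_total 0 k.im with h | h
    · exact ⟨1, by simp, by rw [abs_of_nonneg h, one_mul]⟩
    · exact ⟨-1, by simp, by rw [abs_of_nonpos h]; ring⟩
  rw [← integral_const_mul]
  have hp : ∀ i, ContDiffOn ℝ 1 (pd i v) {0}ᶜ := fun i => contDiffOn_pd (by norm_num) i hv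
  refine (integral_le_of_hasReDiv (φ := fun x => |k.im| * ‖v x‖ ^ 2)
    (G := fun i y => (σ * Complex.I) * (pd i v y * starRingEnd ℂ (v y)))
    (K := fun x => gradSq v x + ‖x‖ ^ (-2 : ℤ) * ‖v x‖ ^ 2)
    (continuousOn_const.mul (hv.continuousOn.norm.pow 2)) (fun x _ => by positivity) hh
    (h1.add h2) (fun i => contDiffOn_const.mul ((hp i).mul (ContDiffOn.conj hv1)))
    (fun x hx => HasReDiv.of_hasPd fun i => HasPd.const_mul _
      ((DifferentiableAt.hasPd i (differentiableAt_of_contDiffOn (hp i) hx)).mul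
        (HasPd.conj (DifferentiableAt.hasPd i (differentiableAt_of_contDiffOn hv1 hx))))) ?_ ?_).2
  · intro x hx
    have hsum : ∑ i, (σ * Complex.I) * (pd i (pd i v) x * starRingEnd ℂ (v x)
        + pd i v x * starRingEnd ℂ (pd i v x))
        = (σ * Complex.I) * (lap v x * starRingEnd ℂ (v x) + gradSq v x) := by
      rw [gradSq_coe, lap, ← Finset.mul_sum, Finset.sum_mul, Finset.sum_add_distrib]
    rw [hsum, show lap v x = h x - k * v x by rw [← heq]; ring, sub_mul, mul_assoc k,
      Complex.mul_conj']
    have e1 : ((σ * Complex.I) * (h x * starRingEnd ℂ (v x) - k * (‖v x‖ : ℂ) ^ 2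
        + gradSq v x)).re = |k.im| * ‖v x‖ ^ 2 - σ * (h x * starRingEnd ℂ (v x)).im := by
      rw [← hσk, ← Complex.ofReal_pow, mul_assoc, Complex.re_ofReal_mul, Complex.I_mul_re,
        Complex.add_im, Complex.sub_im, Complex.im_mul_ofReal, Complex.ofReal_im]
      ring
    rw [e1]
    have h3 := (le_abs_self (σ * (h x * starRingEnd ℂ (v x)).im)).trans
      (show _ ≤ ‖h x‖ * ‖v x‖ by rw [abs_mul, hσ, one_mul]; exact abs_im_mul_conj_le _ _)
    linarith
  · intro x hx t ht
    have hr : 0 < ‖x‖ := norm_pos_iff.2 hx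
    have hsum : ∑ i, (x i : ℂ) * ((σ * Complex.I) * (pd i v x * starRingEnd ℂ (v x)))
        = (σ * Complex.I) * (euler v x * starRingEnd ℂ (v x)) := by
      rw [euler, Finset.sum_mul, Finset.mul_sum]
      exact Finset.sum_congr rfl fun i _ => by ring
    rw [hsum]
    have hb : |((σ * Complex.I) * (euler v x * starRingEnd ℂ (v x))).re|
        ≤ ‖x‖ * √(gradSq v x) * ‖v x‖ := by
      refine (Complex.abs_re_le_norm _).trans ?_
      rw [norm_mul, norm_mul, norm_mul, Complex.norm_I, Complex.norm_real, Real.norm_eq_abs, hσ,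
        RCLike.norm_conj, one_mul, one_mul]
      gcongr
      exact norm_euler_le _ _
    have h3 := (mul_le_of_le_one_left (abs_nonneg _) ht.2).trans hb
    have h2 : ‖x‖ ^ 2 * ‖x‖ ^ (-2 : ℤ) = 1 := by
      rw [← zpow_natCast ‖x‖ 2, ← zpow_add₀ hr.ne']; norm_num
    have hn := Real.sq_sqrt (gradSq_nonneg v x)
    rw [← hn]
    refine h3.trans ?_
    set n := √(gradSq v x)
    set A := ‖x‖ ^ (-2 : ℤ)
    set s := ‖v x‖
    set r := ‖x‖
    have e : r ^ 2 * (t ^ 2 * (|k.im| * s ^ 2) + (n ^ 2 + A * s ^ 2))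
        = r ^ 2 * (t ^ 2 * (|k.im| * s ^ 2)) + (r * n) ^ 2 + s ^ 2 := by
      linear_combination s ^ 2 * h2
    rw [e]
    have h0 : 0 ≤ r ^ 2 * (t ^ 2 * (|k.im| * s ^ 2)) := by positivity
    nlinarith [sq_nonneg (r * n - s), sq_nonneg (r * n), sq_nonneg s]

/-! ### The Helmholtz equation in the radiation gauge -/

set_option maxHeartbeats 800000 in
/-- The multiplier estimate for `q = e^{-iθ|x|} v` where `Δv + (θ² + μ + iτθ) v` is given. The
multiplier is `2 (x · ∇q̄) + (d - 1) q̄ + τ |x| q̄`; with it the first order terms of the equation for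
`q` only contribute imaginary parts, and what remains besides `|∇q|²` is non-negative. -/
theorem integral_gradSq_le_of_gauge [NeZero d] (hd : 3 ≤ d) {θ μ τ : ℝ} (hμ : 0 ≤ μ) (hτ : 0 ≤ τ)
    (hμτ : τ * μ = 0) {q h : Space d → ℂ} (hq : ContDiffOn ℝ 2 q {0}ᶜ)
    (heq : ∀ x, x ≠ 0 → lap q x = h x
      - (2 * θ * Complex.I / ‖x‖) * (euler q x + ((d - 1) / 2) * q x)
      - (μ + τ * θ * Complex.I) * q x)
    (hN : Integrable (gradSq q) volume)
    (hS : Integrable (fun x => ‖q x‖ ^ 2) volume)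
    (hS2 : Integrable (fun x => ‖x‖ ^ (-2 : ℤ) * ‖q x‖ ^ 2) volume)
    (hψ : Integrable (fun x => ‖x‖ * ‖h x‖ * (2 * √(gradSq q x)
      + (d - 1) * (‖x‖⁻¹ * ‖q x‖) + τ * ‖q x‖)) volume) :
    ∫ x, gradSq q x ≤ ∫ x, ‖x‖ * ‖h x‖ * (2 * √(gradSq q x)
      + (d - 1) * (‖x‖⁻¹ * ‖q x‖) + τ * ‖q x‖) := by
  have hd3 : (3 : ℝ) ≤ d := by exact_mod_cast hd
  have hq1 : ContDiffOn ℝ 1 q {0}ᶜ := hq.of_le (by norm_num)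
  set c : ℝ := (d - 1) / 2 with hc
  have hc1 : 1 ≤ c := by rw [hc]; linarith
  refine (integral_le_of_hasReDiv (φ := gradSq q)
    (G := fun i y => pohozaevField q i y + ((c : ℂ) * gradField 0 q i y
      + ((μ : ℂ) * radialField 0 q i y + (((τ / 2 : ℝ) : ℂ) * gradField 1 q i y
        + ((τ / 2 : ℝ) : ℂ) * radialField (-1) q i y))))
    (K := fun x => (3 + c + τ) * gradSq q x + ((c + τ) * (‖x‖ ^ (-2 : ℤ) * ‖q x‖ ^ 2)
      + (μ + 2 * τ) * ‖q x‖ ^ 2))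
    (continuousOn_gradSq hq1) (fun x _ => gradSq_nonneg q x) hψ
    ((hN.const_mul _).add ((hS2.const_mul _).add (hS.const_mul _)))
    (fun i => (contDiffOn_pohozaevField hq i).add
      ((contDiffOn_const.mul (contDiffOn_gradField _ hq i)).add
      ((contDiffOn_const.mul (contDiffOn_radialField _ hq1 i)).add
      ((contDiffOn_const.mul (contDiffOn_gradField _ hq i)).add
      (contDiffOn_const.mul (contDiffOn_radialField _ hq1 i))))))
    (fun x hx => (hasReDiv_pohozaevField hq hx).add
      (((hasReDiv_gradField 0 hq hx).smul c).add
      (((hasReDiv_radialField 0 hq1 hx).smul μ).add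
      (((hasReDiv_gradField 1 hq hx).smul (τ / 2)).add
      ((hasReDiv_radialField (-1) hq1 hx).smul (τ / 2)))))) ?_ ?_).2
  · intro x hx
    have hr : 0 < ‖x‖ := norm_pos_iff.2 hx
    have he := abs_re_euler_mul_conj_le q x (q x)
    have hn := Real.sq_sqrt (gradSq_nonneg q x)
    have hh1 : |(h x * starRingEnd ℂ (euler q x)).re| ≤ ‖h x‖ * (‖x‖ * √(gradSq q x)) :=
      (abs_re_mul_conj_le _ _).trans (by gcongr; exact norm_euler_le q x)
    have hh2 := abs_re_mul_conj_le (h x) (q x)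
    have hdn : (d : ℝ) = 2 * c + 1 := by rw [hc]; ring
    have hdC : (d : ℂ) = ((2 * c + 1 : ℝ) : ℂ) := by rw [← hdn]; simp
    -- real parts of the equation tested with the two multipliers
    have e1 : (lap q x * starRingEnd ℂ (euler q x)).re
        = (h x * starRingEnd ℂ (euler q x)).re
          - (2 * θ * c / ‖x‖) * (euler q x * starRingEnd ℂ (q x)).im
          - μ * (euler q x * starRingEnd ℂ (q x)).re
          - τ * θ * (euler q x * starRingEnd ℂ (q x)).im := by
      rw [heq x hx, hdC]
      set E := euler q x
      have : (h x - (2 * θ * Complex.I / ‖x‖) * (E + ((((2 * c + 1 : ℝ) : ℂ) - 1) / 2) * q x)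
          - (μ + τ * θ * Complex.I) * q x) * starRingEnd ℂ E
          = h x * starRingEnd ℂ E - ((2 * θ / ‖x‖ : ℝ) : ℂ) * (Complex.I * (E * starRingEnd ℂ E))
            - (((2 * θ * c / ‖x‖ : ℝ) : ℂ) * (Complex.I * starRingEnd ℂ (E * starRingEnd ℂ (q x)))
            + ((μ : ℂ) * starRingEnd ℂ (E * starRingEnd ℂ (q x)) + ((τ * θ : ℝ) : ℂ)
              * (Complex.I * starRingEnd ℂ (E * starRingEnd ℂ (q x))))) := by
        rw [map_mul, Complex.conj_conj]; push_cast; ring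
      rw [this, Complex.mul_conj, Complex.sub_re, Complex.sub_re, Complex.add_re, Complex.add_re,
        Complex.re_ofReal_mul, Complex.re_ofReal_mul, Complex.re_ofReal_mul, Complex.re_ofReal_mul,
        Complex.I_mul_re, Complex.I_mul_re, Complex.conj_im, Complex.conj_re, Complex.ofReal_im]
      ring
    have e2 : (lap q x * starRingEnd ℂ (q x)).re
        = (h x * starRingEnd ℂ (q x)).re
          + (2 * θ / ‖x‖) * (euler q x * starRingEnd ℂ (q x)).im - μ * ‖q x‖ ^ 2 := by
      rw [heq x hx]
      set E := euler q x
      have : (h x - (2 * θ * Complex.I / ‖x‖) * (E + ((d - 1) / 2) * q x)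
          - (μ + τ * θ * Complex.I) * q x) * starRingEnd ℂ (q x)
          = h x * starRingEnd ℂ (q x)
            - (((2 * θ / ‖x‖ : ℝ) : ℂ) * (Complex.I * (E * starRingEnd ℂ (q x)))
            + (((2 * θ / ‖x‖ * ((d - 1) / 2) + τ * θ : ℝ) : ℂ)
                * (Complex.I * ((‖q x‖ ^ 2 : ℝ) : ℂ))
              + (μ : ℂ) * ((‖q x‖ ^ 2 : ℝ) : ℂ))) := by
        rw [Complex.ofReal_pow ‖q x‖ 2, ← Complex.mul_conj']; push_cast; ring
      rw [this, Complex.sub_re, Complex.add_re, Complex.add_re, Complex.re_ofReal_mul,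
        Complex.re_ofReal_mul, Complex.re_ofReal_mul, Complex.I_mul_re, Complex.I_mul_re,
        Complex.ofReal_im, Complex.ofReal_re]
      ring
    rw [e1, e2]
    have z1 : ‖x‖ ^ (1 - 2 : ℤ) = ‖x‖⁻¹ := by norm_num
    have z2 : ‖x‖ ^ (-1 : ℤ) = ‖x‖⁻¹ := by norm_num
    have z3 : ‖x‖ ^ (1 : ℤ) = ‖x‖ := zpow_one _
    simp only [z1, z2, z3, zpow_zero, Int.cast_zero, Int.cast_one, Int.cast_neg, div_eq_mul_inv]
    rw [hdn]
    set e := (euler q x * starRingEnd ℂ (q x)).re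
    set m := (euler q x * starRingEnd ℂ (q x)).im
    set n := √(gradSq q x)
    set s := ‖q x‖
    set r := ‖x‖
    set a := (h x * starRingEnd ℂ (euler q x)).re
    set b := (h x * starRingEnd ℂ (q x)).re
    set H := ‖h x‖
    have hri : r * r⁻¹ = 1 := mul_inv_cancel₀ hr.ne'
    have hri0 : 0 < r⁻¹ := inv_pos.2 hr
    have ha := (abs_le.1 hh1).1
    have hb := (abs_le.1 hh2).1
    have hs0 : 0 ≤ s := norm_nonneg _
    have he1 := (abs_le.1 he).1
    rw [← hn]
    -- the coefficient of `τ`; this is where `d ≥ 3`, that is `c ≥ 1`, enters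
    have p1 : 0 ≤ r⁻¹ * ((r * n - s) ^ 2 + 2 * (e + r * n * s) + (c - 1) * s ^ 2) := by
      have : 0 ≤ e + r * n * s := by linarith
      have : 0 ≤ (c - 1) * s ^ 2 := mul_nonneg (by linarith) (sq_nonneg _)
      positivity
    have p2 : r⁻¹ * ((r * n - s) ^ 2 + 2 * (e + r * n * s) + (c - 1) * s ^ 2)
        = r * n ^ 2 + 2 * e * r⁻¹ + c * s ^ 2 * r⁻¹ := by
      linear_combination r * n ^ 2 * hri
    rw [p2] at p1
    have p3 := mul_nonneg hτ p1
    have p4 : 0 ≤ μ * s ^ 2 := by positivity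
    have p5 : 0 ≤ 2 * c * (b + H * s) := mul_nonneg (by linarith) (by linarith)
    have p6 : 0 ≤ τ * r * (b + H * s) := mul_nonneg (by positivity) (by linarith)
    have p7 : 0 ≤ 2 * (a + H * (r * n)) := by linarith
    have key : r * H * (2 * n + (2 * c + 1 - 1) * (r⁻¹ * s) + τ * s)
        + (2 * (a - 2 * θ * c * r⁻¹ * m - μ * e - τ * θ * m) + (2 - (2 * c + 1)) * n ^ 2
          + (c * (1 * (2 * (b + 2 * θ * r⁻¹ * m - μ * s ^ 2) + 2 * n ^ 2)
              + 2 * 0 * r ^ (0 - 2 : ℤ) * e)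
            + (μ * ((2 * c + 1 + 0) * 1 * s ^ 2 + 2 * 1 * e)
            + (τ * 2⁻¹ * (r * (2 * (b + 2 * θ * r⁻¹ * m - μ * s ^ 2) + 2 * n ^ 2)
                + 2 * 1 * r⁻¹ * e)
              + τ * 2⁻¹ * ((2 * c + 1 + -1) * r⁻¹ * s ^ 2 + 2 * r⁻¹ * e)))))
        = n ^ 2 + τ * (r * n ^ 2 + 2 * e * r⁻¹ + c * s ^ 2 * r⁻¹) + μ * s ^ 2
          + 2 * c * (b + H * s) + τ * r * (b + H * s) + 2 * (a + H * (r * n)) := by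
      linear_combination (2 * c * H * s + 2 * τ * θ * m) * hri - r * s ^ 2 * hμτ
    rw [key]
    linarith
  · intro x hx t ht
    have hr : 0 < ‖x‖ := norm_pos_iff.2 hx
    rw [sum_coord_add, sum_coord_add, sum_coord_add, sum_coord_add, sum_coord_smul, sum_coord_smul,
      sum_coord_smul, sum_coord_smul, sum_coord_pohozaevField, sum_coord_gradField,
      sum_coord_gradField, sum_coord_radialField, sum_coord_radialField]
    refine (mul_le_of_le_one_left (abs_nonneg _) ht.2).trans ?_
    have z2 : ‖x‖ ^ (-1 : ℤ) = ‖x‖⁻¹ := by norm_num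
    have z3 : ‖x‖ ^ (1 : ℤ) = ‖x‖ := zpow_one _
    have h2 : ‖x‖ ^ 2 * ‖x‖ ^ (-2 : ℤ) = 1 := by
      rw [← zpow_natCast ‖x‖ 2, ← zpow_add₀ hr.ne']; norm_num
    rw [z2, z3, zpow_zero]
    have hE := norm_euler_le q x
    have he := abs_le.1 (abs_re_euler_mul_conj_le q x (q x))
    have hn := Real.sq_sqrt (gradSq_nonneg q x)
    set e := (euler q x * starRingEnd ℂ (q x)).re
    set s := ‖q x‖
    set r := ‖x‖
    set E := ‖euler q x‖
    have hE0 : 0 ≤ E := norm_nonneg _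
    have hE2 : E ^ 2 ≤ r ^ 2 * gradSq q x := by
      rw [← hn, ← mul_pow]
      exact pow_le_pow_left₀ hE0 hE 2
    rw [← hn] at hE2 ⊢
    set n := √(gradSq q x)
    have hri : r * r⁻¹ = 1 := mul_inv_cancel₀ hr.ne'
    have hs0 : 0 ≤ s := norm_nonneg _
    have q1 : |e| ≤ (r ^ 2 * n ^ 2 + s ^ 2) / 2 :=
      abs_le.2 ⟨by nlinarith [sq_nonneg (r * n - s)], by nlinarith [sq_nonneg (r * n - s)]⟩
    have q2 : |r * e| ≤ r ^ 2 * (n ^ 2 + s ^ 2) / 2 := by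
      have : r * (r * n * s) ≤ r ^ 2 * (n ^ 2 + s ^ 2) / 2 := by
        nlinarith [mul_nonneg (sq_nonneg r) (sq_nonneg (n - s))]
      exact abs_le.2 ⟨by nlinarith [mul_le_mul_of_nonneg_left he.1 hr.le],
        by nlinarith [mul_le_mul_of_nonneg_left he.2 hr.le]⟩
    have q3 : r * s ^ 2 ≤ (r ^ 2 * s ^ 2 + s ^ 2) / 2 := by
      nlinarith [mul_nonneg (sq_nonneg s) (sq_nonneg (r - 1))]
    have e3 : r ^ 2 * (t ^ 2 * n ^ 2 + ((3 + c + τ) * n ^ 2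
        + ((c + τ) * (r ^ (-2 : ℤ) * s ^ 2) + (μ + 2 * τ) * s ^ 2)))
        = r ^ 2 * (t ^ 2 * n ^ 2) + (3 + c + τ) * (r ^ 2 * n ^ 2) + (c + τ) * s ^ 2
          + (μ + 2 * τ) * (r ^ 2 * s ^ 2) := by
      linear_combination (c + τ) * s ^ 2 * h2
    have e4 : 2 * E ^ 2 - r ^ 2 * n ^ 2 + (c * (2 * 1 * e) + (μ * (r ^ 2 * 1 * s ^ 2)
        + (τ / 2 * (2 * r * e) + τ / 2 * (r ^ 2 * r⁻¹ * s ^ 2))))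
        = (2 * E ^ 2 - r ^ 2 * n ^ 2) + 2 * c * e + μ * (r ^ 2 * s ^ 2) + τ * (r * e)
          + τ / 2 * (r * s ^ 2) := by
      linear_combination τ / 2 * r * s ^ 2 * hri
    rw [e3, e4]
    have h0 : 0 ≤ r ^ 2 * (t ^ 2 * n ^ 2) := by positivity
    have q1' := abs_le.1 q1
    have q2' := abs_le.1 q2
    have m1 := mul_le_mul_of_nonneg_left q1'.1 (show 0 ≤ 2 * c by linarith)
    have m2 := mul_le_mul_of_nonneg_left q1'.2 (show 0 ≤ 2 * c by linarith)
    have m3 := mul_le_mul_of_nonneg_left q2'.1 hτ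
    have m4 := mul_le_mul_of_nonneg_left q2'.2 hτ
    have m5 := mul_le_mul_of_nonneg_left q3 (show 0 ≤ τ / 2 by linarith)
    have m6 : 0 ≤ μ * (r ^ 2 * s ^ 2) := by positivity
    have m7 : 0 ≤ τ * (r * s ^ 2) := by positivity
    have m8 : 0 ≤ τ * (r ^ 2 * s ^ 2) := by positivity
    have m9 : 0 ≤ τ * s ^ 2 := by positivity
    have m10 : 0 ≤ τ * (r ^ 2 * n ^ 2) := by positivity
    have m11 : 0 ≤ r ^ 2 * n ^ 2 := by positivity
    have m12 : 0 ≤ E ^ 2 := by positivity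
    rw [abs_le]
    constructor <;> linarith

/-! ### Weighted square integrals -/

theorem locallyIntegrable_norm_zpow [NeZero d] {k : ℤ} (hk : -(d : ℤ) < k) :
    LocallyIntegrable (fun x : Space d => ‖x‖ ^ k) volume := by
  refine locallyIntegrable_of_norm_le_rpow (α := -k) (C := 1) ?_ ?_ ?_ ?_
  · simpa using Nat.one_le_iff_ne_zero.2 (NeZero.ne d)
  · have : (-(k : ℝ)) < d := by exact_mod_cast (by linarith : -k < (d : ℤ))
    simpa using this
  · filter_upwards [ae_ne_zero] with x _
    rw [one_mul, neg_neg, Real.rpow_intCast, Real.norm_of_nonneg (by positivity)]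
  · exact aestronglyMeasurable_of_continuousOn_ne_zero (continuousOn_norm_zpow k)

theorem integrable_norm_zpow_mul_sq [NeZero d] {k : ℤ} (hk : -(d : ℤ) < k) (hk0 : k ≤ 0)
    {v : Space d → ℂ} (hv : Continuous v) (h2 : Integrable (fun x => ‖v x‖ ^ 2) volume) :
    Integrable (fun x => ‖x‖ ^ k * ‖v x‖ ^ 2) volume := by
  obtain ⟨C, hC⟩ := (isCompact_closedBall (0 : Space d) 1).exists_bound_of_continuousOn
    hv.continuousOn
  have hloc : Integrable ((Metric.closedBall (0 : Space d) 1).indicator fun x => ‖x‖ ^ k) volume :=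
    ((locallyIntegrable_norm_zpow hk).integrableOn_isCompact
      (isCompact_closedBall (0 : Space d) 1)).integrable_indicator measurableSet_closedBall
  refine ((hloc.const_mul (C ^ 2)).add h2).mono' ?_ ?_
  · exact aestronglyMeasurable_of_continuousOn_ne_zero
      ((continuousOn_norm_zpow k).mul (hv.norm.pow 2).continuousOn)
  · filter_upwards [ae_ne_zero] with x hx
    rw [Real.norm_of_nonneg (by positivity), Pi.add_apply]
    by_cases hx1 : x ∈ Metric.closedBall (0 : Space d) 1
    · rw [indicator_of_mem hx1]
      have h3 : ‖v x‖ ^ 2 ≤ C ^ 2 := pow_le_pow_left₀ (norm_nonneg _) (hC x hx1) 2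
      have h4 : 0 ≤ ‖x‖ ^ k := by positivity
      nlinarith [mul_le_mul_of_nonneg_left h3 h4, sq_nonneg ‖v x‖]
    · rw [indicator_of_notMem hx1, mul_zero, zero_add]
      rw [mem_closedBall_zero_iff, not_le] at hx1
      have : ‖x‖ ^ k ≤ 1 := zpow_le_one_of_nonpos₀ hx1.le hk0
      exact mul_le_of_le_one_left (sq_nonneg _) this

/-- The Cauchy–Schwarz inequality for non-negative functions. -/
theorem integral_mul_le_sqrt {f g : Space d → ℝ} (hf0 : 0 ≤ f) (hg0 : 0 ≤ g)
    (hfm : AEStronglyMeasurable f volume) (hgm : AEStronglyMeasurable g volume)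
    (hf : Integrable (fun x => f x ^ 2) volume) (hg : Integrable (fun x => g x ^ 2) volume) :
    Integrable (fun x => f x * g x) volume ∧
      ∫ x, f x * g x ≤ √(∫ x, f x ^ 2) * √(∫ x, g x ^ 2) := by
  have hf2 : MemLp f 2 volume := (memLp_two_iff_integrable_sq hfm).2 hf
  have hg2 : MemLp g 2 volume := (memLp_two_iff_integrable_sq hgm).2 hg
  refine ⟨hf2.integrable_mul hg2, ?_⟩
  have h := integral_mul_le_Lp_mul_Lq_of_nonneg (p := 2) (q := 2) (μ := volume)
    Real.HolderConjugate.two_two (Eventually.of_forall hf0)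
    (Eventually.of_forall hg0) (by simpa using hf2) (by simpa using hg2)
  simpa [Real.sqrt_eq_rpow] using h

/-! ### Estimates for smooth solutions -/

/-- The class of smooth functions to which the multiplier estimates are applied; it contains the
mollifications of `H²` functions. -/
structure IsRegular (u : Space d → ℂ) : Prop where
  smooth : ContDiff ℝ (⊤ : ℕ∞) u
  sq : Integrable (fun x => ‖u x‖ ^ 2) volume
  sq_pd : ∀ i, Integrable (fun x => ‖pd i u x‖ ^ 2) volume
  sq_pd_pd : ∀ i j, Integrable (fun x => ‖pd i (pd j u) x‖ ^ 2) volume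
  sq_pd_lap : ∀ i, Integrable (fun x => ‖pd i (lap u) x‖ ^ 2) volume

section regular

variable {u : Space d → ℂ}

theorem ContDiff.pd_top (i : Fin d) (h : ContDiff ℝ (⊤ : ℕ∞) u) :
    ContDiff ℝ (⊤ : ℕ∞) (pd i u) :=
  contDiff_pd (by simp) i h

theorem ContDiff.lap_top (h : ContDiff ℝ (⊤ : ℕ∞) u) : ContDiff ℝ (⊤ : ℕ∞) (lap u) :=
  ContDiff.sum fun i _ => ContDiff.pd_top i (ContDiff.pd_top i h)

theorem ContDiff.of_top {n : ℕ} (h : ContDiff ℝ (⊤ : ℕ∞) u) : ContDiff ℝ n u :=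
  h.of_le (by exact_mod_cast le_top)

theorem integrable_sq_sum {ι : Type*} (s : Finset ι) {F : ι → Space d → ℂ}
    (hc : ∀ i, Continuous (F i)) (h : ∀ i, Integrable (fun x => ‖F i x‖ ^ 2) volume) :
    Integrable (fun x => ‖∑ i ∈ s, F i x‖ ^ 2) volume := by
  have h1 : ∀ i, MemLp (F i) 2 volume := fun i =>
    (memLp_two_iff_integrable_sq_norm (hc i).aestronglyMeasurable).2 (h i)
  have h2 : MemLp (fun x => ∑ i ∈ s, F i x) 2 volume := memLp_finsetSum s fun i _ => h1 i
  exact (memLp_two_iff_integrable_sq_norm h2.1).1 h2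

theorem IsRegular.sq_lap (hu : IsRegular u) : Integrable (fun x => ‖lap u x‖ ^ 2) volume :=
  integrable_sq_sum Finset.univ
    (fun i => (ContDiff.pd_top i (ContDiff.pd_top i hu.smooth)).continuous)
    fun i => hu.sq_pd_pd i i

theorem integrable_gradSq {q : Space d → ℂ} (h : ∀ i, Integrable (fun x => ‖pd i q x‖ ^ 2) volume) :
    Integrable (gradSq q) volume :=
  integrable_finsetSum _ fun i _ => h i

/-- The quadratic inequalities behind the estimate for `Re z ≤ 0`, in terms of the norms of `Δu`,
`u / |x|²`, `∇u / |x|` and `|x|² g`. -/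
theorem IsRegular.rellich_bounds [NeZero d] (hd : 5 ≤ d) (hu : IsRegular u) {z : ℂ}
    (hz : z.re ≤ 0) {g : Space d → ℂ} (hgc : Continuous g)
    (heq : ∀ x, lap (lap u) x = z * u x + g x)
    (hg : Integrable (fun x => ‖x‖ ^ 4 * ‖g x‖ ^ 2) volume) :
    Integrable (fun x => ‖x‖ ^ (-2 : ℤ) * gradSq u x) volume ∧
    √(∫ x, ‖lap u x‖ ^ 2) ^ 2 ≤ √(∫ x, ‖x‖ ^ 4 * ‖g x‖ ^ 2) * √(∫ x, ‖x‖ ^ (-4 : ℤ) * ‖u x‖ ^ 2) ∧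
    √(∫ x, ‖x‖ ^ (-2 : ℤ) * gradSq u x) ^ 2 + (d - 4) * √(∫ x, ‖x‖ ^ (-4 : ℤ) * ‖u x‖ ^ 2) ^ 2
      ≤ √(∫ x, ‖lap u x‖ ^ 2) * √(∫ x, ‖x‖ ^ (-4 : ℤ) * ‖u x‖ ^ 2) ∧
    ((d - 4) / 2 : ℝ) * √(∫ x, ‖x‖ ^ (-4 : ℤ) * ‖u x‖ ^ 2)
      ≤ √(∫ x, ‖x‖ ^ (-2 : ℤ) * gradSq u x) := by
  have hd5 : (5 : ℝ) ≤ d := by exact_mod_cast hd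
  have hdz : (5 : ℤ) ≤ d := by exact_mod_cast hd
  have huc := hu.smooth.continuous
  have hLc := (ContDiff.lap_top hu.smooth).continuous
  have hS4 : Integrable (fun x => ‖x‖ ^ (-4 : ℤ) * ‖u x‖ ^ 2) volume :=
    integrable_norm_zpow_mul_sq (by linarith) (by norm_num) huc hu.sq
  have hS2 : Integrable (fun x => ‖x‖ ^ (-2 : ℤ) * ‖u x‖ ^ 2) volume :=
    integrable_norm_zpow_mul_sq (by linarith) (by norm_num) huc hu.sq
  have hu2 : ContDiffOn ℝ 2 u {0}ᶜ := (ContDiff.of_top (n := 2) hu.smooth).contDiffOn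
  have hu1 : ContDiffOn ℝ 1 u {0}ᶜ := (ContDiff.of_top (n := 1) hu.smooth).contDiffOn
  have hzz : ∀ x : Space d, (‖x‖ ^ (-2 : ℤ)) ^ 2 = ‖x‖ ^ (-4 : ℤ) := by
    intro x; rw [← zpow_natCast, ← zpow_mul]; norm_num
  have hwm : AEStronglyMeasurable (fun x => ‖x‖ ^ (-2 : ℤ) * ‖u x‖) volume :=
    aestronglyMeasurable_of_continuousOn_ne_zero
      ((continuousOn_norm_zpow _).mul huc.norm.continuousOn)
  -- `⟨Δu, u/|x|²⟩`
  obtain ⟨i1, b1⟩ := integral_mul_le_sqrt (f := fun x => ‖lap u x‖)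
    (g := fun x => ‖x‖ ^ (-2 : ℤ) * ‖u x‖) (fun x => norm_nonneg _) (fun x => by positivity)
    hLc.norm.aestronglyMeasurable hwm hu.sq_lap (by simpa only [mul_pow, hzz] using hS4)
  obtain ⟨i2, b2⟩ := integral_mul_le_sqrt (f := fun x => ‖x‖ ^ 2 * ‖g x‖)
    (g := fun x => ‖x‖ ^ (-2 : ℤ) * ‖u x‖) (fun x => by positivity) (fun x => by positivity)
    ((continuous_norm.pow 2).mul hgc.norm).aestronglyMeasurable hwm
    (by simpa only [mul_pow, ← pow_mul] using hg) (by simpa only [mul_pow, hzz] using hS4)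
  simp only [mul_pow, hzz, ← pow_mul] at b1 b2
  norm_num only at b2
  have c1 : ∀ x : Space d, ‖lap u x‖ * (‖x‖ ^ (-2 : ℤ) * ‖u x‖)
      = ‖x‖ ^ (-2 : ℤ) * (‖lap u x‖ * ‖u x‖) := fun x => by ring
  have c2 : ∀ᵐ x : Space d, ‖x‖ ^ 2 * ‖g x‖ * (‖x‖ ^ (-2 : ℤ) * ‖u x‖) = ‖g x‖ * ‖u x‖ := by
    filter_upwards [ae_ne_zero] with x hx
    have hr : ‖x‖ ≠ 0 := norm_ne_zero_iff.2 hx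
    rw [zpow_neg, show ‖x‖ ^ (2 : ℤ) = ‖x‖ ^ 2 from zpow_natCast _ 2]
    field_simp
  simp only [c1] at i1 b1
  rw [integral_congr_ae c2] at b2
  have i2' := i2.congr c2
  obtain ⟨i3, b3⟩ := integral_gradSq_div_sq_le (by omega) hu2 hS4 i1
  have hG : Integrable (fun x => ‖x‖ ^ (-2 : ℤ) * gradSq u x) volume := by
    refine (i3.sub (hS4.const_mul ((d : ℝ) - 4))).congr (Eventually.of_forall fun x => ?_)
    simp
  have hhardy := hardy (-2) (by push_cast; linarith) hu1 (by norm_num; exact_mod_cast hS4) hG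
  have ben := integral_sq_lap_le hz (ContDiff.of_top (n := 4) hu.smooth) heq i2'
    (integrable_gradSq hu.sq_pd_lap) hS2 hu.sq_lap hG
  have n1 : 0 ≤ ∫ x, ‖lap u x‖ ^ 2 := integral_nonneg fun x => by positivity
  have n2 : 0 ≤ ∫ x, ‖x‖ ^ (-4 : ℤ) * ‖u x‖ ^ 2 := integral_nonneg fun x => by positivity
  have n3 : 0 ≤ ∫ x, ‖x‖ ^ (-2 : ℤ) * gradSq u x := integral_nonneg fun x =>
    mul_nonneg (by positivity) (gradSq_nonneg u x)
  rw [integral_add hG (hS4.const_mul _), integral_const_mul] at b3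
  refine ⟨hG, ?_, ?_, ?_⟩
  · rw [Real.sq_sqrt n1]
    exact ben.trans b2
  · rw [Real.sq_sqrt n3, Real.sq_sqrt n2]
    exact b3.trans b1
  · apply Real.le_sqrt_of_sq_le
    rw [mul_pow, Real.sq_sqrt n2]
    rw [show (-2 - 2 : ℤ) = -4 by norm_num] at hhardy
    convert hhardy using 2
    push_cast; ring

/-! ### The gauge transform of a smooth function -/

/-- `|∇(e^{-iθ|x|} v)|²`, written out in terms of `∇v` and `v`. -/
noncomputable def gaugeGradSq (θ : ℝ) (v : Space d → ℂ) (x : Space d) : ℝ :=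
  ∑ i, ‖pd i v x - θ * Complex.I * (x i / ‖x‖) * v x‖ ^ 2

/-- The function `e^{-iθ|x|} v`. -/
noncomputable def phase (θ : ℝ) (v : Space d → ℂ) (x : Space d) : ℂ :=
  Complex.exp (-(θ * Complex.I) * (‖x‖ : ℂ)) * v x

theorem norm_exp_phase (θ r : ℝ) : ‖Complex.exp (-(θ * Complex.I) * (r : ℂ))‖ = 1 := by
  rw [show -(θ * Complex.I) * (r : ℂ) = ((-(θ * r) : ℝ) : ℂ) * Complex.I by push_cast; ring]
  exact Complex.norm_exp_ofReal_mul_I _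

theorem norm_phase (θ : ℝ) (v : Space d → ℂ) (x : Space d) : ‖phase θ v x‖ = ‖v x‖ := by
  rw [phase, norm_mul, norm_exp_phase, one_mul]

theorem contDiffOn_phase (θ : ℝ) {n : WithTop ℕ∞} {v : Space d → ℂ} (hv : ContDiffOn ℝ n v {0}ᶜ) :
    ContDiffOn ℝ n (phase θ v) {0}ᶜ := by
  have h := contDiffOn_norm_zpow (d := d) (n := n) 1
  simp only [zpow_one] at h
  exact ((contDiffOn_const.mul h).cexp).mul hv

theorem hasPd_exp_phase (θ : ℝ) (i : Fin d) {x : Space d} (hx : x ≠ 0) :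
    HasPd i (fun y : Space d => Complex.exp (-(θ * Complex.I) * (‖y‖ : ℂ)))
      (Complex.exp (-(θ * Complex.I) * (‖x‖ : ℂ)) * (-(θ * Complex.I) * (x i / ‖x‖))) x :=
  HasPd.cexp (HasPd.const_mul _ (hasPd_norm i hx))

theorem pd_phase (θ : ℝ) {v : Space d → ℂ} (i : Fin d) {x : Space d} (hx : x ≠ 0)
    (hv : DifferentiableAt ℝ v x) :
    pd i (phase θ v) x = Complex.exp (-(θ * Complex.I) * (‖x‖ : ℂ))
      * (pd i v x - θ * Complex.I * (x i / ‖x‖) * v x) := by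
  have h := ((hasPd_exp_phase θ i hx).mul (DifferentiableAt.hasPd i hv)).2
  change pd i (phase θ v) x = _ at h
  rw [h]; ring

theorem gradSq_phase (θ : ℝ) {v : Space d → ℂ} {x : Space d} (hx : x ≠ 0)
    (hv : DifferentiableAt ℝ v x) : gradSq (phase θ v) x = gaugeGradSq θ v x := by
  refine Finset.sum_congr rfl fun i _ => ?_
  rw [pd_phase θ i hx hv, norm_mul, norm_exp_phase, one_mul]

theorem euler_phase (θ : ℝ) {v : Space d → ℂ} {x : Space d} (hx : x ≠ 0)
    (hv : DifferentiableAt ℝ v x) :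
    euler (phase θ v) x = Complex.exp (-(θ * Complex.I) * (‖x‖ : ℂ))
      * (euler v x - θ * Complex.I * ‖x‖ * v x) := by
  have hc : ((‖x‖ : ℝ) : ℂ) ≠ 0 := by exact_mod_cast norm_ne_zero_iff.2 hx
  have : (‖x‖ : ℂ) = (∑ i, (x i : ℂ) * (x i : ℂ)) / ‖x‖ := by
    rw [sum_coord_sq]; field_simp
  conv_rhs => enter [2, 2, 1]; rw [this]
  simp only [euler, Finset.sum_div, Finset.mul_sum, Finset.sum_mul, ← Finset.sum_sub_distrib]
  refine Finset.sum_congr rfl fun i _ => ?_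
  rw [pd_phase θ i hx hv]
  ring

theorem lap_phase (θ : ℝ) {v : Space d → ℂ} (hv : ContDiff ℝ 2 v) {x : Space d} (hx : x ≠ 0) :
    lap (phase θ v) x = Complex.exp (-(θ * Complex.I) * (‖x‖ : ℂ))
      * (lap v x - 2 * θ * Complex.I / ‖x‖ * euler v x - θ ^ 2 * v x
        - θ * Complex.I * ((d - 1) / ‖x‖) * v x) := by
  have hc : ((‖x‖ : ℝ) : ℂ) ≠ 0 := by exact_mod_cast norm_ne_zero_iff.2 hx
  have hvd : Differentiable ℝ v := hv.differentiable (by norm_num)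
  have hv2 : ∀ i, DifferentiableAt ℝ (pd i v) x := fun i =>
    (contDiff_pd (m := 1) (by norm_num) i hv).differentiable (by norm_num) x
  set e := Complex.exp (-(θ * Complex.I) * (‖x‖ : ℂ)) with he
  have key : ∀ i, pd i (pd i (phase θ v)) x = e * (-(θ * Complex.I) * (x i / ‖x‖))
      * (pd i v x - θ * Complex.I * (x i * ((‖x‖ ^ (-1 : ℤ) : ℝ) : ℂ) * v x))
      + e * (pd i (pd i v) x - θ * Complex.I *
        ((1 * ((‖x‖ ^ (-1 : ℤ) : ℝ) : ℂ) + x i * (((-1 : ℤ) * ‖x‖ ^ (-1 - 2 : ℤ) * x i : ℝ) : ℂ))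
          * v x + x i * ((‖x‖ ^ (-1 : ℤ) : ℝ) : ℂ) * pd i v x)) := by
    intro i
    have h1 : HasPd i (fun y => Complex.exp (-(θ * Complex.I) * (‖y‖ : ℂ))
        * (pd i v y - θ * Complex.I * (y i * ((‖y‖ ^ (-1 : ℤ) : ℝ) : ℂ) * v y))) _ x :=
      (hasPd_exp_phase θ i hx).mul ((DifferentiableAt.hasPd i (hv2 i)).sub (HasPd.const_mul _
        (((hasPd_coord i i x).mul (hasPd_norm_zpow i (-1) hx)).mul
          (DifferentiableAt.hasPd i (hvd x)))))
    have h2 : pd i (phase θ v) =ᶠ[𝓝 x] fun y => Complex.exp (-(θ * Complex.I) * (‖y‖ : ℂ))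
        * (pd i v y - θ * Complex.I * (y i * ((‖y‖ ^ (-1 : ℤ) : ℝ) : ℂ) * v y)) := by
      filter_upwards [isOpen_ne.mem_nhds hx] with y hy
      rw [pd_phase θ i hy (hvd y), zpow_neg_one]
      push_cast
      ring
    have h3 := (h1.congr_of_eventuallyEq h2).2
    rw [h3, he]
    simp
  have hz3 : ((‖x‖ ^ (-1 - 2 : ℤ) : ℝ) : ℂ) = 1 / (‖x‖ : ℂ) ^ 3 := by
    rw [show (-1 - 2 : ℤ) = -(3 : ℕ) by norm_num, zpow_neg, zpow_natCast]; push_cast; simp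
  have hz1 : ((‖x‖ ^ (-1 : ℤ) : ℝ) : ℂ) = 1 / (‖x‖ : ℂ) := by
    rw [zpow_neg_one]; push_cast; simp
  have e1 : ∀ i, pd i (pd i (phase θ v)) x = e * (pd i (pd i v) x
      - 2 * θ * Complex.I / ‖x‖ * (x i * pd i v x) - (θ ^ 2 / ‖x‖ ^ 2 * v x) * (x i * x i)
      - θ * Complex.I / ‖x‖ * v x + (θ * Complex.I / ‖x‖ ^ 3 * v x) * (x i * x i)) := by
    intro i
    rw [key i, hz1]
    push_cast
    have hz3' := hz3
    push_cast at hz3'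
    rw [hz3']
    linear_combination (e * θ ^ 2 * (x i / ‖x‖) * (x i / ‖x‖) * v x) * Complex.I_sq
  rw [lap, Finset.sum_congr rfl fun i _ => e1 i, ← Finset.mul_sum]
  simp only [Finset.sum_add_distrib, Finset.sum_sub_distrib, ← Finset.mul_sum, sum_coord_sq]
  simp only [lap, euler, Finset.sum_const, Finset.card_univ, Fintype.card_fin, nsmul_eq_mul]
  field_simp
  ring

end regular

/-! ### The estimate in the radiation gauge for smooth solutions -/

/-- The gauge frequency `(Re k)^{1/2} sgn(Im k)`. -/
noncomputable def gaugeFreq (k : ℂ) : ℝ := √k.re * Real.sign k.im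

/-- For `|Im k| ≤ Re k` one can write `k = θ² + μ + iτθ` with `θ` the gauge frequency, `μ, τ ≥ 0`
not both positive, and `τ² ≤ |Im k|`. -/
theorem exists_gauge_parameters {k : ℂ} (hk : |k.im| ≤ k.re) :
    ∃ μ τ : ℝ, 0 ≤ μ ∧ 0 ≤ τ ∧ τ * μ = 0 ∧ τ ^ 2 ≤ |k.im| ∧
      k = (gaugeFreq k : ℂ) ^ 2 + μ + τ * gaugeFreq k * Complex.I := by
  have hre : 0 ≤ k.re := (abs_nonneg _).trans hk
  by_cases him : k.im = 0
  · refine ⟨k.re, 0, hre, le_rfl, by simp, by simp, ?_⟩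
    apply Complex.ext <;> simp [gaugeFreq, him]
  · have him' : 0 < |k.im| := abs_pos.2 him
    have hre' : 0 < k.re := him'.trans_le hk
    have hs := Real.sq_sqrt hre
    have hs0 : 0 < √k.re := Real.sqrt_pos.2 hre'
    have hsign : Real.sign k.im * Real.sign k.im = 1 := by
      rcases Real.sign_apply_eq_of_ne_zero _ him with h | h <;> rw [h] <;> norm_num
    have habs : |k.im| * Real.sign k.im = k.im := by
      rcases lt_or_gt_of_ne him with h | h
      · rw [Real.sign_of_neg h, abs_of_neg h]; ring
      · rw [Real.sign_of_pos h, abs_of_pos h]; ring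
    refine ⟨0, |k.im| / √k.re, le_rfl, by positivity, by simp, ?_, ?_⟩
    · rw [div_pow, hs, div_le_iff₀ hre']
      nlinarith
    · have e1 : gaugeFreq k ^ 2 = k.re := by
        rw [gaugeFreq, mul_pow, hs, pow_two (Real.sign _), hsign, mul_one]
      have e2 : |k.im| / √k.re * gaugeFreq k = k.im := by
        rw [gaugeFreq]
        field_simp
        exact habs
      rw [← Complex.ofReal_pow, e1, ← Complex.ofReal_mul, e2]
      simp

/-- The arithmetic that turns the multiplier inequality, after Cauchy–Schwarz, into a bound of
`‖∇q‖` by the source. -/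
theorem le_six_mul_of_quadratic {X H Y P : ℝ} (hX : 0 ≤ X) (hH : 0 ≤ H) {d : ℝ} (hd : 5 ≤ d)
    (hY : (d - 2) / 2 * Y ≤ X) (hY0 : 0 ≤ Y) (hP : P ^ 2 ≤ H * Y)
    (h : X ^ 2 ≤ H * (2 * X + (d - 1) * Y + P)) : X ≤ 6 * H := by
  have h1 : (d - 1) * Y ≤ 8 / 3 * X := by
    nlinarith
  have h2 : Y ≤ 2 / 3 * X := by nlinarith
  have h3 : P ≤ (H + Y) / 2 := by
    apply le_of_sq_le_sq _ (by linarith)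
    nlinarith [sq_nonneg (H - Y)]
  have h4 : X ^ 2 ≤ H * (5 * X + H / 2) :=
    h.trans (mul_le_mul_of_nonneg_left (by linarith) hH)
  by_contra hc
  push Not at hc
  nlinarith

theorem lap_pd {u : Space d → ℂ} (hu : ContDiff ℝ (⊤ : ℕ∞) u) (j : Fin d) (x : Space d) :
    lap (pd j u) x = pd j (lap u) x := by
  have h2 : ∀ i, ContDiff ℝ (⊤ : ℕ∞) (pd i (pd i u)) := fun i =>
    ContDiff.pd_top i (ContDiff.pd_top i hu)
  have h := (HasPd.sum Finset.univ fun i _ =>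
    DifferentiableAt.hasPd j ((h2 i).differentiable (by simp) x)).2
  change pd j (lap u) x = _ at h
  rw [h]
  refine Finset.sum_congr rfl fun i _ => ?_
  have e : pd i (pd j u) = pd j (pd i u) :=
    funext fun y => pd_comm (ContDiff.of_top (n := 2) hu) i j y
  rw [e]
  exact pd_comm (ContDiff.of_top (n := 2) (ContDiff.pd_top i hu)) i j x

/-- The radiation-gauge estimate for the Helmholtz equation `(Δ + k) v = h`, uniform in `k`: the
gradient in the gauge is bounded by `|x| h`. -/
theorem integral_gaugeGradSq_le_helmholtz [NeZero d] (hd : 5 ≤ d) {k : ℂ} (hk : |k.im| ≤ k.re)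
    {v h : Space d → ℂ} (hv : ContDiff ℝ (⊤ : ℕ∞) v) (hv2 : Integrable (fun x => ‖v x‖ ^ 2) volume)
    (hpv : ∀ i, Integrable (fun x => ‖pd i v x‖ ^ 2) volume) (hc : Continuous h)
    (heq : ∀ x, lap v x + k * v x = h x)
    (hh : Integrable (fun x => ‖x‖ ^ 2 * ‖h x‖ ^ 2) volume) :
    Integrable (gaugeGradSq (gaugeFreq k) v) volume ∧
    ∫ x, gaugeGradSq (gaugeFreq k) v x ≤ 36 * ∫ x, ‖x‖ ^ 2 * ‖h x‖ ^ 2 ∧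
    ((d - 2) / 2 : ℝ) ^ 2 * ∫ x, ‖x‖ ^ (-2 : ℤ) * ‖v x‖ ^ 2
      ≤ ∫ x, gaugeGradSq (gaugeFreq k) v x := by
  have hd5 : (5 : ℝ) ≤ d := by exact_mod_cast hd
  have hdz : (5 : ℤ) ≤ d := by exact_mod_cast hd
  obtain ⟨μ, τ, hμ, hτ, hμτ, hτk, hkeq⟩ := exists_gauge_parameters hk
  set θ := gaugeFreq k
  set q := phase θ v with hq
  have hvd : Differentiable ℝ v := hv.differentiable (by simp)
  have hS2 : Integrable (fun x => ‖x‖ ^ (-2 : ℤ) * ‖v x‖ ^ 2) volume :=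
    integrable_norm_zpow_mul_sq (by linarith) (by norm_num) hv.continuous hv2
  have hq2 : ContDiffOn ℝ 2 q {0}ᶜ :=
    contDiffOn_phase θ (ContDiff.of_top (n := 2) hv).contDiffOn
  have hq1 : ContDiffOn ℝ 1 q {0}ᶜ := hq2.of_le (by norm_num)
  have hnq : ∀ x, ‖q x‖ = ‖v x‖ := norm_phase θ v
  have hgrad : gradSq q =ᵐ[volume] gaugeGradSq θ v := by
    filter_upwards [ae_ne_zero] with x hx
    exact gradSq_phase θ hx (hvd x)
  have hNv : Integrable (gradSq v) volume := integrable_gradSq hpv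
  have hNg : Integrable (gradSq q) volume := by
    refine ((hNv.add (hv2.const_mul (d * θ ^ 2))).const_mul 2).mono'
      (aestronglyMeasurable_of_continuousOn_ne_zero (continuousOn_gradSq hq1)) ?_
    filter_upwards [ae_ne_zero] with x hx
    rw [Real.norm_of_nonneg (gradSq_nonneg q x), gradSq_phase θ hx (hvd x)]
    have : ∀ i, ‖pd i v x - θ * Complex.I * (x i / ‖x‖) * v x‖ ^ 2
        ≤ 2 * (‖pd i v x‖ ^ 2 + θ ^ 2 * ‖v x‖ ^ 2) := by
      intro i
      have h1 : ‖θ * Complex.I * (x i / ‖x‖) * v x‖ ≤ |θ| * ‖v x‖ := by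
        rw [norm_mul, norm_mul, norm_mul, Complex.norm_I, Complex.norm_real, Real.norm_eq_abs,
          norm_div, Complex.norm_real, Complex.norm_real, norm_norm, mul_one]
        have : ‖x i‖ / ‖x‖ ≤ 1 := div_le_one_of_le₀ (PiLp.norm_apply_le x i) (norm_nonneg _)
        have h2 : |θ| * (‖x i‖ / ‖x‖) ≤ |θ| := mul_le_of_le_one_right (abs_nonneg _) this
        gcongr
      have h2 := norm_sub_le (pd i v x) (θ * Complex.I * (x i / ‖x‖) * v x)
      have h3 : ‖pd i v x - θ * Complex.I * (x i / ‖x‖) * v x‖ ≤ ‖pd i v x‖ + |θ| * ‖v x‖ := by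
        linarith
      have h4 := pow_le_pow_left₀ (norm_nonneg _) h3 2
      have h5 : (|θ| * ‖v x‖) ^ 2 = θ ^ 2 * ‖v x‖ ^ 2 := by rw [mul_pow, sq_abs]
      nlinarith [sq_nonneg (‖pd i v x‖ - |θ| * ‖v x‖)]
    refine (Finset.sum_le_sum fun i _ => this i).trans (le_of_eq ?_)
    rw [← Finset.mul_sum, Finset.sum_add_distrib]
    simp only [Finset.sum_const, Finset.card_univ, Fintype.card_fin, nsmul_eq_mul, Pi.add_apply,
      gradSq]
    ring
  have hNgi := integral_congr_ae hgrad
  -- the equation for `q`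
  set E : Space d → ℂ := fun x => Complex.exp (-(θ * Complex.I) * (‖x‖ : ℂ)) with hE
  have hEn : ∀ x, ‖E x * h x‖ = ‖h x‖ := fun x => by
    rw [norm_mul, hE, norm_exp_phase, one_mul]
  have heq' : ∀ x, x ≠ 0 → lap q x = (E x * h x)
      - (2 * θ * Complex.I / ‖x‖) * (euler q x + ((d - 1) / 2) * q x)
      - (μ + τ * θ * Complex.I) * q x := by
    intro x hx
    have hcx : ((‖x‖ : ℝ) : ℂ) ≠ 0 := by exact_mod_cast norm_ne_zero_iff.2 hx
    rw [hq, lap_phase θ (ContDiff.of_top (n := 2) hv) hx, euler_phase θ hx (hvd x), ← heq x, phase]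
    conv_rhs => rw [hkeq]
    simp only [hE]
    field_simp
    linear_combination (-2 * θ ^ 2 * v x * (‖x‖ : ℂ)) * Complex.I_sq
  have hQm : AEStronglyMeasurable (fun x => √(gradSq q x)) volume :=
    aestronglyMeasurable_of_continuousOn_ne_zero (continuousOn_gradSq hq1).sqrt
  have hHm : AEStronglyMeasurable (fun x => ‖x‖ * ‖h x‖) volume :=
    (continuous_norm.mul hc.norm).aestronglyMeasurable
  have hYm : AEStronglyMeasurable (fun x => ‖x‖⁻¹ * ‖q x‖) volume := by
    simp only [hnq]
    refine aestronglyMeasurable_of_continuousOn_ne_zero (ContinuousOn.mul ?_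
      hv.continuous.norm.continuousOn)
    simpa using continuousOn_norm_zpow (d := d) (-1)
  have hPm : AEStronglyMeasurable (fun x => ‖q x‖) volume := by
    simp only [hnq]
    exact hv.continuous.norm.aestronglyMeasurable
  have hH2 : Integrable (fun x => (‖x‖ * ‖h x‖) ^ 2) volume := by simpa only [mul_pow] using hh
  have hQ2 : ∀ x, √(gradSq q x) ^ 2 = gradSq q x := fun x => Real.sq_sqrt (gradSq_nonneg q x)
  have hY2 : ∀ x, (‖x‖⁻¹ * ‖q x‖) ^ 2 = ‖x‖ ^ (-2 : ℤ) * ‖v x‖ ^ 2 := by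
    intro x
    rw [mul_pow, hnq, zpow_neg, show ‖x‖ ^ (2 : ℤ) = ‖x‖ ^ 2 from zpow_natCast _ 2, inv_pow]
  obtain ⟨j1, c1⟩ := integral_mul_le_sqrt (f := fun x => ‖x‖ * ‖h x‖) (g := fun x => √(gradSq q x))
    (fun x => by positivity) (fun x => by positivity) hHm hQm hH2
    (by simpa only [hQ2] using hNg)
  obtain ⟨j2, c2⟩ := integral_mul_le_sqrt (f := fun x => ‖x‖ * ‖h x‖) (g := fun x => ‖x‖⁻¹ * ‖q x‖)
    (fun x => by positivity) (fun x => by positivity) hHm hYm hH2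
    (by simpa only [hY2] using hS2)
  obtain ⟨j3, c3⟩ := integral_mul_le_sqrt (f := fun x => ‖x‖ * ‖h x‖) (g := fun x => ‖q x‖)
    (fun x => by positivity) (fun x => by positivity) hHm hPm hH2
    (by simpa only [hnq] using hv2)
  simp only [hQ2] at c1
  simp only [hY2] at c2
  simp only [hnq] at c3
  have hsplit : (fun x => ‖x‖ * ‖E x * h x‖ * (2 * √(gradSq q x)
      + (d - 1) * (‖x‖⁻¹ * ‖q x‖) + τ * ‖q x‖))
      = fun x => 2 * (‖x‖ * ‖h x‖ * √(gradSq q x)) + (d - 1) * (‖x‖ * ‖h x‖ * (‖x‖⁻¹ * ‖q x‖))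
        + τ * (‖x‖ * ‖h x‖ * ‖q x‖) := by
    funext x; rw [hEn]; ring
  have hψi : Integrable (fun x => ‖x‖ * ‖E x * h x‖ * (2 * √(gradSq q x)
      + (d - 1) * (‖x‖⁻¹ * ‖q x‖) + τ * ‖q x‖)) volume := by
    rw [hsplit]
    exact ((j1.const_mul _).add (j2.const_mul _)).add (j3.const_mul _)
  have hmain := integral_gradSq_le_of_gauge (by omega) hμ hτ hμτ hq2 heq' hNg
    (by simpa only [hnq] using hv2) (by simpa only [hnq] using hS2) hψi
  have j12 : Integrable (fun x => 2 * (‖x‖ * ‖h x‖ * √(gradSq q x))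
      + (d - 1) * (‖x‖ * ‖h x‖ * (‖x‖⁻¹ * ‖q x‖))) volume := (j1.const_mul _).add (j2.const_mul _)
  rw [hsplit, integral_add j12 (j3.const_mul _),
    integral_add (j1.const_mul _) (j2.const_mul _), integral_const_mul, integral_const_mul,
    integral_const_mul] at hmain
  have hhardy := hardy 0 (by push_cast; linarith) hq1
    (by simpa only [hnq, zero_sub] using hS2) (by simpa only [zpow_zero, one_mul] using hNg)
  simp only [hnq, zero_sub, zpow_zero, one_mul, Int.cast_zero, add_zero] at hhardy
  have j2' : Integrable (fun x => ‖h x‖ * ‖v x‖) volume ∧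
      ∫ x, ‖x‖ * ‖h x‖ * (‖x‖⁻¹ * ‖q x‖) = ∫ x, ‖h x‖ * ‖v x‖ := by
    have : (fun x => ‖x‖ * ‖h x‖ * (‖x‖⁻¹ * ‖q x‖)) =ᵐ[volume] fun x => ‖h x‖ * ‖v x‖ := by
      filter_upwards [ae_ne_zero] with x hx
      have hr : ‖x‖ ≠ 0 := norm_ne_zero_iff.2 hx
      rw [hnq]; field_simp
    exact ⟨j2.congr this, integral_congr_ae this⟩
  have him := abs_im_mul_integral_sq_le (ContDiff.of_top (n := 2) hv).contDiffOn heq j2'.1 hNv hS2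
  rw [← j2'.2] at him
  have nX : 0 ≤ ∫ x, gradSq q x := integral_nonneg fun x => gradSq_nonneg q x
  have nY : 0 ≤ ∫ x, ‖x‖ ^ (-2 : ℤ) * ‖v x‖ ^ 2 := integral_nonneg fun x => by positivity
  have nP : 0 ≤ ∫ x, ‖v x‖ ^ 2 := integral_nonneg fun x => by positivity
  have nH : 0 ≤ ∫ x, ‖x‖ ^ 2 * ‖h x‖ ^ 2 := integral_nonneg fun x => by positivity
  simp only [mul_pow] at c1 c2 c3
  have hX := Real.sq_sqrt nX
  have hY := Real.sq_sqrt nY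
  have hP := Real.sq_sqrt nP
  have hHs := Real.sq_sqrt nH
  refine ⟨hNg.congr hgrad, ?_, ?_⟩
  · rw [← hNgi, ← hX, ← hHs]
    set X := √(∫ x, gradSq q x)
    set Y := √(∫ x, ‖x‖ ^ (-2 : ℤ) * ‖v x‖ ^ 2)
    set P := √(∫ x, ‖v x‖ ^ 2)
    set H := √(∫ x, ‖x‖ ^ 2 * ‖h x‖ ^ 2)
    have hX0 : 0 ≤ X := Real.sqrt_nonneg _
    have hY0 : 0 ≤ Y := Real.sqrt_nonneg _
    have hH0 : 0 ≤ H := Real.sqrt_nonneg _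
    have b1 : (d - 2 : ℝ) / 2 * Y ≤ X := by
      apply le_of_sq_le_sq _ hX0
      rw [mul_pow, hY, hX]
      exact hhardy
    have b2 : (τ * P) ^ 2 ≤ H * Y := by
      rw [mul_pow, hP]
      calc τ ^ 2 * ∫ x, ‖v x‖ ^ 2 ≤ |k.im| * ∫ x, ‖v x‖ ^ 2 := by gcongr
        _ ≤ H * Y := him.trans c2
    have b3 : X ^ 2 ≤ H * (2 * X + (d - 1) * Y + τ * P) := by
      rw [hX]
      have t1 := mul_le_mul_of_nonneg_left c2 (show (0 : ℝ) ≤ d - 1 by linarith)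
      have t2 := mul_le_mul_of_nonneg_left c3 hτ
      simp only [hnq] at hmain t1 t2
      nlinarith [hmain, c1, t1, t2]
    have := le_six_mul_of_quadratic hX0 hH0 hd5 b1 hY0 b2 b3
    nlinarith
  · rw [← hNgi]
    exact hhardy

/-- The key estimate for smooth solutions when `|Im k| ≤ Re k`, `k² = z`: the equation factors
into `(Δ - k)w = g`, `w = (Δ + k)u`; the first equation is elliptic and bounds `|x|∇w`, the second
one is a Helmholtz equation for each `∂_j u` with source `∂_j w`. -/
theorem IsRegular.gauge_bounds [NeZero d] (hd : 5 ≤ d) {u : Space d → ℂ} (hu : IsRegular u)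
    {z k : ℂ} (hkz : k ^ 2 = z) (hk : |k.im| ≤ k.re) {g : Space d → ℂ} (hgc : Continuous g)
    (heq : ∀ x, lap (lap u) x = z * u x + g x)
    (hg : Integrable (fun x => ‖x‖ ^ 4 * ‖g x‖ ^ 2) volume) :
    (∀ j, Integrable (gaugeGradSq (gaugeFreq k) (pd j u)) volume) ∧
    ∑ j, ∫ x, gaugeGradSq (gaugeFreq k) (pd j u) x
      ≤ (12 / (d - 4)) ^ 2 * ∫ x, ‖x‖ ^ 4 * ‖g x‖ ^ 2 ∧
    Integrable (fun x => ‖x‖ ^ (-2 : ℤ) * gradSq u x) volume ∧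
    ((d - 2) / 2 : ℝ) ^ 2 * ∫ x, ‖x‖ ^ (-2 : ℤ) * gradSq u x
      ≤ ∑ j, ∫ x, gaugeGradSq (gaugeFreq k) (pd j u) x := by
  have hd5 : (5 : ℝ) ≤ d := by exact_mod_cast hd
  have hdz : (5 : ℤ) ≤ d := by exact_mod_cast hd
  set w : Space d → ℂ := fun x => lap u x + k * u x with hwdef
  have hLs := ContDiff.lap_top hu.smooth
  have hws : ContDiff ℝ (⊤ : ℕ∞) w := hLs.add (contDiff_const.mul hu.smooth)
  have hpw : ∀ i x, pd i w x = pd i (lap u) x + k * pd i u x := fun i x =>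
    ((DifferentiableAt.hasPd i (hLs.differentiable (by simp) x)).add
      (HasPd.const_mul k (DifferentiableAt.hasPd i (hu.smooth.differentiable (by simp) x)))).2
  have hppw : ∀ i x, pd i (pd i w) x = pd i (pd i (lap u)) x + k * pd i (pd i u) x := by
    intro i x
    rw [show pd i w = fun y => pd i (lap u) y + k * pd i u y from funext (hpw i)]
    exact ((DifferentiableAt.hasPd i ((ContDiff.pd_top i hLs).differentiable (by simp) x)).add
      (HasPd.const_mul k (DifferentiableAt.hasPd i
        ((ContDiff.pd_top i hu.smooth).differentiable (by simp) x)))).2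
  have hweq : ∀ x, lap w x = k * w x + g x := by
    intro x
    have : lap w x = lap (lap u) x + k * lap u x := by
      conv_lhs => rw [lap]
      rw [Finset.sum_congr rfl fun i _ => hppw i x, Finset.sum_add_distrib, ← Finset.mul_sum]
      rfl
    rw [this, heq, ← hkz, hwdef]
    ring
  have hw2 : Integrable (fun x => ‖w x‖ ^ 2) volume := by
    have h1 : MemLp (lap u) 2 volume :=
      (memLp_two_iff_integrable_sq_norm hLs.continuous.aestronglyMeasurable).2 hu.sq_lap
    have h2 : MemLp u 2 volume :=
      (memLp_two_iff_integrable_sq_norm hu.smooth.continuous.aestronglyMeasurable).2 hu.sq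
    have h3 : MemLp w 2 volume := h1.add (h2.const_mul k)
    exact (memLp_two_iff_integrable_sq_norm h3.1).1 h3
  have hwc2 : ContDiffOn ℝ 2 w {0}ᶜ := (ContDiff.of_top (n := 2) hws).contDiffOn
  have hwc1 : ContDiffOn ℝ 1 w {0}ᶜ := (ContDiff.of_top (n := 1) hws).contDiffOn
  obtain ⟨i1, c1⟩ := integral_mul_le_sqrt (f := fun x => ‖x‖ ^ 2 * ‖g x‖) (g := fun x => ‖w x‖)
    (fun x => by positivity) (fun x => by positivity)
    ((continuous_norm.pow 2).mul hgc.norm).aestronglyMeasurable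
    hws.continuous.norm.aestronglyMeasurable
    (by simpa only [mul_pow, ← pow_mul] using hg) hw2
  simp only [mul_pow, ← pow_mul, mul_assoc] at i1 c1
  norm_num only at c1
  obtain ⟨hT, hTle⟩ := integral_sq_mul_gradSq_le ((abs_nonneg _).trans hk) hwc2 hweq hw2 i1
  rw [integral_add i1 (hw2.const_mul _), integral_const_mul] at hTle
  have hz2 : ∀ x : Space d, ‖x‖ ^ (2 : ℤ) = ‖x‖ ^ 2 := fun x => zpow_natCast _ 2
  have hhardy := hardy 2 (by push_cast; linarith) hwc1 (by simpa using hw2)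
    (by simpa only [hz2] using hT)
  simp only [hz2, sub_self, zpow_zero, one_mul] at hhardy
  have nT : 0 ≤ ∫ x, ‖x‖ ^ 2 * gradSq w x := integral_nonneg fun x =>
    mul_nonneg (sq_nonneg _) (gradSq_nonneg w x)
  have nW : 0 ≤ ∫ x, ‖w x‖ ^ 2 := integral_nonneg fun x => by positivity
  have nG : 0 ≤ ∫ x, ‖x‖ ^ 4 * ‖g x‖ ^ 2 := integral_nonneg fun x => by positivity
  -- the elliptic factor
  have hell : ∫ x, ‖x‖ ^ 2 * gradSq w x ≤ (2 / (d - 4)) ^ 2 * ∫ x, ‖x‖ ^ 4 * ‖g x‖ ^ 2 := by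
    have hTs := Real.sq_sqrt nT
    have hWs := Real.sq_sqrt nW
    have hGs := Real.sq_sqrt nG
    rw [← hTs, ← hWs] at hTle
    rw [← hTs, ← hGs, ← mul_pow]
    rw [← hTs, ← hWs] at hhardy
    set T := √(∫ x, ‖x‖ ^ 2 * gradSq w x)
    set W := √(∫ x, ‖w x‖ ^ 2)
    set Γ := √(∫ x, ‖x‖ ^ 4 * ‖g x‖ ^ 2)
    have hT0 : 0 ≤ T := Real.sqrt_nonneg _
    have hW0 : 0 ≤ W := Real.sqrt_nonneg _
    have hΓ0 : 0 ≤ Γ := Real.sqrt_nonneg _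
    have hWT : d / 2 * W ≤ T := by
      apply le_of_sq_le_sq _ hT0
      push_cast at hhardy
      calc (d / 2 * W) ^ 2 = ((d + 2 - 2) / 2 : ℝ) ^ 2 * W ^ 2 := by ring
        _ ≤ T ^ 2 := hhardy
    have h1 : T ^ 2 ≤ Γ * W + d * W ^ 2 := by linarith
    have hd0 : (0 : ℝ) < d := by linarith
    have h2 : W ≤ 2 / d * T := by
      rw [div_mul_eq_mul_div, le_div_iff₀ hd0]; linarith
    have h3 : T ^ 2 ≤ Γ * (2 / d * T) + d * (2 / d * T) ^ 2 :=
      h1.trans (add_le_add (mul_le_mul_of_nonneg_left h2 hΓ0)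
        (mul_le_mul_of_nonneg_left (pow_le_pow_left₀ hW0 h2 2) hd0.le))
    have h4 : d * T ^ 2 ≤ 2 * Γ * T + 4 * T ^ 2 := by
      have := mul_le_mul_of_nonneg_left h3 hd0.le
      field_simp at this
      nlinarith [this]
    have h5 : T ≤ 2 / (d - 4) * Γ := by
      rw [div_mul_eq_mul_div, le_div_iff₀ (by linarith)]
      rcases hT0.eq_or_lt with h | h
      · rw [← h]; linarith
      · nlinarith
    exact pow_le_pow_left₀ hT0 h5 2
  have hHj : ∀ j, Integrable (fun x => ‖x‖ ^ 2 * ‖pd j w x‖ ^ 2) volume := by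
    intro j
    refine hT.mono' ((continuous_norm.pow 2).mul
      ((ContDiff.pd_top j hws).continuous.norm.pow 2)).aestronglyMeasurable ?_
    filter_upwards with x
    rw [Real.norm_of_nonneg (by positivity)]
    exact mul_le_mul_of_nonneg_left (Finset.single_le_sum (f := fun i => ‖pd i w x‖ ^ 2)
      (fun i _ => sq_nonneg _) (Finset.mem_univ j)) (sq_nonneg _)
  have hj : ∀ j, _ := fun j => integral_gaugeGradSq_le_helmholtz hd hk
    (ContDiff.pd_top j hu.smooth) (hu.sq_pd j) (fun i => hu.sq_pd_pd i j)
    (ContDiff.pd_top j hws).continuous (fun x => by rw [lap_pd hu.smooth, hpw]) (hHj j)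
  have hYj : ∀ j, Integrable (fun x => ‖x‖ ^ (-2 : ℤ) * ‖pd j u x‖ ^ 2) volume := fun j =>
    integrable_norm_zpow_mul_sq (by linarith) (by norm_num) (ContDiff.pd_top j hu.smooth).continuous
      (hu.sq_pd j)
  refine ⟨fun j => (hj j).1, ?_, ?_, ?_⟩
  · calc ∑ j, ∫ x, gaugeGradSq (gaugeFreq k) (pd j u) x
        ≤ ∑ j, 36 * ∫ x, ‖x‖ ^ 2 * ‖pd j w x‖ ^ 2 := Finset.sum_le_sum fun j _ => (hj j).2.1
      _ = 36 * ∫ x, ‖x‖ ^ 2 * gradSq w x := by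
          rw [← Finset.mul_sum, ← integral_finsetSum _ fun j _ => hHj j]
          simp only [gradSq, Finset.mul_sum]
      _ ≤ 36 * ((2 / (d - 4)) ^ 2 * ∫ x, ‖x‖ ^ 4 * ‖g x‖ ^ 2) := by gcongr
      _ = _ := by ring
  · refine (integrable_finsetSum Finset.univ fun j _ => hYj j).congr
      (Eventually.of_forall fun x => ?_)
    simp only [gradSq, Finset.mul_sum]
  · have : ∫ x, ‖x‖ ^ (-2 : ℤ) * gradSq u x
        = ∑ j, ∫ x, ‖x‖ ^ (-2 : ℤ) * ‖pd j u x‖ ^ 2 := by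
      rw [← integral_finsetSum _ fun j _ => hYj j]
      simp only [gradSq, Finset.mul_sum]
    rw [this, Finset.mul_sum]
    exact Finset.sum_le_sum fun j _ => (hj j).2.2

/-! ### Convolution with test functions -/

/-- The convolution `f * η`, with the kernel `η` on the right. -/
noncomputable def conv (η f : Space d → ℂ) (x : Space d) : ℂ := ∫ t, f t * η (x - t)

section conv

variable {η f g v w : Space d → ℂ}

theorem IsTest.pd (h : IsTest η) (i : Fin d) : IsTest (pd i η) := by
  refine ⟨ContDiff.pd_top i h.1, ?_⟩
  exact h.2.fderiv_apply (𝕜 := ℝ) (v := EuclideanSpace.single i 1)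

theorem IsTest.reflect (h : IsTest η) (x : Space d) : IsTest (fun t => η (x - t)) :=
  ⟨h.1.comp (contDiff_const.sub contDiff_id),
    h.2.comp_homeomorph (Homeomorph.subLeft x)⟩

theorem pd_reflect (h : IsTest η) (i : Fin d) (x t : Space d) :
    pd i (fun s => η (x - s)) t = -pd i η (x - t) := by
  have h1 := ((h.1.differentiable (by simp)) (x - t)).hasFDerivAt.comp t
    ((hasFDerivAt_const x t).sub (hasFDerivAt_id t))
  have := (HasFDerivAt.hasPd i h1).2
  refine this.trans ?_
  simp [pd]

theorem laplacian_eq_lap (η : Space d → ℂ) (h : ContDiff ℝ 2 η) :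
    Laplacian.laplacian η = lap η := by
  rw [InnerProductSpace.laplacian_eq_iteratedFDeriv_orthonormalBasis η
    (EuclideanSpace.basisFun (Fin d) ℝ)]
  funext x
  refine Finset.sum_congr rfl fun i _ => ?_
  rw [iteratedFDeriv_two_apply]
  have h1 : DifferentiableAt ℝ (fderiv ℝ η) x :=
    (h.fderiv_right (m := 1) (by norm_num)).differentiable (by simp) x
  have h2 := h1.hasFDerivAt.clm_apply (hasFDerivAt_const (EuclideanSpace.single i (1 : ℝ)) x)
  have h3 := (HasFDerivAt.hasPd i h2).2
  rw [show pd i η = fun y => (fderiv ℝ η y) (EuclideanSpace.single i 1) from rfl, h3]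
  simp

theorem laplacian_reflect (h : IsTest η) (x t : Space d) :
    Laplacian.laplacian (fun s => η (x - s)) t = lap η (x - t) := by
  rw [laplacian_eq_lap _ (ContDiff.of_top (n := 2) (h.reflect x).1)]
  refine Finset.sum_congr rfl fun i _ => ?_
  rw [show pd i (fun s => η (x - s)) = fun s => (-1) * pd i η (x - s) by
    funext s; rw [pd_reflect h]; ring]
  rw [((DifferentiableAt.hasPd i
    (((h.pd i).reflect x).1.differentiable (by simp) t)).const_mul (-1)).2,
    pd_reflect (h.pd i)]
  ring

theorem integrable_mul_test (hf : LocallyIntegrable f volume) (h : IsTest η) :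
    Integrable (fun x => f x * η x) volume := by
  simpa [mul_comm] using hf.integrable_smul_left_of_hasCompactSupport h.1.continuous h.2

theorem contDiff_conv (h : IsTest η) (hf : LocallyIntegrable f volume) :
    ContDiff ℝ (⊤ : ℕ∞) (conv η f) :=
  h.2.contDiff_convolution_right (ContinuousLinearMap.mul ℝ ℂ) hf h.1

theorem pd_conv (h : IsTest η) (hf : LocallyIntegrable f volume) (i : Fin d) :
    pd i (conv η f) = conv (pd i η) f := by
  funext x
  have h1 := h.2.hasFDerivAt_convolution_right (ContinuousLinearMap.mul ℝ ℂ) hf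
    (h.1.of_le (by exact_mod_cast le_top)) x
  have h2 := (HasFDerivAt.hasPd i h1).2
  rw [convolution_precompR_apply _ hf (h.2.fderiv ℝ)
    (h.1.continuous_fderiv (by simp))] at h2
  exact h2

theorem lap_conv (h : IsTest η) (hf : LocallyIntegrable f volume) :
    lap (conv η f) = conv (lap η) f := by
  funext x
  simp_rw [conv, lap, Finset.mul_sum]
  rw [integral_finsetSum _ fun i _ => integrable_mul_test hf (((h.pd i).pd i).reflect x)]
  refine Finset.sum_congr rfl fun i _ => ?_
  rw [pd_conv h hf, pd_conv (h.pd i) hf]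
  rfl

/-- Weak derivatives commute with convolution. -/
theorem HasWeakPartial.pd_conv {i : Fin d} (hv : HasWeakPartial i v w) (h : IsTest η) :
    Bilaplacian.pd i (conv η v) = conv η w := by
  rw [Bilaplacian.pd_conv h hv.1]
  funext x
  have h1 := hv.2.2 _ (h.reflect x)
  have h2 : ∀ t, fderiv ℝ (fun s => η (x - s)) t (EuclideanSpace.single i 1)
      = -Bilaplacian.pd i η (x - t) := fun t => pd_reflect h i x t
  simp_rw [h2, mul_neg] at h1
  rw [integral_neg, neg_inj] at h1
  exact h1

end conv

/-! ### Square integrability of convolutions -/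

theorem lintegral_mul_sq_le {α : Type*} [MeasurableSpace α] {μ : Measure α} {f g : α → ENNReal}
    (hf : AEMeasurable f μ) (hg : AEMeasurable g μ) :
    (∫⁻ a, f a * g a ∂μ) ^ 2 ≤ (∫⁻ a, f a ^ 2 ∂μ) * ∫⁻ a, g a ^ 2 ∂μ := by
  have h := ENNReal.lintegral_mul_le_Lp_mul_Lq μ Real.HolderConjugate.two_two hf hg
  have h2 := pow_le_pow_left' h 2
  have e : ∀ c : ENNReal, (c ^ (1 / 2 : ℝ)) ^ 2 = c := fun c => by
    rw [← ENNReal.rpow_natCast, ← ENNReal.rpow_mul]; norm_num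
  rw [mul_pow, e, e] at h2
  simpa using h2

/-- A weighted Schur test: the Cauchy–Schwarz inequality with the weight `S` gives
`(F * κ)² ≤ ((F S)² * κ) (S⁻² * κ)`, and the first factor is integrated against `m (S⁻² * κ)`. -/
theorem lintegral_kernel_sq_le {κ F S m : Space d → ENNReal} (hκ : Measurable κ)
    (hF : AEMeasurable F volume) (hS : Measurable S) (hS0 : ∀ᵐ y, S y ≠ 0 ∧ S y ≠ ⊤)
    (hm : Measurable m) :
    ∫⁻ x, m x * (∫⁻ y, F y * κ (x - y)) ^ 2
      ≤ ∫⁻ y, (F y * S y) ^ 2 * ∫⁻ x, κ (x - y) * (m x * ∫⁻ t, (S t)⁻¹ ^ 2 * κ (x - t)) := by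
  set M : Space d → ENNReal := fun x => m x * ∫⁻ t, (S t)⁻¹ ^ 2 * κ (x - t) with hMdef
  have hκ2 : Measurable fun p : Space d × Space d => κ (p.1 - p.2) :=
    hκ.comp (measurable_fst.sub measurable_snd)
  have hM : Measurable M := by
    refine hm.mul (Measurable.lintegral_prod_right' (f := fun p : Space d × Space d =>
      (S p.2)⁻¹ ^ 2 * κ (p.1 - p.2)) ?_)
    exact ((hS.comp measurable_snd).inv.pow_const 2).mul hκ2
  have hκx : ∀ x, Measurable fun y => κ (x - y) := fun x => hκ.comp (measurable_const.sub measurable_id)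
  have hFS : AEMeasurable (fun y => F y * S y) volume := hF.mul hS.aemeasurable
  have h1 : ∀ x, (∫⁻ y, F y * κ (x - y)) ^ 2
      ≤ (∫⁻ y, κ (x - y) * (F y * S y) ^ 2) * ∫⁻ y, (S y)⁻¹ ^ 2 * κ (x - y) := by
    intro x
    have hac := withDensity_absolutelyContinuous (volume : Measure (Space d)) fun y => κ (x - y)
    have h2 := lintegral_mul_sq_le (hFS.mono_ac hac) (hS.inv.aemeasurable (μ :=
      (volume : Measure (Space d)).withDensity fun y => κ (x - y)))
    have wd : ∀ G : Space d → ENNReal, AEMeasurable G volume →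
        ∫⁻ y, G y ∂(volume : Measure (Space d)).withDensity (fun y => κ (x - y))
          = ∫⁻ y, κ (x - y) * G y := fun G hG =>
      lintegral_withDensity_eq_lintegral_mul₀ (hκx x).aemeasurable hG
    rw [wd (fun y => F y * S y * S⁻¹ y) (hFS.mul hS.inv.aemeasurable),
      wd (fun y => (F y * S y) ^ 2) (hFS.pow_const 2),
      wd (fun y => S⁻¹ y ^ 2) (hS.inv.pow_const 2).aemeasurable] at h2
    refine le_trans (le_of_eq ?_) (h2.trans (le_of_eq ?_))
    · congr 1
      refine lintegral_congr_ae ?_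
      filter_upwards [hS0] with y hy
      simp only [Pi.inv_apply]
      rw [mul_assoc, ENNReal.mul_inv_cancel hy.1 hy.2, mul_one, mul_comm]
    · simp only [Pi.inv_apply]
      congr 1
      exact lintegral_congr fun y => mul_comm _ _
  calc ∫⁻ x, m x * (∫⁻ y, F y * κ (x - y)) ^ 2
      ≤ ∫⁻ x, (∫⁻ y, κ (x - y) * (F y * S y) ^ 2) * M x := by
        refine lintegral_mono fun x => ?_
        calc _ ≤ m x * ((∫⁻ y, κ (x - y) * (F y * S y) ^ 2) * ∫⁻ y, (S y)⁻¹ ^ 2 * κ (x - y)) := by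
              gcongr; exact h1 x
          _ = _ := by rw [hMdef]; ring
    _ = ∫⁻ x, ∫⁻ y, κ (x - y) * (F y * S y) ^ 2 * M x := by
        refine lintegral_congr fun x => ?_
        exact (lintegral_mul_const'' (M x) (f := fun y => κ (x - y) * (F y * S y) ^ 2)
          ((hκx x).aemeasurable.mul (hFS.pow_const 2))).symm
    _ = ∫⁻ y, ∫⁻ x, κ (x - y) * (F y * S y) ^ 2 * M x := by
        refine lintegral_lintegral_swap ?_
        refine (hκ2.aemeasurable.mul ?_).mul (hM.comp measurable_fst).aemeasurable
        exact (hFS.pow_const 2).comp_quasiMeasurePreserving Measure.quasiMeasurePreserving_snd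
    _ = _ := by
        refine lintegral_congr fun y => ?_
        rw [← lintegral_const_mul (f := fun x => κ (x - y) * M x) _
          ((hκ.comp (measurable_id.sub_const y)).mul hM)]
        exact lintegral_congr fun x => by ring

/-- Young's inequality for the convolution of `L¹` with `L²`. -/
theorem lintegral_kernel_sq_le_mul {κ F : Space d → ENNReal} (hκ : Measurable κ)
    (hF : AEMeasurable F volume) :
    ∫⁻ x, (∫⁻ y, F y * κ (x - y)) ^ 2 ≤ (∫⁻ y, κ y) ^ 2 * ∫⁻ y, F y ^ 2 := by
  have h := lintegral_kernel_sq_le (S := fun _ => 1) (m := fun _ => 1) hκ hF measurable_const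
    (by simp) measurable_const
  simp only [one_mul, mul_one, inv_one, one_pow, lintegral_sub_left_eq_self κ] at h
  have h2 : ∀ y, ∫⁻ x, κ (x - y) * ∫⁻ t, κ t = (∫⁻ t, κ t) * ∫⁻ t, κ t := fun y => by
    rw [lintegral_mul_const (f := fun x => κ (x - y)) _ (hκ.comp (measurable_id.sub_const _)),
      lintegral_sub_right_eq_self κ]
  simp_rw [h2] at h
  refine h.trans (le_of_eq ?_)
  rw [lintegral_mul_const'' _ (hF.pow_const 2)]
  ring

theorem enorm_conv_le (η f : Space d → ℂ) (x : Space d) :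
    ‖conv η f x‖ₑ ≤ ∫⁻ y, ‖f y‖ₑ * ‖η (x - y)‖ₑ := by
  refine (enorm_integral_le_lintegral_enorm _).trans (le_of_eq ?_)
  simp_rw [enorm_mul]

theorem integrable_sq_iff {f : Space d → ℂ} (hf : AEStronglyMeasurable f volume) :
    Integrable (fun x => ‖f x‖ ^ 2) volume ↔ MemLp f 2 volume := by
  rw [← memLp_two_iff_integrable_sq hf.norm, memLp_norm_iff hf]

theorem lintegral_enorm_sq_lt_top {f : Space d → ℂ} (hf : MemLp f 2 volume) :
    ∫⁻ x, ‖f x‖ₑ ^ 2 < ⊤ := by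
  have := lintegral_rpow_enorm_lt_top_of_eLpNorm_lt_top (p := 2) (by simp) (by simp) hf.2
  simpa using this

theorem integrable_sq_conv {η f : Space d → ℂ} (h : IsTest η) (hf : MemLp f 2 volume) :
    Integrable (fun x => ‖conv η f x‖ ^ 2) volume := by
  have hc := (contDiff_conv h (hf.locallyIntegrable (by norm_num))).continuous
  refine ⟨(hc.norm.pow 2).aestronglyMeasurable, ?_⟩
  have h1 : ∫⁻ x, ‖‖conv η f x‖ ^ 2‖ₑ ≤ ∫⁻ x, (∫⁻ y, ‖f y‖ₑ * ‖η (x - y)‖ₑ) ^ 2 := by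
    refine lintegral_mono fun x => ?_
    rw [enorm_pow, enorm_norm]
    gcongr
    exact enorm_conv_le η f x
  refine (h1.trans (lintegral_kernel_sq_le_mul (κ := fun y => ‖η y‖ₑ)
    h.1.continuous.enorm.measurable hf.1.enorm)).trans_lt ?_
  refine ENNReal.mul_lt_top (ENNReal.pow_lt_top ?_) (lintegral_enorm_sq_lt_top hf)
  exact (h.1.continuous.integrable_of_hasCompactSupport h.2).2

/-! ### Mollification -/

/-- A bump function at the origin that equals `1` on the ball of radius `1 / (n + 1)` and vanishes
off the ball of radius `2 / (n + 1)`. -/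
noncomputable def bump (d n : ℕ) : ContDiffBump (0 : Space d) where
  rIn := 1 / (n + 1)
  rOut := 2 * (1 / (n + 1))
  rIn_pos := by positivity
  rIn_lt_rOut := by
    have : (0 : ℝ) < 1 / (n + 1) := by positivity
    linarith

/-- The mollifier of integral one at scale `1 / (n + 1)`. -/
noncomputable def mollifier (d n : ℕ) (x : Space d) : ℂ := ((bump d n).normed volume x : ℝ)

theorem isTest_mollifier (d n : ℕ) : IsTest (mollifier d n) :=
  ⟨Complex.ofRealCLM.contDiff.comp (bump d n).contDiff_normed,
    ((bump d n).hasCompactSupport_normed (μ := volume)).comp_left (g := fun r : ℝ => (r : ℂ))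
      Complex.ofReal_zero⟩

theorem enorm_mollifier (n : ℕ) (x : Space d) :
    ‖mollifier d n x‖ₑ = ENNReal.ofReal ((bump d n).normed volume x) := by
  rw [mollifier, ← ofReal_norm, Complex.norm_of_nonneg ((bump d n).nonneg_normed x)]

theorem lintegral_enorm_mollifier (n : ℕ) : ∫⁻ x, ‖mollifier d n x‖ₑ = 1 := by
  simp_rw [enorm_mollifier]
  rw [← ofReal_integral_eq_lintegral_ofReal (bump d n).integrable_normed
    (Eventually.of_forall fun x => (bump d n).nonneg_normed x), (bump d n).integral_normed]
  simp

theorem mollifier_eq_zero {n : ℕ} {x : Space d} (hx : 2 * (1 / ((n : ℝ) + 1)) ≤ ‖x‖) :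
    mollifier d n x = 0 := by
  have h : x ∉ Function.support ((bump d n).normed volume) := by
    rw [(bump d n).support_normed_eq, mem_ball_zero_iff, not_lt]
    exact hx
  rw [Function.notMem_support] at h
  rw [mollifier, h, Complex.ofReal_zero]

theorem ae_tendsto_conv_mollifier {f : Space d → ℂ} (hf : LocallyIntegrable f volume) :
    ∀ᵐ x, Tendsto (fun n => conv (mollifier d n) f x) atTop (𝓝 (f x)) := by
  have hlim : Tendsto (fun n : ℕ => (bump d n).rOut) atTop (𝓝 0) := by
    have := (tendsto_one_div_add_atTop_nhds_zero_nat (𝕜 := ℝ)).const_mul 2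
    simpa [bump] using this
  have h := ContDiffBump.ae_convolution_tendsto_right_of_locallyIntegrable (μ := volume) (K := 2)
    hlim (Eventually.of_forall fun n => le_rfl) hf
  filter_upwards [h] with x hx
  refine hx.congr fun n => ?_
  rw [conv, ← integral_sub_left_eq_self _ volume x]
  refine integral_congr_ae (Eventually.of_forall fun t => ?_)
  simp [mollifier, mul_comm]

/-- Convolution does not increase the `L²` norm. -/
theorem lintegral_conv_mollifier_sq_le {f : Space d → ℂ} (hf : AEStronglyMeasurable f volume)
    (n : ℕ) : ∫⁻ x, ‖conv (mollifier d n) f x‖ₑ ^ 2 ≤ ∫⁻ x, ‖f x‖ₑ ^ 2 := by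
  have h := lintegral_kernel_sq_le_mul (κ := fun y => ‖mollifier d n y‖ₑ)
    (isTest_mollifier d n).1.continuous.enorm.measurable hf.enorm
  rw [lintegral_enorm_mollifier, one_pow, one_mul] at h
  refine (lintegral_mono fun x => ?_).trans h
  gcongr
  exact enorm_conv_le _ f x

/-! ### Mollification in the weighted space -/

theorem inv_enorm_sq_sq {t : Space d} (ht : t ≠ 0) :
    (‖t‖ₑ ^ 2)⁻¹ ^ 2 = ENNReal.ofReal (‖t‖ ^ (-4 : ℤ)) := by
  have h : 0 < ‖t‖ := norm_pos_iff.2 ht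
  rw [← ofReal_norm, ← ENNReal.ofReal_pow h.le, ← ENNReal.ofReal_inv_of_pos (by positivity),
    ← ENNReal.ofReal_pow (by positivity)]
  congr 1
  rw [zpow_neg, inv_pow, ← pow_mul]
  rfl

theorem enorm_pow_four_mul {x t : Space d} (ht : t ≠ 0) :
    ‖x‖ₑ ^ 4 * (‖t‖ₑ ^ 2)⁻¹ ^ 2 = ENNReal.ofReal ((‖x‖ / ‖t‖) ^ 4) := by
  rw [inv_enorm_sq_sq ht, ← ofReal_norm, ← ENNReal.ofReal_pow (norm_nonneg _),
    ← ENNReal.ofReal_mul (by positivity), div_pow, div_eq_mul_inv, zpow_neg]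
  rfl

theorem integral_closedBall_norm_zpow {R : ℝ} (hR : 0 < R) (k : ℤ) :
    ∫ x in Metric.closedBall (0 : Space d) R, ‖x‖ ^ k
      = R ^ d * R ^ k * ∫ x in Metric.closedBall (0 : Space d) 1, ‖x‖ ^ k := by
  have h := Measure.setIntegral_comp_smul_of_pos (volume : Measure (Space d))
    (fun x => ‖x‖ ^ k) (Metric.closedBall 0 1) hR
  rw [smul_closedBall _ _ zero_le_one, smul_zero, Real.norm_of_nonneg hR.le, mul_one,
    finrank_euclideanSpace_fin, smul_eq_mul] at h
  simp_rw [norm_smul, Real.norm_of_nonneg hR.le, mul_zpow] at h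
  rw [integral_const_mul] at h
  rw [mul_assoc, h, mul_inv_cancel_left₀ (by positivity)]

/-- The weight `|x|⁴` is comparable with its mollified inverse, uniformly in the scale. Near the
origin this is the scaling of the integral of `|t|⁻⁴`, finite since `d ≥ 5`. -/
theorem exists_weight_bound [NeZero d] (hd : 5 ≤ d) : ∃ C : ENNReal, C ≠ ⊤ ∧
    ∀ (n : ℕ) (x : Space d),
      ‖x‖ₑ ^ 4 * ∫⁻ t, (‖t‖ₑ ^ 2)⁻¹ ^ 2 * ‖mollifier d n (x - t)‖ₑ ≤ C := by
  set J := ∫ x in Metric.closedBall (0 : Space d) 1, ‖x‖ ^ (-4 : ℤ) with hJ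
  set v := (volume : Measure (Space d)).real (Metric.ball 0 1) with hv
  have hv0 : 0 < v := ENNReal.toReal_pos (Metric.measure_ball_pos _ _ one_pos).ne'
    measure_ball_lt_top.ne
  refine ⟨16 + ENNReal.ofReal (256 / v * (2 ^ d * J / 16)), by finiteness, fun n x => ?_⟩
  set ε : ℝ := 1 / ((n : ℝ) + 1) with hε
  have hε0 : 0 < ε := by positivity
  have hmeas : Measurable fun t : Space d => (‖t‖ₑ ^ 2)⁻¹ ^ 2 * ‖mollifier d n (x - t)‖ₑ :=
    ((measurable_enorm.pow_const 2).inv.pow_const 2).mul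
      (((isTest_mollifier d n).reflect x).1.continuous.enorm.measurable)
  have hint : IntegrableOn (fun t : Space d => ‖t‖ ^ (-4 : ℤ)) (Metric.closedBall 0 (2 * ε)) :=
    (locallyIntegrable_norm_zpow (by omega)).integrableOn_isCompact (isCompact_closedBall _ _)
  have hsup : ∀ y, (bump d n).normed volume y ≤ 1 / (ε ^ d * v) := by
    intro y
    refine ((bump d n).normed_le_div_measure_closedBall_rIn volume y).trans (le_of_eq ?_)
    rw [Measure.addHaar_real_closedBall _ _ (bump d n).rIn_pos.le, finrank_euclideanSpace_fin]
    rfl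
  have hpt : ∀ t : Space d, t ≠ 0 → ‖x‖ₑ ^ 4 * ((‖t‖ₑ ^ 2)⁻¹ ^ 2 * ‖mollifier d n (x - t)‖ₑ)
      ≤ 16 * ‖mollifier d n (x - t)‖ₑ + (Metric.closedBall (0 : Space d) (2 * ε)).indicator
        (fun t => ENNReal.ofReal (256 * ε ^ 4 / (ε ^ d * v) * ‖t‖ ^ (-4 : ℤ))) t := by
    intro t ht
    have ht0 : 0 < ‖t‖ := norm_pos_iff.2 ht
    rw [← mul_assoc, enorm_pow_four_mul ht]
    -- for `|t| < |x| / 2` the kernel vanishes unless `|x| ≤ 4ε`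
    rcases le_or_gt (‖x‖ / 2) ‖t‖ with h | h
    · refine le_add_right ?_
      gcongr
      rw [show (16 : ENNReal) = ENNReal.ofReal (2 ^ 4) by norm_num]
      refine ENNReal.ofReal_le_ofReal (pow_le_pow_left₀ (by positivity) ?_ 4)
      rw [div_le_iff₀ ht0]
      linarith
    · have h3 : ‖x‖ - ‖t‖ ≤ ‖x - t‖ := norm_sub_norm_le x t
      by_cases h2 : ‖x‖ ≤ 4 * ε
      · refine le_add_left ?_
        rw [indicator_of_mem (by rw [mem_closedBall_zero_iff]; linarith), enorm_mollifier,
          ← ENNReal.ofReal_mul (by positivity)]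
        refine ENNReal.ofReal_le_ofReal ?_
        calc (‖x‖ / ‖t‖) ^ 4 * (bump d n).normed volume (x - t)
            ≤ (4 * ε / ‖t‖) ^ 4 * (1 / (ε ^ d * v)) := by
              gcongr
              · exact (bump d n).nonneg_normed _
              · exact hsup _
          _ = _ := by
              rw [zpow_neg, div_pow, show ‖t‖ ^ (4 : ℤ) = ‖t‖ ^ 4 from rfl]
              field_simp
              norm_num
      · rw [mollifier_eq_zero (x := x - t) (by rw [← hε]; linarith)]
        simp
  rw [← lintegral_const_mul _ hmeas]
  calc ∫⁻ t, ‖x‖ₑ ^ 4 * ((‖t‖ₑ ^ 2)⁻¹ ^ 2 * ‖mollifier d n (x - t)‖ₑ)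
      ≤ ∫⁻ t, (16 * ‖mollifier d n (x - t)‖ₑ + (Metric.closedBall (0 : Space d) (2 * ε)).indicator
        (fun t => ENNReal.ofReal (256 * ε ^ 4 / (ε ^ d * v) * ‖t‖ ^ (-4 : ℤ))) t) := by
        refine lintegral_mono_ae ?_
        filter_upwards [ae_ne_zero] with t ht using hpt t ht
    _ = 16 + ∫⁻ t in Metric.closedBall (0 : Space d) (2 * ε),
          ENNReal.ofReal (256 * ε ^ 4 / (ε ^ d * v) * ‖t‖ ^ (-4 : ℤ)) := by
        have h1 : Measurable fun t : Space d => ‖mollifier d n (x - t)‖ₑ :=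
          ((isTest_mollifier d n).reflect x).1.continuous.enorm.measurable
        rw [lintegral_add_left (h1.const_mul 16), lintegral_const_mul _ h1,
          lintegral_sub_left_eq_self (fun t => ‖mollifier d n t‖ₑ), lintegral_enorm_mollifier,
          mul_one, lintegral_indicator measurableSet_closedBall]
    _ = 16 + ENNReal.ofReal (256 / v * (2 ^ d * J / 16)) := by
        rw [← ofReal_integral_eq_lintegral_ofReal (hint.const_mul _)
          (Eventually.of_forall fun t => by positivity), integral_const_mul,
          integral_closedBall_norm_zpow (by positivity) (-4)]
        congr 2
        rw [← hJ, zpow_neg, mul_pow, show (2 * ε) ^ (4 : ℤ) = (2 * ε) ^ 4 from rfl, mul_pow]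
        field_simp
        ring

/-- Mollification is asymptotically non-expansive in the weighted space `L²(|x|⁴ dx)`. -/
theorem exists_tendsto_weighted_conv [NeZero d] (hd : 5 ≤ d) {f : Space d → ℂ}
    (hf : AEStronglyMeasurable f volume) (hfin : ∫⁻ y, (‖f y‖ₑ * ‖y‖ₑ ^ 2) ^ 2 ≠ ⊤) :
    ∃ N : ℕ → ENNReal, Tendsto N atTop (𝓝 (∫⁻ y, (‖f y‖ₑ * ‖y‖ₑ ^ 2) ^ 2)) ∧
      ∀ n, ∫⁻ x, ‖x‖ₑ ^ 4 * ‖conv (mollifier d n) f x‖ₑ ^ 2 ≤ N n := by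
  obtain ⟨C, hC, hbd⟩ := exists_weight_bound hd
  set k : ℕ → Space d → ENNReal := fun n x =>
    ‖x‖ₑ ^ 4 * ∫⁻ t, (‖t‖ₑ ^ 2)⁻¹ ^ 2 * ‖mollifier d n (x - t)‖ₑ with hk
  have hκ : ∀ n, Measurable fun x : Space d => ‖mollifier d n x‖ₑ := fun n =>
    (isTest_mollifier d n).1.continuous.enorm.measurable
  have hκ2 : ∀ n, Measurable fun p : Space d × Space d => ‖mollifier d n (p.1 - p.2)‖ₑ := fun n =>
    (hκ n).comp (measurable_fst.sub measurable_snd)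
  have hkm : ∀ n, Measurable (k n) := by
    intro n
    refine (measurable_enorm.pow_const 4).mul (Measurable.lintegral_prod_right'
      (f := fun p : Space d × Space d => (‖p.2‖ₑ ^ 2)⁻¹ ^ 2 * ‖mollifier d n (p.1 - p.2)‖ₑ) ?_)
    exact ((measurable_snd.enorm.pow_const 2).inv.pow_const 2).mul (hκ2 n)
  set P : ℕ → Space d → ENNReal := fun n y => ∫⁻ x, ‖mollifier d n (x - y)‖ₑ * k n x with hP
  have hPm : ∀ n, Measurable (P n) := by
    intro n
    refine Measurable.lintegral_prod_left'
      (f := fun p : Space d × Space d => ‖mollifier d n (p.1 - p.2)‖ₑ * k n p.1) ?_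
    exact (hκ2 n).mul ((hkm n).comp measurable_fst)
  have hκ1 : ∀ n (y : Space d) (c : ENNReal), ∫⁻ x, ‖mollifier d n (x - y)‖ₑ * c = c := by
    intro n y c
    rw [lintegral_mul_const (f := fun x => ‖mollifier d n (x - y)‖ₑ) _
        ((hκ n).comp (measurable_id.sub_const y)),
      lintegral_sub_right_eq_self (fun x => ‖mollifier d n x‖ₑ), lintegral_enorm_mollifier, one_mul]
  have hPC : ∀ n y, P n y ≤ C := fun n y =>
    (lintegral_mono fun x => by gcongr; exact hbd n x).trans (hκ1 n y C).le
  have hPlim : ∀ (n : ℕ) (y : Space d), 4 * (1 / ((n : ℝ) + 1)) < ‖y‖ →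
      P n y ≤ ENNReal.ofReal (((‖y‖ + 2 * (1 / ((n : ℝ) + 1))) / (‖y‖ - 4 * (1 / ((n : ℝ) + 1)))) ^ 4) := by
    intro n y hy
    set ε : ℝ := 1 / ((n : ℝ) + 1)
    have hε0 : 0 < ε := by positivity
    refine (lintegral_mono fun x => ?_).trans (hκ1 n y _).le
    by_cases hxy : 2 * ε ≤ ‖x - y‖
    · rw [mollifier_eq_zero hxy]; simp
    gcongr
    rw [not_le] at hxy
    have hm : Measurable fun t : Space d => ‖mollifier d n (x - t)‖ₑ :=
      ((isTest_mollifier d n).reflect x).1.continuous.enorm.measurable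
    rw [hk]
    simp only
    rw [← lintegral_const_mul (f := fun t => (‖t‖ₑ ^ 2)⁻¹ ^ 2 * ‖mollifier d n (x - t)‖ₑ) _
      (((measurable_enorm.pow_const 2).inv.pow_const 2).mul hm)]
    calc _ ≤ ∫⁻ t, ENNReal.ofReal (((‖y‖ + 2 * ε) / (‖y‖ - 4 * ε)) ^ 4) * ‖mollifier d n (x - t)‖ₑ := by
          refine lintegral_mono_ae ?_
          filter_upwards [ae_ne_zero] with t ht
          rw [← mul_assoc, enorm_pow_four_mul ht]
          by_cases hxt : 2 * ε ≤ ‖x - t‖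
          · rw [mollifier_eq_zero hxt]; simp
          rw [not_le] at hxt
          gcongr
          · linarith [norm_sub_norm_le x y]
          · linarith [norm_sub_norm_le x t, norm_sub_norm_le y x, norm_sub_rev y x]
      _ = _ := by
          rw [lintegral_const_mul _ hm, lintegral_sub_left_eq_self (fun t => ‖mollifier d n t‖ₑ),
            lintegral_enorm_mollifier, mul_one]
  have hh : AEMeasurable (fun y : Space d => (‖f y‖ₑ * ‖y‖ₑ ^ 2) ^ 2) volume :=
    (hf.enorm.mul (measurable_enorm.pow_const 2).aemeasurable).pow_const 2
  -- the maximum with `1` makes upper bounds for `P` suffice for convergence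
  refine ⟨fun n => ∫⁻ y, (‖f y‖ₑ * ‖y‖ₑ ^ 2) ^ 2 * max (P n y) 1, ?_, fun n => ?_⟩
  · refine tendsto_lintegral_of_dominated_convergence'
      (fun y => (‖f y‖ₑ * ‖y‖ₑ ^ 2) ^ 2 * max C 1) ?_ ?_ ?_ ?_
    · exact fun n => hh.mul ((hPm n).max measurable_const).aemeasurable
    · exact fun n => Eventually.of_forall fun y =>
        mul_le_mul' le_rfl (max_le_max_right 1 (hPC n y))
    · rw [lintegral_mul_const'' _ hh]
      exact ENNReal.mul_ne_top hfin (by simp [hC])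
    · filter_upwards [ae_ne_zero] with y hy
      have hy0 : 0 < ‖y‖ := norm_pos_iff.2 hy
      have hε := tendsto_one_div_add_atTop_nhds_zero_nat (𝕜 := ℝ)
      have h1 : Tendsto (fun n : ℕ => ENNReal.ofReal
          (((‖y‖ + 2 * (1 / ((n : ℝ) + 1))) / (‖y‖ - 4 * (1 / ((n : ℝ) + 1)))) ^ 4)) atTop (𝓝 1) := by
        have := ENNReal.tendsto_ofReal ((((tendsto_const_nhds (x := ‖y‖)).add (hε.const_mul 2)).div
          ((tendsto_const_nhds (x := ‖y‖)).sub (hε.const_mul 4)) (by simpa using hy0.ne')).pow 4)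
        simpa [div_self hy0.ne'] using this
      have h2 : Tendsto (fun n => max (P n y) 1) atTop (𝓝 1) := by
        have h3 := h1.max (tendsto_const_nhds (x := (1 : ENNReal)))
        rw [max_self] at h3
        refine tendsto_of_tendsto_of_tendsto_of_le_of_le' tendsto_const_nhds h3
          (Eventually.of_forall fun n => le_max_right _ _) ?_
        have h4 := (hε.const_mul 4).eventually_lt_const (u := ‖y‖) (by simpa using hy)
        filter_upwards [h4] with n hn
        exact max_le_max_right _ (hPlim n y hn)
      have h5 := ENNReal.Tendsto.const_mul (a := (‖f y‖ₑ * ‖y‖ₑ ^ 2) ^ 2) h2 (by simp)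
      simpa using h5
  · have h := lintegral_kernel_sq_le (κ := fun y => ‖mollifier d n y‖ₑ) (F := fun y => ‖f y‖ₑ)
      (S := fun y : Space d => ‖y‖ₑ ^ 2) (m := fun x => ‖x‖ₑ ^ 4) (hκ n) hf.enorm
      (measurable_enorm.pow_const 2) ?_ (measurable_enorm.pow_const 4)
    · calc _ ≤ ∫⁻ x : Space d, ‖x‖ₑ ^ 4 * (∫⁻ y, ‖f y‖ₑ * ‖mollifier d n (x - y)‖ₑ) ^ 2 := by
            gcongr with x
            exact enorm_conv_le _ f x
        _ ≤ _ := h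
        _ ≤ _ := lintegral_mono fun y => mul_le_mul' le_rfl (le_max_left _ _)
    · filter_upwards [ae_ne_zero] with y hy
      exact ⟨by simpa using hy, by finiteness⟩

/-! ### Weak derivatives -/

section weak

variable {v w w' u : Space d → ℂ} {i j : Fin d}

theorem HasWeakPartial.ae_unique (h : HasWeakPartial i v w) (h' : HasWeakPartial i v w') :
    w =ᵐ[volume] w' := by
  have h0 : ∀ᵐ x, w x - w' x = 0 := by
    refine ae_eq_zero_of_integral_contDiff_smul_eq_zero (h.2.1.sub h'.2.1) fun g hg hgc => ?_
    have hφ : IsTest fun x => (g x : ℂ) :=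
      ⟨Complex.ofRealCLM.contDiff.comp hg, hgc.comp_left Complex.ofReal_zero⟩
    have h1 := (h.2.2 _ hφ).symm.trans (h'.2.2 _ hφ)
    rw [neg_inj] at h1
    rw [← sub_self (∫ x, w x * (g x : ℂ))]
    nth_rw 2 [h1]
    rw [← integral_sub (integrable_mul_test h.2.1 hφ) (integrable_mul_test h'.2.1 hφ)]
    refine integral_congr_ae (Eventually.of_forall fun x => ?_)
    simp only [Complex.real_smul]
    ring
  filter_upwards [h0] with x hx using sub_eq_zero.1 hx

theorem HasWeakPartial.weakPartial (h : HasWeakPartial i v w) :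
    HasWeakPartial i v (weakPartial i v) := by
  have hex : ∃ w, HasWeakPartial i v w := ⟨w, h⟩
  rw [Bilaplacian.weakPartial, dif_pos hex]
  exact hex.choose_spec

theorem HasWeakPartial.weakPartial_ae_eq (h : HasWeakPartial i v w) :
    Bilaplacian.weakPartial i v =ᵐ[volume] w := h.weakPartial.ae_unique h

theorem MemH1.hasWeakPartial (h : MemH1 v) (i : Fin d) : HasWeakPartial i v (weakPartial i v) := by
  obtain ⟨w, hw, -⟩ := h.2 i
  exact hw.weakPartial

theorem MemH1.memLp_weakPartial (h : MemH1 v) (i : Fin d) : MemLp (weakPartial i v) 2 volume := by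
  obtain ⟨w, hw, hw2⟩ := h.2 i
  exact (memLp_congr_ae hw.weakPartial_ae_eq).2 hw2

theorem MemH2.memLp_weakLaplacian (h : MemH2 u) : MemLp (weakLaplacian u) 2 volume :=
  memLp_finsetSum _ fun j _ => (h.2 j).memLp_weakPartial j

/-! ### Mollified Sobolev functions -/

variable {η : Space d → ℂ}

theorem MemH2.pd_conv (hu : MemH2 u) (h : IsTest η) (j : Fin d) :
    pd j (conv η u) = conv η (weakPartial j u) := (hu.1.hasWeakPartial j).pd_conv h

theorem MemH2.pd_pd_conv (hu : MemH2 u) (h : IsTest η) (i j : Fin d) :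
    pd i (pd j (conv η u)) = conv η (weakPartial i (weakPartial j u)) := by
  rw [hu.pd_conv h, ((hu.2 j).hasWeakPartial i).pd_conv h]

theorem MemH2.lap_conv (hu : MemH2 u) (h : IsTest η) :
    lap (conv η u) = conv η (weakLaplacian u) := by
  funext x
  simp_rw [lap, hu.pd_pd_conv h, conv, weakLaplacian, Finset.sum_mul]
  rw [integral_finsetSum]
  exact fun i _ => integrable_mul_test
    (((hu.2 i).memLp_weakPartial i).locallyIntegrable (by norm_num)) (h.reflect x)

theorem MemH2.isRegular_conv (hu : MemH2 u) (h : IsTest η) : IsRegular (conv η u) where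
  smooth := contDiff_conv h (hu.1.1.locallyIntegrable (by norm_num))
  sq := integrable_sq_conv h hu.1.1
  sq_pd i := by rw [hu.pd_conv h]; exact integrable_sq_conv h (hu.1.memLp_weakPartial i)
  sq_pd_pd i j := by
    rw [hu.pd_pd_conv h]; exact integrable_sq_conv h ((hu.2 j).memLp_weakPartial i)
  sq_pd_lap i := by
    rw [hu.lap_conv h, Bilaplacian.pd_conv h
      (hu.memLp_weakLaplacian.locallyIntegrable (by norm_num))]
    exact integrable_sq_conv (h.pd i) hu.memLp_weakLaplacian

/-- A mollified weak solution solves the equation classically. -/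
theorem IsWeakSolution.lap_lap_conv {V f : Space d → ℂ} {z : ℂ} (hs : IsWeakSolution V z f u)
    (hu : MemH2 u) (hf : LocallyIntegrable f volume)
    (hVu : LocallyIntegrable (fun x => V x * u x) volume) (h : IsTest η) (x : Space d) :
    lap (lap (conv η u)) x = z * conv η u x + conv η (fun t => f t - V t * u t) x := by
  have h1 := hs _ (h.reflect x)
  simp_rw [laplacian_reflect h] at h1
  rw [hu.lap_conv h, Bilaplacian.lap_conv h
    (hu.memLp_weakLaplacian.locallyIntegrable (by norm_num))]
  simp_rw [conv, sub_mul]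
  rw [integral_sub (integrable_mul_test hf (h.reflect x)) (integrable_mul_test hVu (h.reflect x)),
    ← add_sub_assoc, ← h1, add_sub_cancel_right]

/-! ### The gauge transform of weakly differentiable functions -/

/-- The exponent of the gauge is regularised to `√(|x|² + δ²)` and `δ → 0`. -/
theorem HasWeakPartial.phase [NeZero d] (h : HasWeakPartial i v w) (θ : ℝ) :
    HasWeakPartial i (phase θ v) (fun x => Complex.exp (-(θ * Complex.I) * (‖x‖ : ℂ))
      * (w x - θ * Complex.I * (x i / ‖x‖) * v x)) := by
  have hbd : ∀ (v' : Space d → ℂ) (b : Space d → ℂ), LocallyIntegrable v' volume →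
      AEStronglyMeasurable b volume → (∀ x, ‖b x‖ ≤ ‖v' x‖) → LocallyIntegrable b volume :=
    fun v' b h1 h2 h3 => h1.mono h2 (Eventually.of_forall h3)
  set E : Space d → ℂ := fun x => Complex.exp (-(θ * Complex.I) * (‖x‖ : ℂ)) with hE
  have hEc : Continuous E := by fun_prop
  have hEn : ∀ x, ‖E x‖ = 1 := fun x => norm_exp_phase θ ‖x‖
  have hrc : ContinuousOn (fun x : Space d => (x i / ‖x‖ : ℂ)) {0}ᶜ :=
    ContinuousOn.div (by fun_prop) (by fun_prop) (fun x hx => by simpa using hx)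
  have hrm : AEStronglyMeasurable (fun x : Space d => (x i / ‖x‖ : ℂ)) volume :=
    aestronglyMeasurable_of_continuousOn_ne_zero hrc
  have hxi : ∀ x : Space d, |x i| ≤ ‖x‖ := fun x => PiLp.norm_apply_le x i
  have hr1 : ∀ x : Space d, ‖(x i / ‖x‖ : ℂ)‖ ≤ 1 := by
    intro x
    rw [norm_div, Complex.norm_real, Complex.norm_real, norm_norm]
    exact div_le_one_of_le₀ (hxi x) (norm_nonneg _)
  have hrv : LocallyIntegrable (fun x => (x i / ‖x‖ : ℂ) * v x) volume :=
    hbd v _ h.1 (hrm.mul h.1.aestronglyMeasurable) fun x => by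
      rw [norm_mul]; exact mul_le_of_le_one_left (norm_nonneg _) (hr1 x)
  have hw1 : LocallyIntegrable (fun x => w x - θ * Complex.I * (x i / ‖x‖) * v x) volume := by
    refine (h.2.1.sub (hrv.smul (θ * Complex.I))).congr ?_
    filter_upwards with x
    simp [mul_assoc]
  refine ⟨hbd v _ h.1 (hEc.aestronglyMeasurable.mul h.1.aestronglyMeasurable) fun x => ?_,
    hbd _ _ hw1 (hEc.aestronglyMeasurable.mul hw1.aestronglyMeasurable) fun x => ?_, fun φ hφ => ?_⟩
  · exact (norm_phase θ v x).le
  · rw [norm_mul, hEn, one_mul]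
  let s : ℕ → Space d → ℝ := fun n x => √(‖x‖ ^ 2 + (1 / ((n : ℝ) + 1)) ^ 2)
  have hpos : ∀ (n : ℕ) (x : Space d), 0 < ‖x‖ ^ 2 + (1 / ((n : ℝ) + 1)) ^ 2 := fun n x => by
    positivity
  have hs0 : ∀ n x, 0 < s n x := fun n x => Real.sqrt_pos.2 (hpos n x)
  have hsd : ∀ n, ContDiff ℝ (⊤ : ℕ∞) (s n) := fun n =>
    ((contDiff_norm_sq ℝ).add contDiff_const).sqrt fun x => (hpos n x).ne'
  have hxs : ∀ n x, ‖x‖ ≤ s n x := fun n x =>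
    Real.le_sqrt_of_sq_le (by linarith [sq_nonneg (1 / ((n : ℝ) + 1))])
  have hslim : ∀ x, Tendsto (fun n => s n x) atTop (𝓝 ‖x‖) := by
    intro x
    have h1 := ((tendsto_one_div_add_atTop_nhds_zero_nat (𝕜 := ℝ)).pow 2).const_add (‖x‖ ^ 2)
    have h2 := h1.sqrt
    simpa [s, Real.sqrt_sq (norm_nonneg x)] using h2
  let e : ℕ → Space d → ℂ := fun n x => Complex.exp (-(θ * Complex.I) * (s n x : ℂ))
  have hed : ∀ n, ContDiff ℝ (⊤ : ℕ∞) (e n) := fun n =>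
    (contDiff_const.mul (Complex.ofRealCLM.contDiff.comp (hsd n))).cexp
  have hen : ∀ n x, ‖e n x‖ = 1 := fun n x => norm_exp_phase θ (s n x)
  have helim : ∀ x, Tendsto (fun n => e n x) atTop (𝓝 (E x)) := fun x =>
    (Complex.continuous_exp.tendsto _).comp
      (((Complex.continuous_ofReal.tendsto _).comp (hslim x)).const_mul _)
  have hspd : ∀ n x, HasPd i (fun y => (s n y : ℂ)) (x i / s n x) x := by
    intro n x
    have h1 : HasFDerivAt (fun y => ((s n y : ℝ) : ℂ))
        (Complex.ofRealCLM.comp (fderiv ℝ (s n) x)) x :=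
      Complex.ofRealCLM.hasFDerivAt.comp x (((hsd n).differentiable (by simp)) x).hasFDerivAt
    refine (HasFDerivAt.hasPd i h1).congr_val ?_
    have h2 : HasFDerivAt (s n) ((1 / (2 * s n x)) • (2 • (innerSL ℝ x))) x :=
      (((hasStrictFDerivAt_norm_sq x).hasFDerivAt).add_const _).sqrt (hpos n x).ne'
    rw [h2.fderiv]
    simp [EuclideanSpace.inner_single_right]
    field_simp
  have hepd : ∀ n x, HasPd i (e n) (e n x * (-(θ * Complex.I) * (x i / s n x))) x := fun n x =>
    HasPd.cexp ((hspd n x).const_mul _)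
  have htest : ∀ n, IsTest fun x => e n x * φ x := fun n =>
    ⟨(hed n).mul hφ.1, hφ.2.mul_left⟩
  -- the weak formulation tested with the regularised gauge times `φ`
  have hn : ∀ n, ∫ x, v x * (e n x * pd i φ x - e n x * (θ * Complex.I * (x i / s n x)) * φ x)
      = -∫ x, w x * (e n x * φ x) := by
    intro n
    rw [← h.2.2 _ (htest n)]
    refine integral_congr_ae (Eventually.of_forall fun x => ?_)
    have h1 := ((hepd n x).mul (DifferentiableAt.hasPd i (hφ.1.differentiable (by simp) x))).2
    have h2 : fderiv ℝ (fun x => e n x * φ x) x (EuclideanSpace.single i 1) = _ := h1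
    simp only
    rw [h2]
    ring
  have hvm := h.1.aestronglyMeasurable
  have hwm := h.2.1.aestronglyMeasurable
  have hφc := hφ.1.continuous
  have hpφc := (hφ.pd i).1.continuous
  have hscoord : ∀ n, Continuous fun x : Space d => (x i / s n x : ℂ) := fun n =>
    Continuous.div (by fun_prop) (Complex.continuous_ofReal.comp (hsd n).continuous)
      (fun x => by exact_mod_cast (hs0 n x).ne')
  have hl1 : Tendsto (fun n => ∫ x, w x * (e n x * φ x)) atTop (𝓝 (∫ x, w x * (E x * φ x))) := by
    refine tendsto_integral_of_dominated_convergence (fun x => ‖w x * φ x‖) (fun n => ?_)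
      (integrable_mul_test h.2.1 hφ).norm (fun n => Eventually.of_forall fun x => ?_)
      (Eventually.of_forall fun x => ?_)
    · exact hwm.mul ((hed n).continuous.mul hφc).aestronglyMeasurable
    · rw [norm_mul, norm_mul, norm_mul, hen, one_mul]
    · exact ((helim x).mul_const _).const_mul _
  have hl2 : Tendsto
      (fun n => ∫ x, v x * (e n x * pd i φ x - e n x * (θ * Complex.I * (x i / s n x)) * φ x)) atTop
      (𝓝 (∫ x, v x * (E x * pd i φ x - E x * (θ * Complex.I * (x i / ‖x‖)) * φ x))) := by
    refine tendsto_integral_of_dominated_convergence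
      (fun x => ‖v x * pd i φ x‖ + |θ| * ‖v x * φ x‖) (fun n => ?_)
      ((integrable_mul_test h.1 (hφ.pd i)).norm.add
        ((integrable_mul_test h.1 hφ).norm.const_mul _))
      (fun n => Eventually.of_forall fun x => ?_) ?_
    · refine hvm.mul (Continuous.aestronglyMeasurable ?_)
      exact ((hed n).continuous.mul hpφc).sub
        (((hed n).continuous.mul (continuous_const.mul (hscoord n))).mul hφc)
    · have h1 : ‖(x i / s n x : ℂ)‖ ≤ 1 := by
        rw [norm_div, Complex.norm_real, Complex.norm_real, Real.norm_of_nonneg (hs0 n x).le]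
        exact div_le_one_of_le₀ ((hxi x).trans (hxs n x)) (hs0 n x).le
      calc _ ≤ ‖v x‖ * (‖e n x * pd i φ x‖ + ‖e n x * (θ * Complex.I * (x i / s n x)) * φ x‖) := by
            rw [norm_mul]; gcongr; exact norm_sub_le _ _
        _ = ‖v x‖ * (‖pd i φ x‖ + |θ| * ‖(x i / s n x : ℂ)‖ * ‖φ x‖) := by
            simp only [norm_mul, hen, one_mul, Complex.norm_I, mul_one, Complex.norm_real,
              Real.norm_eq_abs]
        _ ≤ ‖v x‖ * (‖pd i φ x‖ + |θ| * 1 * ‖φ x‖) := by gcongr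
        _ = _ := by rw [norm_mul, norm_mul]; ring
    · filter_upwards [ae_ne_zero] with x hx
      have h1 : Tendsto (fun n => (x i / s n x : ℂ)) atTop (𝓝 (x i / ‖x‖)) :=
        tendsto_const_nhds.div ((Complex.continuous_ofReal.tendsto _).comp (hslim x))
          (by simpa using hx)
      exact (((helim x).mul_const _).sub
        (((helim x).mul (h1.const_mul _)).mul_const _)).const_mul _
  have hlim := tendsto_nhds_unique hl2 (hl1.neg.congr fun n => (hn n).symm)
  have i1 : Integrable (fun x => v x * (E x * pd i φ x)) volume := by
    refine (integrable_mul_test h.1 (hφ.pd i)).norm.mono'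
      (hvm.mul (hEc.mul hpφc).aestronglyMeasurable) (Eventually.of_forall fun x => ?_)
    rw [norm_mul, norm_mul, hEn, one_mul, norm_mul]
  have i2 : Integrable (fun x => w x * (E x * φ x)) volume := by
    refine (integrable_mul_test h.2.1 hφ).norm.mono'
      (hwm.mul (hEc.mul hφc).aestronglyMeasurable) (Eventually.of_forall fun x => ?_)
    rw [norm_mul, norm_mul, hEn, one_mul, norm_mul]
  have i3 : Integrable (fun x => v x * (E x * (θ * Complex.I * (x i / ‖x‖)) * φ x)) volume := by
    have := (((integrable_mul_test hrv hφ).norm.const_mul |θ|)).mono'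
      (f := fun x => v x * (E x * (θ * Complex.I * (x i / ‖x‖)) * φ x))
      (hvm.mul ((hEc.aestronglyMeasurable.mul (hrm.const_mul _)).mul hφc.aestronglyMeasurable))
      (Eventually.of_forall fun x => le_of_eq ?_)
    · exact this
    · simp only [norm_mul, hEn, one_mul, Complex.norm_I, mul_one, Complex.norm_real,
        Real.norm_eq_abs]
      ring
  have e1 : ∫ x, Bilaplacian.phase θ v x * pd i φ x = ∫ x, v x * (E x * pd i φ x) := by
    refine integral_congr_ae (Eventually.of_forall fun x => ?_)
    simp only [Bilaplacian.phase, hE]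
    ring
  have e2 : ∫ x, E x * (w x - θ * Complex.I * (x i / ‖x‖) * v x) * φ x
      = (∫ x, w x * (E x * φ x)) - ∫ x, v x * (E x * (θ * Complex.I * (x i / ‖x‖)) * φ x) := by
    rw [← integral_sub i2 i3]
    refine integral_congr_ae (Eventually.of_forall fun x => ?_)
    simp only
    ring
  simp_rw [mul_sub] at hlim
  rw [integral_sub i1 i3] at hlim
  refine e1.trans ?_
  rw [e2, neg_sub]
  linear_combination hlim

end weak

/-! ### Passage to the limit -/

section limit

/-- Fatou's lemma along an almost everywhere convergent sequence. -/
theorem lintegral_ofReal_le_liminf {h : Space d → ℝ} {H : ℕ → Space d → ℝ}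
    (hm : ∀ n, AEStronglyMeasurable (H n) volume)
    (hlim : ∀ᵐ x, Tendsto (fun n => H n x) atTop (𝓝 (h x))) :
    ∫⁻ x, ENNReal.ofReal (h x) ≤ liminf (fun n => ∫⁻ x, ENNReal.ofReal (H n x)) atTop := by
  refine le_trans (le_of_eq (lintegral_congr_ae ?_))
    (lintegral_liminf_le' fun n => (hm n).aemeasurable.ennreal_ofReal)
  filter_upwards [hlim] with x hx
  exact (ENNReal.tendsto_ofReal hx).liminf_eq.symm

/-- Fatou's lemma with a convergent upper bound. -/
theorem integrable_and_integral_le_of_tendsto {h : Space d → ℝ} {H : ℕ → Space d → ℝ}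
    (hm : ∀ n, AEStronglyMeasurable (H n) volume) (hmh : AEStronglyMeasurable h volume)
    (h0 : 0 ≤ h) (H0 : ∀ n, 0 ≤ H n)
    (hlim : ∀ᵐ x, Tendsto (fun n => H n x) atTop (𝓝 (h x)))
    {b : ℕ → ℝ} {B : ℝ} (hb : Tendsto b atTop (𝓝 B))
    (hbd : ∀ᶠ n in atTop, Integrable (H n) volume ∧ ∫ x, H n x ≤ b n) :
    Integrable h volume ∧ ∫ x, h x ≤ B := by
  have hB : 0 ≤ B := ge_of_tendsto hb (hbd.mono fun n hn => (integral_nonneg (H0 n)).trans hn.2)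
  have h1 : ∫⁻ x, ENNReal.ofReal (h x) ≤ ENNReal.ofReal B := by
    refine (lintegral_ofReal_le_liminf hm hlim).trans ?_
    rw [← (ENNReal.tendsto_ofReal hb).liminf_eq]
    refine liminf_le_liminf (hbd.mono fun n hn => ?_)
    rw [← ofReal_integral_eq_lintegral_ofReal hn.1 (Eventually.of_forall (H0 n))]
    exact ENNReal.ofReal_le_ofReal hn.2
  refine ⟨(lintegral_ofReal_ne_top_iff_integrable hmh (Eventually.of_forall h0)).1
    (ne_top_of_le_ne_top ENNReal.ofReal_ne_top h1), ?_⟩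
  rw [integral_eq_lintegral_of_nonneg_ae (Eventually.of_forall h0) hmh]
  exact ENNReal.toReal_le_of_le_ofReal hB h1

/-- Fatou's lemma as a lower bound for the tail. -/
theorem eventually_lt_sqrt_integral {h : Space d → ℝ} {H : ℕ → Space d → ℝ}
    (hm : ∀ n, AEStronglyMeasurable (H n) volume) (hi : Integrable h volume)
    (h0 : 0 ≤ h) (H0 : ∀ n, 0 ≤ H n)
    (hlim : ∀ᵐ x, Tendsto (fun n => H n x) atTop (𝓝 (h x)))
    (hint : ∀ᶠ n in atTop, Integrable (H n) volume) {c : ℝ} (hc : c < √(∫ x, h x)) :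
    ∀ᶠ n in atTop, c < √(∫ x, H n x) := by
  rcases lt_or_ge c 0 with hc0 | hc0
  · exact Eventually.of_forall fun n => hc0.trans_le (Real.sqrt_nonneg _)
  have h1 : ENNReal.ofReal (c ^ 2) < ∫⁻ x, ENNReal.ofReal (h x) := by
    rw [← ofReal_integral_eq_lintegral_ofReal hi (Eventually.of_forall h0)]
    have := (Real.lt_sqrt hc0).1 hc
    exact (ENNReal.ofReal_lt_ofReal_iff ((sq_nonneg c).trans_lt this)).2 this
  have h2 := eventually_lt_of_lt_liminf (h1.trans_le (lintegral_ofReal_le_liminf hm hlim))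
  filter_upwards [h2, hint] with n hn hn2
  rw [← ofReal_integral_eq_lintegral_ofReal hn2 (Eventually.of_forall (H0 n))] at hn
  exact (Real.lt_sqrt hc0).2 (ENNReal.ofReal_lt_ofReal_iff'.1 hn).1

end limit

section norms

theorem normL2_eq {F : Type*} [NormedAddCommGroup F] {g : Space d → F} (hg : MemLp g 2 volume) :
    normL2 g = ENNReal.ofReal √(∫ x, ‖g x‖ ^ 2) := by
  rw [normL2, hg.eLpNorm_eq_integral_rpow_norm (by simp) (by simp)]
  simp [Real.sqrt_eq_rpow]

theorem lintegral_enorm_sq_eq {f : Space d → ℂ} (hf : MemLp f 2 volume) :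
    ∫⁻ x, ‖f x‖ₑ ^ 2 = ENNReal.ofReal (∫ x, ‖f x‖ ^ 2) := by
  rw [ofReal_integral_eq_lintegral_ofReal ((integrable_sq_iff hf.1).2 hf)
    (Eventually.of_forall fun x => by positivity)]
  refine lintegral_congr fun x => ?_
  rw [ENNReal.ofReal_pow (norm_nonneg _), ofReal_norm]

theorem norm_rsq (g : Space d → ℂ) (x : Space d) : ‖rsq g x‖ = ‖x‖ ^ 2 * ‖g x‖ := by
  rw [rsq, norm_mul, Complex.norm_of_nonneg (by positivity)]

theorem enorm_rsq (g : Space d → ℂ) (x : Space d) : ‖rsq g x‖ₑ = ‖g x‖ₑ * ‖x‖ₑ ^ 2 := by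
  rw [← ofReal_norm, norm_rsq, ENNReal.ofReal_mul (by positivity),
    ENNReal.ofReal_pow (norm_nonneg _), ofReal_norm, ofReal_norm, mul_comm]

theorem aestronglyMeasurable_of_rsq [NeZero d] {g : Space d → ℂ}
    (h : AEStronglyMeasurable (rsq g) volume) : AEStronglyMeasurable g volume := by
  have h1 : AEStronglyMeasurable (fun x : Space d => ((‖x‖ ^ (-2 : ℤ) : ℝ) : ℂ)) volume :=
    Complex.continuous_ofReal.comp_aestronglyMeasurable
      (aestronglyMeasurable_of_continuousOn_ne_zero (continuousOn_norm_zpow (-2)))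
  refine (h1.mul h).congr ?_
  filter_upwards [ae_ne_zero] with x hx
  have : (‖x‖ : ℂ) ≠ 0 := by simpa using hx
  simp only [rsq, Pi.mul_apply, zpow_neg]
  push_cast
  rw [show (‖x‖ : ℂ) ^ (2 : ℤ) = (‖x‖ : ℂ) ^ 2 from rfl]
  field_simp

/-- Square integrability with the weight `|x|²` gives local integrability because `|x|⁻⁴` is
locally integrable for `d ≥ 5`. -/
theorem locallyIntegrable_of_rsq [NeZero d] (hd : 5 ≤ d) {g : Space d → ℂ}
    (h : MemLp (rsq g) 2 volume) : LocallyIntegrable g volume := by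
  have h1 : LocallyIntegrable (fun x : Space d => ‖x‖ ^ (-4 : ℤ)) volume :=
    locallyIntegrable_norm_zpow (by omega)
  have h2 := ((integrable_sq_iff h.1).2 h).locallyIntegrable
  refine LocallyIntegrable.mono (h1.add h2) (aestronglyMeasurable_of_rsq h.1) ?_
  filter_upwards [ae_ne_zero] with x hx
  have hx0 : 0 < ‖x‖ := norm_pos_iff.2 hx
  rw [Pi.add_apply, Real.norm_of_nonneg (by positivity), norm_rsq]
  have e1 : ‖x‖ ^ (-4 : ℤ) = (‖x‖ ^ 2)⁻¹ ^ 2 := by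
    rw [zpow_neg, inv_pow, ← pow_mul]; rfl
  rw [e1]
  have e2 : ‖g x‖ = (‖x‖ ^ 2)⁻¹ * (‖x‖ ^ 2 * ‖g x‖) := by
    field_simp
  nlinarith [sq_nonneg ((‖x‖ ^ 2)⁻¹ - ‖x‖ ^ 2 * ‖g x‖), sq_nonneg ((‖x‖ ^ 2)⁻¹),
    sq_nonneg (‖x‖ ^ 2 * ‖g x‖)]

theorem norm_weakGrad_sq (v : Space d → ℂ) (x : Space d) :
    ‖weakGrad v x‖ ^ 2 = ∑ i, ‖weakPartial i v x‖ ^ 2 :=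
  EuclideanSpace.norm_sq_eq _

end norms

section approximation

variable {u : Space d → ℂ}

theorem integral_sq_conv_mollifier_le {f : Space d → ℂ} (hf : MemLp f 2 volume) (n : ℕ) :
    ∫ x, ‖conv (mollifier d n) f x‖ ^ 2 ≤ ∫ x, ‖f x‖ ^ 2 := by
  have hi := integrable_sq_conv (isTest_mollifier d n) hf
  have hc := (contDiff_conv (isTest_mollifier d n)
    (hf.locallyIntegrable (by norm_num))).continuous.aestronglyMeasurable (μ := volume)
  have h := lintegral_conv_mollifier_sq_le hf.1 n
  rw [lintegral_enorm_sq_eq hf, lintegral_enorm_sq_eq ((integrable_sq_iff hc).1 hi)] at h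
  exact (ENNReal.ofReal_le_ofReal_iff (integral_nonneg fun x => by positivity)).1 h

/-- Hardy's inequality for the gradient. -/
theorem IsRegular.hardy_grad [NeZero d] (hd : 5 ≤ d) (hu : IsRegular u) :
    Integrable (fun x => ‖x‖ ^ (-2 : ℤ) * gradSq u x) volume ∧
    ((d - 2) / 2 : ℝ) ^ 2 * ∫ x, ‖x‖ ^ (-2 : ℤ) * gradSq u x
      ≤ ∑ j, ∑ i, ∫ x, ‖pd i (pd j u) x‖ ^ 2 := by
  have hd5 : (5 : ℝ) ≤ d := by exact_mod_cast hd
  have hi : ∀ j, Integrable (fun x => ‖x‖ ^ (-2 : ℤ) * ‖pd j u x‖ ^ 2) volume := fun j =>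
    integrable_norm_zpow_mul_sq (by omega) (by norm_num)
      (ContDiff.pd_top j hu.smooth).continuous (hu.sq_pd j)
  have e : (fun x => ‖x‖ ^ (-2 : ℤ) * gradSq u x)
      = fun x => ∑ j, ‖x‖ ^ (-2 : ℤ) * ‖pd j u x‖ ^ 2 := by
    funext x; rw [gradSq, Finset.mul_sum]
  refine ⟨by rw [e]; exact integrable_finsetSum _ fun j _ => hi j, ?_⟩
  rw [e, integral_finsetSum _ fun j _ => hi j, Finset.mul_sum]
  refine Finset.sum_le_sum fun j _ => ?_
  have hg := integrable_gradSq (q := pd j u) fun i => hu.sq_pd_pd i j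
  have h := hardy (d := d) 0 (q := pd j u) (by push_cast; linarith)
    (ContDiff.of_top (n := 1) (ContDiff.pd_top j hu.smooth)).contDiffOn
    (by simpa using hi j) (by simpa using hg)
  simp only [zpow_zero, one_mul] at h
  rw [show (∫ x, gradSq (pd j u) x) = ∑ i, ∫ x, ‖pd i (pd j u) x‖ ^ 2 from
    integral_finsetSum _ fun i _ => hu.sq_pd_pd i j] at h
  simpa using h

theorem MemH2.ae_tendsto (hu : MemH2 u) : ∀ᵐ x, ∀ j,
    Tendsto (fun n => pd j (conv (mollifier d n) u) x) atTop (𝓝 (weakPartial j u x)) ∧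
    ∀ i, Tendsto (fun n => pd i (pd j (conv (mollifier d n) u)) x) atTop
      (𝓝 (weakPartial i (weakPartial j u) x)) := by
  have h1 : ∀ j, ∀ᵐ x, Tendsto (fun n => pd j (conv (mollifier d n) u) x) atTop
      (𝓝 (weakPartial j u x)) := by
    intro j
    simp_rw [hu.pd_conv (isTest_mollifier d _)]
    exact ae_tendsto_conv_mollifier ((hu.1.hasWeakPartial j).2.1)
  have h2 : ∀ j i, ∀ᵐ x, Tendsto (fun n => pd i (pd j (conv (mollifier d n) u)) x) atTop
      (𝓝 (weakPartial i (weakPartial j u) x)) := by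
    intro j i
    simp_rw [hu.pd_pd_conv (isTest_mollifier d _)]
    exact ae_tendsto_conv_mollifier (((hu.2 j).hasWeakPartial i).2.1)
  filter_upwards [ae_all_iff.2 h1, ae_all_iff.2 fun j => ae_all_iff.2 (h2 j)] with x hx1 hx2 j
  exact ⟨hx1 j, hx2 j⟩

theorem MemH2.ae_tendsto_grad (hu : MemH2 u) : ∀ᵐ x : Space d,
    Tendsto (fun n => ‖x‖ ^ (-2 : ℤ) * gradSq (conv (mollifier d n) u) x) atTop
      (𝓝 (‖weakGrad u x‖ ^ 2 / ‖x‖ ^ 2)) := by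
  filter_upwards [hu.ae_tendsto] with x hx
  rw [norm_weakGrad_sq, div_eq_mul_inv, mul_comm, show (‖x‖ ^ 2)⁻¹ = ‖x‖ ^ (-2 : ℤ) by
    rw [zpow_neg]; rfl]
  exact (tendsto_finsetSum _ fun i _ => ((hx i).1.norm.pow 2)).const_mul _

theorem MemH2.ae_tendsto_lap (hu : MemH2 u) : ∀ᵐ x : Space d,
    Tendsto (fun n => ‖lap (conv (mollifier d n) u) x‖ ^ 2) atTop
      (𝓝 (‖weakLaplacian u x‖ ^ 2)) := by
  filter_upwards [hu.ae_tendsto] with x hx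
  exact (tendsto_finsetSum _ fun i _ => (hx i).2 i).norm.pow 2

theorem MemH2.aestronglyMeasurable_grad (hu : MemH2 u) :
    AEStronglyMeasurable (fun x => ‖weakGrad u x‖ ^ 2 / ‖x‖ ^ 2) volume := by
  simp_rw [norm_weakGrad_sq, div_eq_mul_inv]
  refine AEStronglyMeasurable.mul ?_ (by fun_prop)
  exact Finset.aestronglyMeasurable_fun_sum _ fun i _ => (hu.1.memLp_weakPartial i).1.norm.pow 2

theorem aestronglyMeasurable_smooth_grad [NeZero d] (hu : ContDiff ℝ (⊤ : ℕ∞) u) :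
    AEStronglyMeasurable (fun x => ‖x‖ ^ (-2 : ℤ) * gradSq u x) volume := by
  refine aestronglyMeasurable_of_continuousOn_ne_zero ((continuousOn_norm_zpow (-2)).mul ?_)
  exact (continuous_finsetSum _ fun i _ =>
    ((ContDiff.pd_top i hu).continuous.norm.pow 2)).continuousOn

/-- Hardy's inequality for the gradient of an `H²` function, in qualitative form. It makes the
right-hand side of the smallness condition on the potential finite. -/
theorem MemH2.integrable_grad [NeZero d] (hd : 5 ≤ d) (hu : MemH2 u) :
    Integrable (fun x => ‖weakGrad u x‖ ^ 2 / ‖x‖ ^ 2) volume := by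
  have hd5 : (5 : ℝ) ≤ d := by exact_mod_cast hd
  have hr := fun n => hu.isRegular_conv (isTest_mollifier d n)
  refine (integrable_and_integral_le_of_tendsto
    (fun n => aestronglyMeasurable_smooth_grad (hr n).smooth) hu.aestronglyMeasurable_grad
    (fun x => by positivity) (fun n x => mul_nonneg (by positivity) (gradSq_nonneg _ _))
    hu.ae_tendsto_grad
    (tendsto_const_nhds (x := (∑ j, ∑ i, ∫ x, ‖weakPartial i (weakPartial j u) x‖ ^ 2)
      / ((d - 2) / 2 : ℝ) ^ 2))
    (Eventually.of_forall fun n => ⟨((hr n).hardy_grad hd).1, ?_⟩)).1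
  rw [le_div_iff₀ (pow_pos (by linarith) 2), mul_comm]
  refine ((hr n).hardy_grad hd).2.trans (Finset.sum_le_sum fun j _ => Finset.sum_le_sum fun i _ => ?_)
  rw [hu.pd_pd_conv (isTest_mollifier d n)]
  exact integral_sq_conv_mollifier_le ((hu.2 j).memLp_weakPartial i) n

/-- A weak solution of the perturbed equation is a limit of regular solutions of the free equation,
with the potential term moved to the right-hand side and controlled in `L²(|x|⁴ dx)`. -/
theorem IsWeakSolution.exists_approximation [NeZero d] (hd : 5 ≤ d) {V f : Space d → ℂ} {z : ℂ}
    {a : ℝ} (ha : 0 ≤ a) (hV : LocallyIntegrable V volume) (hVa : SmallPotential V a)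
    (hf : MemLp (rsq f) 2 volume) (hu : MemH2 u) (hs : IsWeakSolution V z f u) :
    ∃ (g : ℕ → Space d → ℂ) (b : ℕ → ℝ) (B : ℝ), Tendsto b atTop (𝓝 B) ∧
      B ≤ √(∫ x, ‖rsq f x‖ ^ 2) + a * √(∫ x, ‖weakGrad u x‖ ^ 2 / ‖x‖ ^ 2) ∧
      ∀ᶠ n in atTop, Continuous (g n) ∧
        (∀ x, lap (lap (conv (mollifier d n) u)) x = z * conv (mollifier d n) u x + g n x) ∧
        Integrable (fun x => ‖x‖ ^ 4 * ‖g n x‖ ^ 2) volume ∧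
        √(∫ x, ‖x‖ ^ 4 * ‖g n x‖ ^ 2) ≤ b n := by
  set w : Space d → ℂ := fun x => V x * u x with hw
  have hwm : AEStronglyMeasurable w volume := hV.aestronglyMeasurable.mul hu.1.1.1
  have hrm : Continuous fun x : Space d => ((‖x‖ ^ 2 : ℝ) : ℂ) := by fun_prop
  have hrwm : AEStronglyMeasurable (rsq w) volume := hrm.aestronglyMeasurable.mul hwm
  set G := ∫ x, ‖weakGrad u x‖ ^ 2 / ‖x‖ ^ 2 with hG
  have hG0 : 0 ≤ G := integral_nonneg fun x => by positivity
  have hsm : ∫⁻ x, ENNReal.ofReal (‖rsq w x‖ ^ 2) ≤ ENNReal.ofReal (a ^ 2 * G) := by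
    have h1 := hVa u hu
    rw [← ofReal_integral_eq_lintegral_ofReal (hu.integrable_grad hd)
      (Eventually.of_forall fun x => by positivity), ← ENNReal.ofReal_mul (sq_nonneg a)] at h1
    refine le_trans (le_of_eq (lintegral_congr fun x => ?_)) h1
    rw [norm_rsq, hw]
    simp only [norm_mul]
    congr 1
    ring
  have hwi : Integrable (fun x => ‖rsq w x‖ ^ 2) volume :=
    (lintegral_ofReal_ne_top_iff_integrable (hrwm.norm.pow 2)
      (Eventually.of_forall fun x => sq_nonneg _)).1
      (ne_top_of_le_ne_top ENNReal.ofReal_ne_top hsm)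
  have hw2 : MemLp (rsq w) 2 volume := (integrable_sq_iff hrwm).1 hwi
  have hwn : √(∫ x, ‖rsq w x‖ ^ 2) ≤ a * √G := by
    rw [← ofReal_integral_eq_lintegral_ofReal hwi (Eventually.of_forall fun x => by positivity),
      ENNReal.ofReal_le_ofReal_iff (by positivity)] at hsm
    rw [Real.sqrt_le_left (by positivity), mul_pow, Real.sq_sqrt hG0]
    exact hsm
  set g : Space d → ℂ := fun t => f t - V t * u t with hg
  have hrg : rsq g = rsq f - rsq w := by
    funext x; simp only [rsq, hg, hw, Pi.sub_apply]; ring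
  have hg2 : MemLp (rsq g) 2 volume := by rw [hrg]; exact hf.sub hw2
  have hgn : √(∫ x, ‖rsq g x‖ ^ 2) ≤ √(∫ x, ‖rsq f x‖ ^ 2) + a * √G := by
    have h1 : normL2 (rsq g) ≤ normL2 (rsq f) + normL2 (rsq w) := by
      rw [hrg]; exact eLpNorm_sub_le hf.1 hw2.1 (by norm_num)
    rw [normL2_eq hg2, normL2_eq hf, normL2_eq hw2, ← ENNReal.ofReal_add (Real.sqrt_nonneg _)
      (Real.sqrt_nonneg _), ENNReal.ofReal_le_ofReal_iff (by positivity)] at h1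
    linarith
  have hgeq : ∫⁻ y, (‖g y‖ₑ * ‖y‖ₑ ^ 2) ^ 2 = ENNReal.ofReal (∫ x, ‖rsq g x‖ ^ 2) := by
    rw [← lintegral_enorm_sq_eq hg2]
    simp_rw [enorm_rsq]
  have hgm := aestronglyMeasurable_of_rsq hg2.1
  obtain ⟨N, hN, hNle⟩ := exists_tendsto_weighted_conv hd hgm
    (by rw [hgeq]; exact ENNReal.ofReal_ne_top)
  rw [hgeq] at hN
  refine ⟨fun n => conv (mollifier d n) g, fun n => √(N n).toReal, √(∫ x, ‖rsq g x‖ ^ 2), ?_, hgn, ?_⟩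
  · have h1 := (ENNReal.tendsto_toReal ENNReal.ofReal_ne_top).comp hN
    rw [ENNReal.toReal_ofReal (integral_nonneg fun x => by positivity)] at h1
    exact h1.sqrt
  · filter_upwards [hN.eventually_lt_const ENNReal.ofReal_lt_top] with n hn
    have hgl := locallyIntegrable_of_rsq hd hg2
    have hc := (contDiff_conv (isTest_mollifier d n) hgl).continuous
    have hc2 : Continuous fun x => ‖x‖ ^ 4 * ‖conv (mollifier d n) g x‖ ^ 2 := by fun_prop
    have h0 : 0 ≤ᵐ[volume] fun x => ‖x‖ ^ 4 * ‖conv (mollifier d n) g x‖ ^ 2 :=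
      Eventually.of_forall fun x => by positivity
    have h1 : ∫⁻ x, ENNReal.ofReal (‖x‖ ^ 4 * ‖conv (mollifier d n) g x‖ ^ 2) ≤ N n := by
      refine le_trans (le_of_eq (lintegral_congr fun x => ?_)) (hNle n)
      rw [ENNReal.ofReal_mul (by positivity), ENNReal.ofReal_pow (norm_nonneg _),
        ENNReal.ofReal_pow (norm_nonneg _), ofReal_norm, ofReal_norm]
    have hi := (lintegral_ofReal_ne_top_iff_integrable hc2.aestronglyMeasurable h0).1
      (ne_top_of_le_ne_top hn.ne h1)
    refine ⟨hc, fun x => ?_, hi, Real.sqrt_le_sqrt ?_⟩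
    · exact hs.lap_lap_conv hu (locallyIntegrable_of_rsq hd hf) (locallyIntegrable_of_rsq hd hw2)
        (isTest_mollifier d n) x
    · rw [integral_eq_lintegral_of_nonneg_ae h0 hc2.aestronglyMeasurable]
      exact ENNReal.toReal_mono hn.ne h1

end approximation

/-! ### Constants -/

theorem sqrt_CH (hd : 5 ≤ d) : √(CH d) = ((d : ℝ) - 2) / 2 := by
  have hd5 : (5 : ℝ) ≤ d := by exact_mod_cast hd
  rw [CH, show ((d : ℝ) - 2) ^ 2 / 4 = (((d : ℝ) - 2) / 2) ^ 2 by ring,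
    Real.sqrt_sq (by linarith)]

theorem sqrt_CR (hd : 5 ≤ d) : √(CR d) = (d : ℝ) * (d - 4) / 4 := by
  have hd5 : (5 : ℝ) ≤ d := by exact_mod_cast hd
  rw [CR, show (d : ℝ) ^ 2 * (d - 4) ^ 2 / 16 = ((d : ℝ) * (d - 4) / 4) ^ 2 by ring,
    Real.sqrt_sq (div_nonneg (mul_nonneg (by linarith) (by linarith)) (by norm_num))]

theorem sqrt_CHR : √(CHR d) = (d : ℝ) / 2 := by
  rw [CHR, show (d : ℝ) ^ 2 / 4 = ((d : ℝ) / 2) ^ 2 by ring, Real.sqrt_sq (by positivity)]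

/-- The linear term of the smallness condition is all that is needed. -/
theorem SmallConstant.lt (hd : 5 ≤ d) {a : ℝ} (ha : 0 ≤ a) (h : SmallConstant d a) :
    8 * (d : ℝ) ^ 2 * (d - 3) * a < (d - 2) ^ 2 * (d - 4) := by
  have hd5 : (5 : ℝ) ≤ d := by exact_mod_cast hd
  have h2 : (0 : ℝ) < d - 2 := by linarith
  have h4 : (0 : ℝ) < d - 4 := by linarith
  rw [SmallConstant, sqrt_CH hd] at h
  have hpos : 0 ≤ 4 * (d : ℝ) * √(d : ℝ) / (((d : ℝ) - 4) * √(((d : ℝ) - 2) * ((d : ℝ) - 4)))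
      * (a ^ (3 / 2 : ℝ) / (((d : ℝ) - 2) / 2) ^ (3 / 2 : ℝ)) := by positivity
  have h1 : 4 * (d : ℝ) ^ 2 * ((d : ℝ) - 3) / (((d : ℝ) - 2) * ((d : ℝ) - 4))
      * (a / (((d : ℝ) - 2) / 2)) < 1 := by linarith
  rw [show 4 * (d : ℝ) ^ 2 * ((d : ℝ) - 3) / (((d : ℝ) - 2) * ((d : ℝ) - 4))
      * (a / (((d : ℝ) - 2) / 2))
      = 8 * (d : ℝ) ^ 2 * (d - 3) * a / ((d - 2) ^ 2 * (d - 4)) by field_simp; ring,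
    div_lt_one (by positivity)] at h1
  exact h1

theorem SmallConstant.lt_eighth (hd : 5 ≤ d) {a : ℝ} (ha : 0 ≤ a) (h : SmallConstant d a) :
    8 * a < d - 4 := by
  have hd5 : (5 : ℝ) ≤ d := by exact_mod_cast hd
  have h1 := h.lt hd ha
  have h2 : ((d : ℝ) - 2) ^ 2 ≤ (d : ℝ) ^ 2 * (d - 3) := by
    nlinarith [mul_nonneg (sq_nonneg (d : ℝ)) (show (0 : ℝ) ≤ d - 5 by linarith)]
  by_contra hn
  rw [not_lt] at hn
  have h3 : (0 : ℝ) < (d : ℝ) ^ 2 * (d - 3) := by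
    have : (0 : ℝ) < d - 3 := by linarith
    positivity
  nlinarith [mul_le_mul_of_nonneg_left hn h3.le, mul_le_mul_of_nonneg_right h2
    (show (0 : ℝ) ≤ d - 4 by linarith)]

/-- The absorption constant for `Re z ≥ 0` is less than one. -/
theorem SmallConstant.absorb (hd : 5 ≤ d) {a : ℝ} (ha : 0 ≤ a) (h : SmallConstant d a) :
    24 / (((d : ℝ) - 2) * (d - 4)) * a < 1 := by
  have hd5 : (5 : ℝ) ≤ d := by exact_mod_cast hd
  have h2 : (0 : ℝ) < d - 2 := by linarith
  have h4 : (0 : ℝ) < d - 4 := by linarith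
  have h1 := h.lt hd ha
  rw [div_mul_eq_mul_div, div_lt_one (by positivity)]
  have h3 : (d - 2 : ℝ) * (3 * (d - 2)) ≤ (d - 2 : ℝ) * ((d : ℝ) ^ 2 * (d - 3)) := by
    refine mul_le_mul_of_nonneg_left ?_ h2.le
    nlinarith [mul_nonneg (sq_nonneg (d : ℝ)) (show (0 : ℝ) ≤ d - 5 by linarith)]
  by_contra hn
  rw [not_lt] at hn
  have h5 : (0 : ℝ) < (d : ℝ) ^ 2 * (d - 3) := by
    have : (0 : ℝ) < d - 3 := by linarith
    positivity
  nlinarith [mul_le_mul_of_nonneg_left hn h5.le, mul_le_mul_of_nonneg_right h3 h4.le]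

theorem cConst_eq (hd : 5 ≤ d) (a : ℝ) :
    cConst d a = 1 / ((d : ℝ) * (d - 4) / 4 - 2 * a / d) := by
  have hd5 : (5 : ℝ) ≤ d := by exact_mod_cast hd
  have h0 : (0 : ℝ) < d := by linarith
  rw [cConst, sqrt_CR hd, sqrt_CHR, show (d : ℝ) * (d - 4) / 4 * (d / 2) - a
    = (d / 2) * ((d : ℝ) * (d - 4) / 4 - 2 * a / d) by field_simp]
  rw [← div_div, div_self (by positivity)]

theorem cConst_denom_pos (hd : 5 ≤ d) {a : ℝ} (ha : 0 ≤ a) (h : SmallConstant d a) :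
    0 < (d : ℝ) * (d - 4) / 4 - 2 * a / d := by
  have hd5 : (5 : ℝ) ≤ d := by exact_mod_cast hd
  have h1 := h.lt_eighth hd ha
  have h2 : 2 * a / d ≤ 2 * a := div_le_self (by positivity) (by linarith)
  nlinarith

/-- The sharp form of the estimate for `Re z ≤ 0`. With `D² ≤ Γ R` the ratio `Γ / D` is at least
`D / R`, while `G / D` is a concave function of `R / D ≤ 4 / (d (d - 4))` and so lies below a line
through its value `2 / d` at the right end point. -/
theorem rellich_algebra {n D R G Γ a : ℝ} (hn : 5 ≤ n) (hD : 0 ≤ D) (hR : 0 ≤ R) (hG : 0 ≤ G)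
    (hΓ : 0 ≤ Γ) (ha : 0 ≤ a) (ha1 : a ≤ (n - 4) / 8) (h1 : D ^ 2 ≤ Γ * R)
    (h2 : G ^ 2 + (n - 4) * R ^ 2 ≤ D * R) (h3 : (n - 4) / 2 * R ≤ G) :
    (n * (n - 4) / 4 - 2 * a / n) * D + a * G ≤ Γ := by
  set m := n - 4 with hm
  have hm1 : 1 ≤ m := by linarith
  set κ := n * m / 4 with hκ
  have hκ0 : 1 ≤ κ := by rw [hκ]; nlinarith
  rcases hR.eq_or_lt with hR0 | hR0
  · have hD0 : D = 0 := by
      rw [← hR0] at h1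
      nlinarith
    have hG0 : G = 0 := by
      rw [hD0, ← hR0] at h2
      nlinarith
    rw [hD0, hG0]
    simpa using hΓ
  have hκR : κ * R ≤ D := by
    have h4 : (m / 2 * R) ^ 2 ≤ G ^ 2 := pow_le_pow_left₀ (by positivity) h3 2
    have h5 : κ * R * R ≤ D * R := by
      rw [hκ]
      nlinarith
    exact le_of_mul_le_mul_right h5 hR0
  set s := D - κ * R with hs
  have hs0 : 0 ≤ s := by linarith
  have hDs : D = κ * R + s := by rw [hs]; ring
  have hn0 : 0 < n := by linarith
  -- the line through the end point `s = 0`; its slope works for every `n ≥ 5`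
  have hGle : G ≤ 2 / n * D + 3 / (4 * κ) * s := by
    have e : 2 / n * D + 3 / (4 * κ) * s = m / 2 * R + (2 / n + 3 / (4 * κ)) * s := by
      rw [hDs, hκ]
      have : m ≠ 0 := by linarith
      field_simp
      ring
    have hc : 1 / m ≤ 2 / n + 3 / (4 * κ) := by
      rw [hκ, div_add_div _ _ hn0.ne' (by positivity), div_le_div_iff₀ (by linarith) (by positivity)]
      have : n = m + 4 := by rw [hm]; ring
      nlinarith
    rw [e]
    refine le_of_sq_le_sq ?_ (by positivity)
    have hc2 : R * s ≤ m * (2 / n + 3 / (4 * κ)) * (R * s) := by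
      have : 1 ≤ m * (2 / n + 3 / (4 * κ)) := by
        rw [div_le_iff₀ (by linarith)] at hc
        linarith
      exact le_mul_of_one_le_left (mul_nonneg hR hs0) this
    have h6 : G ^ 2 ≤ m ^ 2 / 4 * R ^ 2 + R * s := by
      rw [hDs] at h2
      have : n = m + 4 := by rw [hm]; ring
      rw [hκ, this] at h2
      nlinarith
    nlinarith [sq_nonneg ((2 / n + 3 / (4 * κ)) * s)]
  have hΓle : κ * D + κ * s ≤ Γ := by
    have h7 : (κ * D + κ * s) * R ≤ Γ * R := by
      refine le_trans ?_ h1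
      rw [hDs]
      nlinarith [mul_nonneg hs0 hs0]
    exact le_of_mul_le_mul_right h7 hR0
  have h8 : a * (3 / (4 * κ)) * s ≤ κ * s := by
    refine mul_le_mul_of_nonneg_right ?_ hs0
    have h9 : 3 / (4 * κ) ≤ 1 := by rw [div_le_one (by positivity)]; linarith
    have h10 : a ≤ κ := by rw [hκ]; nlinarith
    nlinarith
  have h11 := mul_le_mul_of_nonneg_left hGle ha
  have e2 : 2 * a / n = a * (2 / n) := by ring
  rw [e2]
  nlinarith

/-! ### The case of negative real part -/

theorem MemH2.norm_weakLaplacian_le [NeZero d] (hd : 5 ≤ d) {V f u : Space d → ℂ} {z : ℂ}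
    {a : ℝ} (ha : 0 ≤ a) (hsmall : SmallConstant d a) (hV : LocallyIntegrable V volume)
    (hVa : SmallPotential V a) (hf : MemLp (rsq f) 2 volume) (hu : MemH2 u)
    (hs : IsWeakSolution V z f u) (hz : z.re < 0) :
    √(∫ x, ‖weakLaplacian u x‖ ^ 2) ≤ cConst d a * √(∫ x, ‖rsq f x‖ ^ 2) := by
  obtain ⟨g, b, B, hb, hB, hev⟩ := hs.exists_approximation hd ha hV hVa hf hu
  have hd5 : (5 : ℝ) ≤ d := by exact_mod_cast hd
  have hκ := cConst_denom_pos hd ha hsmall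
  rw [cConst_eq hd, one_div, inv_mul_eq_div, le_div_iff₀ hκ, mul_comm]
  set κ := (d : ℝ) * (d - 4) / 4 - 2 * a / d
  set D := √(∫ x, ‖weakLaplacian u x‖ ^ 2)
  set G := √(∫ x, ‖weakGrad u x‖ ^ 2 / ‖x‖ ^ 2)
  have hr := fun n => hu.isRegular_conv (isTest_mollifier d n)
  refine le_of_forall_pos_le_add fun ε hε => ?_
  -- with `D - δ` and `G - δ` in place of `D` and `G` the loss is `(κ + a) δ = ε`
  set δ := ε / (κ + a) with hδ
  have hδ0 : 0 < δ := by positivity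
  have hlap := eventually_lt_sqrt_integral (c := D - δ)
    (H := fun n x => ‖lap (conv (mollifier d n) u) x‖ ^ 2)
    (fun n => ((ContDiff.lap_top (hr n).smooth).continuous.norm.pow 2).aestronglyMeasurable)
    ((integrable_sq_iff hu.memLp_weakLaplacian.1).2 hu.memLp_weakLaplacian)
    (fun x => sq_nonneg _) (fun n x => sq_nonneg _) hu.ae_tendsto_lap
    (Eventually.of_forall fun n => (hr n).sq_lap) (by linarith)
  have hgrad := eventually_lt_sqrt_integral (c := G - δ)
    (fun n => aestronglyMeasurable_smooth_grad (hr n).smooth) (hu.integrable_grad hd)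
    (fun x => by positivity) (fun n x => mul_nonneg (by positivity) (gradSq_nonneg _ _))
    hu.ae_tendsto_grad (Eventually.of_forall fun n => ((hr n).hardy_grad hd).1) (by linarith)
  have hfin : κ * (D - δ) + a * (G - δ) ≤ B := by
    refine ge_of_tendsto hb ?_
    filter_upwards [hev, hlap, hgrad] with n hn hn1 hn2
    obtain ⟨hgc, heq, hgi, hgb⟩ := hn
    obtain ⟨-, r1, r2, r3⟩ := (hr n).rellich_bounds hd hz.le hgc heq hgi
    have h := rellich_algebra hd5 (Real.sqrt_nonneg _) (Real.sqrt_nonneg _) (Real.sqrt_nonneg _)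
      (Real.sqrt_nonneg _) ha (by linarith [hsmall.lt_eighth hd ha]) r1 r2 r3
    change κ * _ + _ ≤ _ at h
    have h1 := mul_le_mul_of_nonneg_left hn1.le hκ.le
    have h2 := mul_le_mul_of_nonneg_left hn2.le ha
    linarith
  have e : (κ + a) * δ = ε := mul_div_cancel₀ ε (by positivity)
  linarith

/-! ### The case of non-negative real part -/

/-- `|∇(e^{-iθ|x|} v)|²` for a weakly differentiable function `v`. -/
noncomputable def weakGaugeGradSq (θ : ℝ) (v : Space d → ℂ) (x : Space d) : ℝ :=
  ∑ i, ‖weakPartial i v x - θ * Complex.I * (x i / ‖x‖) * v x‖ ^ 2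

theorem weakGaugeGradSq_nonneg (θ : ℝ) (v : Space d → ℂ) (x : Space d) :
    0 ≤ weakGaugeGradSq θ v x := Finset.sum_nonneg fun _ _ => by positivity

theorem aestronglyMeasurable_coord_div_norm [NeZero d] (i : Fin d) :
    AEStronglyMeasurable (fun x : Space d => (x i / ‖x‖ : ℂ)) volume :=
  aestronglyMeasurable_of_continuousOn_ne_zero
    (ContinuousOn.div (by fun_prop) (by fun_prop) (fun x hx => by simpa using hx))

theorem norm_coord_div_norm_le (i : Fin d) (x : Space d) : ‖(x i / ‖x‖ : ℂ)‖ ≤ 1 := by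
  rw [norm_div, Complex.norm_real, Complex.norm_real, norm_norm]
  exact div_le_one_of_le₀ (PiLp.norm_apply_le x i) (norm_nonneg _)

theorem gauge_eq_phase (z : ℂ) (v : Space d → ℂ) :
    gauge z v = phase (gaugeFreq (Complex.sqrt z)) v := by
  funext x
  rw [gauge, phase, gaugeFreq]
  congr 2
  push_cast
  ring

theorem MemH1.memLp_gauge_partial [NeZero d] {v : Space d → ℂ} (h : MemH1 v) (θ : ℝ) (i : Fin d) :
    MemLp (fun x => weakPartial i v x - θ * Complex.I * (x i / ‖x‖) * v x) 2 volume := by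
  refine (h.memLp_weakPartial i).sub ?_
  refine (h.1.const_mul (θ * Complex.I)).mono
    (((aestronglyMeasurable_coord_div_norm i).const_mul _).mul h.1.1)
    (Eventually.of_forall fun x => ?_)
  rw [norm_mul, norm_mul _ (v x), norm_mul _ (_ / _ : ℂ)]
  have := norm_coord_div_norm_le i x
  exact mul_le_mul_of_nonneg_right (mul_le_of_le_one_right (norm_nonneg _) this) (norm_nonneg _)

theorem MemH1.phase [NeZero d] {v : Space d → ℂ} (h : MemH1 v) (θ : ℝ) :
    MemH1 (phase θ v) ∧
      ∀ᵐ x, ‖weakGrad (Bilaplacian.phase θ v) x‖ ^ 2 = weakGaugeGradSq θ v x := by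
  have hE : Continuous fun x : Space d => Complex.exp (-(θ * Complex.I) * (‖x‖ : ℂ)) := by fun_prop
  have hp := fun i => (h.hasWeakPartial i).phase θ
  refine ⟨⟨(memLp_congr_norm (hE.aestronglyMeasurable.mul h.1.1) h.1.1
    (Eventually.of_forall fun x => norm_phase θ v x)).2 h.1, fun i => ⟨_, hp i, ?_⟩⟩, ?_⟩
  · have h1 := h.memLp_gauge_partial θ i
    refine (memLp_congr_norm (hE.aestronglyMeasurable.mul h1.1) h1.1
      (Eventually.of_forall fun x => ?_)).2 h1
    rw [Pi.mul_apply, norm_mul, norm_exp_phase, one_mul]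
  · filter_upwards [ae_all_iff.2 fun i => (hp i).weakPartial_ae_eq] with x hx
    rw [norm_weakGrad_sq, weakGaugeGradSq]
    refine Finset.sum_congr rfl fun i _ => ?_
    rw [hx i, norm_mul, norm_exp_phase, one_mul]

theorem MemH1.integrable_weakGaugeGradSq [NeZero d] {v : Space d → ℂ} (h : MemH1 v) (θ : ℝ) :
    Integrable (weakGaugeGradSq θ v) volume :=
  integrable_finsetSum _ fun i _ =>
    (integrable_sq_iff (h.memLp_gauge_partial θ i).1).2 (h.memLp_gauge_partial θ i)

theorem MemH1.normL2_weakGrad_phase [NeZero d] {v : Space d → ℂ} (h : MemH1 v) (θ : ℝ) :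
    normL2 (weakGrad (Bilaplacian.phase θ v)) = ENNReal.ofReal √(∫ x, weakGaugeGradSq θ v x) := by
  obtain ⟨h1, h2⟩ := h.phase θ
  have hm : MemLp (weakGrad (Bilaplacian.phase θ v)) 2 volume :=
    MemLp.of_eval_piLp fun i => h1.memLp_weakPartial i
  rw [normL2_eq hm, integral_congr_ae h2]

theorem sq_sqrt_complex (z : ℂ) : Complex.sqrt z ^ 2 = z := by
  rw [Complex.sqrt]
  exact_mod_cast Complex.cpow_nat_inv_pow z (n := 2) (by norm_num)

theorem abs_im_sqrt_le {z : ℂ} (hz : 0 ≤ z.re) :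
    |(Complex.sqrt z).im| ≤ (Complex.sqrt z).re := by
  have h0 : 0 ≤ (Complex.sqrt z).re := by
    rw [Complex.sqrt, Complex.cpow_inv_two_re]
    positivity
  have h1 := congrArg Complex.re (sq_sqrt_complex z)
  rw [pow_two, Complex.mul_re] at h1
  exact abs_le_of_sq_le_sq (by nlinarith) h0

theorem MemH2.ae_tendsto_gauge (u : Space d → ℂ) (hu : MemH2 u) (θ : ℝ) : ∀ᵐ x : Space d,
    Tendsto (fun n => ∑ j, gaugeGradSq θ (pd j (conv (mollifier d n) u)) x) atTop
      (𝓝 (∑ j, weakGaugeGradSq θ (weakPartial j u) x)) := by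
  filter_upwards [hu.ae_tendsto] with x hx
  exact tendsto_finsetSum _ fun j _ => tendsto_finsetSum _ fun i _ =>
    ((((hx j).2 i).sub ((hx j).1.const_mul _)).norm.pow 2)

/-- The weak form of the estimate for `Re z ≥ 0`: the potential is absorbed by means of the
weighted bound on `∇u / |x|`. -/
theorem MemH2.sqrt_integral_weakGaugeGradSq_le [NeZero d] (hd : 5 ≤ d) {V f u : Space d → ℂ} {z : ℂ}
    {a : ℝ} (ha : 0 ≤ a) (hsmall : SmallConstant d a) (hV : LocallyIntegrable V volume)
    (hVa : SmallPotential V a) (hf : MemLp (rsq f) 2 volume) (hu : MemH2 u)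
    (hs : IsWeakSolution V z f u) (hz : 0 ≤ z.re) :
    √(∫ x, ∑ j, weakGaugeGradSq (gaugeFreq (Complex.sqrt z)) (weakPartial j u) x)
      ≤ 12 / ((d : ℝ) - 4) / (1 - 24 / (((d : ℝ) - 2) * (d - 4)) * a)
        * √(∫ x, ‖rsq f x‖ ^ 2) := by
  obtain ⟨g, b, B, hb, hB, hev⟩ := hs.exists_approximation hd ha hV hVa hf hu
  have hd5 : (5 : ℝ) ≤ d := by exact_mod_cast hd
  have h2 : (0 : ℝ) < d - 2 := by linarith
  have h4 : (0 : ℝ) < d - 4 := by linarith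
  set θ := gaugeFreq (Complex.sqrt z)
  set F := √(∫ x, ‖rsq f x‖ ^ 2)
  set G := √(∫ x, ‖weakGrad u x‖ ^ 2 / ‖x‖ ^ 2)
  have hr := fun n => hu.isRegular_conv (isTest_mollifier d n)
  have hbound : ∀ᶠ n in atTop, 0 ≤ b n ∧
      (∀ j, Integrable (gaugeGradSq θ (pd j (conv (mollifier d n) u))) volume) ∧
      ∑ j, ∫ x, gaugeGradSq θ (pd j (conv (mollifier d n) u)) x ≤ (12 / ((d : ℝ) - 4) * b n) ^ 2 ∧
      ∫ x, ‖x‖ ^ (-2 : ℤ) * gradSq (conv (mollifier d n) u) x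
        ≤ (24 / (((d : ℝ) - 2) * (d - 4)) * b n) ^ 2 := by
    filter_upwards [hev] with n hn
    obtain ⟨hgc, heq, hgi, hgb⟩ := hn
    obtain ⟨r1, r2, -, r4⟩ :=
      (hr n).gauge_bounds hd (sq_sqrt_complex z) (abs_im_sqrt_le hz) hgc heq hgi
    have hbn : ∫ x, ‖x‖ ^ 4 * ‖g n x‖ ^ 2 ≤ b n ^ 2 := (Real.sqrt_le_iff.1 hgb).2
    have hX := r2.trans (mul_le_mul_of_nonneg_left hbn (sq_nonneg _))
    rw [← mul_pow] at hX
    refine ⟨(Real.sqrt_nonneg _).trans hgb, r1, hX, ?_⟩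
    have h5 := r4.trans hX
    rw [← le_div_iff₀' (by positivity), ← div_pow] at h5
    refine h5.trans (le_of_eq ?_)
    congr 1
    field_simp
    ring
  have hB0 : 0 ≤ B := ge_of_tendsto hb (hbound.mono fun n hn => hn.1)
  have hG : G ≤ 24 / (((d : ℝ) - 2) * (d - 4)) * B := by
    refine (Real.sqrt_le_left (by positivity)).2 ?_
    exact (integrable_and_integral_le_of_tendsto
      (fun n => aestronglyMeasurable_smooth_grad (hr n).smooth) hu.aestronglyMeasurable_grad
      (fun x => by positivity) (fun n x => mul_nonneg (by positivity) (gradSq_nonneg _ _))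
      hu.ae_tendsto_grad ((hb.const_mul _).pow 2)
      (hbound.mono fun n hn => ⟨((hr n).hardy_grad hd).1, hn.2.2.2⟩)).2
  have hXB : √(∫ x, ∑ j, weakGaugeGradSq θ (weakPartial j u) x) ≤ 12 / ((d : ℝ) - 4) * B := by
    refine (Real.sqrt_le_left (by positivity)).2 ?_
    refine (integrable_and_integral_le_of_tendsto
      (H := fun n x => ∑ j, gaugeGradSq θ (pd j (conv (mollifier d n) u)) x) ?_ ?_
      (fun x => Finset.sum_nonneg fun j _ => weakGaugeGradSq_nonneg _ _ _)
      (fun n x => Finset.sum_nonneg fun j _ => Finset.sum_nonneg fun i _ => sq_nonneg _)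
      (hu.ae_tendsto_gauge u θ) ((hb.const_mul _).pow 2) ?_).2
    · intro n
      refine Finset.aestronglyMeasurable_fun_sum _ fun j _ =>
        Finset.aestronglyMeasurable_fun_sum _ fun i _ => ?_
      have hs1 := ContDiff.pd_top j (hr n).smooth
      exact ((ContDiff.pd_top i hs1).continuous.aestronglyMeasurable.sub
        (((aestronglyMeasurable_coord_div_norm i).const_mul _).mul
          hs1.continuous.aestronglyMeasurable)).norm.pow 2
    · exact (integrable_finsetSum _ fun j _ => (hu.2 j).integrable_weakGaugeGradSq θ).1
    · filter_upwards [hbound] with n hn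
      refine ⟨integrable_finsetSum _ fun j _ => hn.2.1 j, ?_⟩
      rw [integral_finsetSum _ fun j _ => hn.2.1 j]
      exact hn.2.2.1
  have habs := hsmall.absorb hd ha
  set β := 24 / (((d : ℝ) - 2) * (d - 4))
  have hBF : B ≤ F / (1 - β * a) := by
    rw [le_div_iff₀ (by linarith)]
    nlinarith [mul_le_mul_of_nonneg_left hG ha]
  calc _ ≤ 12 / ((d : ℝ) - 4) * B := hXB
    _ ≤ 12 / ((d : ℝ) - 4) * (F / (1 - β * a)) := by gcongr
    _ = _ := by ring

end Bilaplacian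

theorem theorem1p4 (d : ℕ) (hd : 5 ≤ d)
    (V : Bilaplacian.Space d → ℂ)
    (hV : MeasureTheory.LocallyIntegrable V MeasureTheory.volume)
    (hV2 : Bilaplacian.MemL2Loc (Bilaplacian.rsq V))
    (a : ℝ) (ha : 0 ≤ a)
    (hVa : Bilaplacian.SmallPotential V a)
    (hsmall : Bilaplacian.SmallConstant d a) :
    0 < Bilaplacian.cConst d a ∧
    ∃ c : ℝ, 0 < c ∧
      ∀ (z : ℂ) (f u : Bilaplacian.Space d → ℂ),
        MeasureTheory.MemLp (Bilaplacian.rsq f) 2 MeasureTheory.volume →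
        Bilaplacian.MemH2 u →
        Bilaplacian.IsWeakSolution V z f u →
        (0 ≤ z.re →
          (∀ j, Bilaplacian.MemH1 (Bilaplacian.gauge z (Bilaplacian.weakPartial j u))) ∧
          ∑ j, Bilaplacian.normL2
              (Bilaplacian.weakGrad (Bilaplacian.gauge z (Bilaplacian.weakPartial j u)))
            ≤ ENNReal.ofReal c * Bilaplacian.normL2 (Bilaplacian.rsq f)) ∧
        (z.re < 0 →
          Bilaplacian.normL2 (Bilaplacian.weakLaplacian u)
            ≤ ENNReal.ofReal (Bilaplacian.cConst d a)
              * Bilaplacian.normL2 (Bilaplacian.rsq f)) := by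
  have : NeZero d := ⟨by omega⟩
  have hd5 : (5 : ℝ) ≤ d := by exact_mod_cast hd
  have hc0 : 0 < Bilaplacian.cConst d a := by
    rw [Bilaplacian.cConst_eq hd]
    exact one_div_pos.2 (Bilaplacian.cConst_denom_pos hd ha hsmall)
  have habs := hsmall.absorb hd ha
  set c₀ : ℝ := 12 / ((d : ℝ) - 4) / (1 - 24 / (((d : ℝ) - 2) * (d - 4)) * a) with hc₀
  have hc₀0 : 0 < c₀ := div_pos (div_pos (by norm_num) (by linarith)) (by linarith)
  -- each of the `d` summands is at most the square root of the sum of their squares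
  refine ⟨hc0, d * c₀, by positivity, fun z f u hf hu hs => ⟨fun hz => ⟨fun j => ?_, ?_⟩, fun hz => ?_⟩⟩
  · rw [Bilaplacian.gauge_eq_phase]
    exact ((hu.2 j).phase _).1
  · simp_rw [Bilaplacian.gauge_eq_phase, (hu.2 _).normL2_weakGrad_phase]
    rw [Bilaplacian.normL2_eq hf, ← ENNReal.ofReal_mul (by positivity),
      ← ENNReal.ofReal_sum_of_nonneg fun _ _ => Real.sqrt_nonneg _]
    refine ENNReal.ofReal_le_ofReal ?_
    have h := hu.sqrt_integral_weakGaugeGradSq_le hd ha hsmall hV hVa hf hs hz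
    rw [← hc₀] at h
    set θ := Bilaplacian.gaugeFreq (Complex.sqrt z)
    have hi := fun j => (hu.2 j).integrable_weakGaugeGradSq θ
    calc ∑ j, √(∫ x, Bilaplacian.weakGaugeGradSq θ (Bilaplacian.weakPartial j u) x)
        ≤ ∑ _j : Fin d, c₀ * √(∫ x, ‖Bilaplacian.rsq f x‖ ^ 2) := by
          refine Finset.sum_le_sum fun j _ => le_trans (Real.sqrt_le_sqrt ?_) h
          refine integral_mono (hi j) (integrable_finsetSum _ fun j _ => hi j) fun x => ?_
          exact Finset.single_le_sum
            (f := fun j => Bilaplacian.weakGaugeGradSq θ (Bilaplacian.weakPartial j u) x)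
            (fun j _ => Bilaplacian.weakGaugeGradSq_nonneg _ _ _) (Finset.mem_univ j)
      _ = _ := by rw [Finset.sum_const, Finset.card_univ, Fintype.card_fin, nsmul_eq_mul]; ring
  · rw [Bilaplacian.normL2_eq hf, Bilaplacian.normL2_eq hu.memLp_weakLaplacian,
      ← ENNReal.ofReal_mul hc0.le]
    exact ENNReal.ofReal_le_ofReal
      (hu.norm_weakLaplacian_le hd ha hsmall hV hVa hf hs hz)
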